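/- **Notation.** For a finite sequence $\sigma$, $|\sigma|$ is its length and $\|\sigma\|$ the number of distinct symbols in it. $\sigma\prec\sigma'$ means that $\sigma$ is isomorphic (equal up to an injective renaming of symbols) to a not necessarily contiguous subsequence of $\sigma'$. A sequence $S$ is $r$-sparse if any two occurrences of the same symbol in $S$ are at distance at least $r$. Put $$\mathrm{Ex}(\sigma,n)=\max\{|S| : \sigma\nprec S,\ \|S\|=n,\ S\text{ is }\|\sigma\|\text{-sparse}\}.$$ For $k\ge1$ let $M_k = 1\,2\cdots (k+1)\;k\cdots 1\;2\cdots(k+1)\;k\cdots 1$ (so $M_1=12121$). Let $a_{1,j}=2^j$ for $j\ge1$, $a_{i,1}=2$ for $i\ge 2$, and $a_{i,j}=w\cdot a_{i-1,w}$ with $w=a_{i,j-1}$ for $i,j\ge2$. For $m\ge 1$ let $\alpha(n,m)=\min\{i\ge 1: a_{i,j}\ge m\}$ where $j=\max\{\lceil n/m\rceil,3\}$, and let $\alpha(n)=\alpha(n,n)$. **Class I sequences.** We consider sequences partitioned into blocks, each of which is live, written $(\cdot)$, or dead, written $\langle\cdot\rangle$. All sequences are put in canonical form: their symbols are renamed $1,2,3,\dots$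 in the order of first appearance. If every live block of $T_{\rm top}$ has length $\|T_{\rm mid}\|$, then $T_{\rm top}\circ T_{\rm mid}$ is obtained from $T_{\rm top}$ by replacing each live block $(a_1a_2\cdots)$ with the copy of $T_{\rm mid}$ under the renaming $k\mapsto a_k$; blocks keep their live/dead status. If every live block of $T_{\rm sub}$ has length $l$, where $l$ is the number of live blocks of $T_{\rm bot}$, then the postshuffle $T_{\rm sub}\rhd T_{\rm bot}$ is obtained by replacing each live block $(a_1\cdots a_l)$ of $T_{\rm sub}$ with a copy of $T_{\rm bot}$, over an alphabet of its own, in which $a_p$ has been inserted at the end of the $p$th live block for $1\le p\le l$ (the dead blocks of $T_{\rm sub}$ stay in place); the preshuffle $T_{\rm sub}\lhd T_{\rm bot}$ is defined in the same way, except that $a_p$ is inserted at the beginning of the $p$th live block. For a word $\pi=\pi_1\cdots\pi_{|\pi|}$ over $\{\nearrow,\searrow\}$ with $|\pi|\ge2$ and $\pi_1=\nearrow$, and for $i\ge1$, $j\ge0$, define $T_\pi(i,j)$ as follows. * $T_\pi(i,0)=(\,)(\,)$, two empty live blocks. * If $j\ge1$ and ($|\pi|=2$ or $i=1$), then $T_\pi(i,j)=(1\,2\cdots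 j)\,\langle j\cdots 2\,1\rangle$ if $\pi_{|\pi|}=\searrow$, and $T_\pi(i,j)=(1\,2\cdots j)\,\langle 1\,2\cdots j\rangle$ if $\pi_{|\pi|}=\nearrow$. * If $j\ge1$, $i\ge2$ and $|\pi|\ge3$, let $\pi^-=\pi_1\cdots\pi_{|\pi|-1}$, let $T_{\rm bot}=T_\pi(i,j-1)$, let $T_{\rm mid}=T_{\pi^-}(i,l)$ where $l$ is the number of live blocks of $T_{\rm bot}$, and let $T_{\rm top}=T_\pi(i-1,\|T_{\rm mid}\|)$. Then $T_\pi(i,j)$ is the preshuffle $(T_{\rm top}\circ T_{\rm mid})\lhd T_{\rm bot}$ if $\pi_{|\pi|}=\searrow$, and the postshuffle $(T_{\rm top}\circ T_{\rm mid})\rhd T_{\rm bot}$ if $\pi_{|\pi|}=\nearrow$. **Theorem.** For every $k\ge1$ and every $\pi\in\;\nearrow\{\nearrow,\searrow\}^2\nearrow^k$, $$M_{2^k}\nprec T_\pi(i,j)\qquad\text{for all } i\ge1,\ j\ge0.$$ Moreover, for every fixed $k\ge1$, $\mathrm{Ex}(M_{2^k},n)=\Omega\big(n\,(\alpha(n))^{k+1}\big)$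 as $n\to\infty$, where the implied constant may depend on $k$. -/

import Mathlib

namespace GenDS

/-! ### Sequences, patterns, extremal functions -/

/-- The number `‖w‖` of distinct symbols occurring in the sequence `w`. -/
def alphabetSize {α : Type} [DecidableEq α] (w : List α) : ℕ :=
  w.toFinset.card

/-- `σ ≺ w`: the sequence `σ` is isomorphic to (that is, equal up to an injective renaming of its
alphabet to) a not necessarily contiguous subsequence of `w`. -/
def Contained {α β : Type} (σ : List α) (w : List β) : Prop :=
  ∃ f : α → β, Set.InjOn f {a | a ∈ σ} ∧ (σ.map f).Sublist w

/-- `w` is `r`-sparse: two occurrences of the same symbol are at distance at least `r`. -/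
def Sparse {α : Type} (r : ℕ) (w : List α) : Prop :=
  ∀ (i j : ℕ) (hi : i < w.length) (hj : j < w.length), i < j → w[i] = w[j] → r ≤ j - i

/-- The extremal function `Ex(σ, n)`: the maximum length of a `‖σ‖`-sparse, `σ`-free sequence with
exactly `n` distinct symbols. -/
noncomputable def Ex (σ : List ℕ) (n : ℕ) : ℕ :=
  sSup {l : ℕ | ∃ S : List ℕ, S.length = l ∧ ¬ Contained σ S ∧ alphabetSize S = n ∧
    Sparse (alphabetSize σ) S}

/-- The `M`-shaped sequence `1 2 ⋯ (k+1) k ⋯ 1 2 ⋯ (k+1) k ⋯ 1`. -/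
def mShape (k : ℕ) : List ℕ :=
  List.range' 1 (k + 1) ++ (List.range' 1 k).reverse ++ List.range' 2 k ++
    (List.range' 1 k).reverse

/-! ### Ackermann's function and its inverse -/

/-- Ackermann's function `a i j` for `i, j ≥ 1`: `a 1 j = 2 ^ j`, `a i 1 = 2` for `i ≥ 2`, and
`a i j = w * a (i - 1) w` with `w = a i (j - 1)` for `i, j ≥ 2`.
(The values for `i = 0`, or for `i ≥ 2` and `j = 0`, are irrelevant.) -/
def ackermann : ℕ → ℕ → ℕ
  | 0, _ => 0
  | 1, j => 2 ^ j
  | _ + 2, 0 => 0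
  | _ + 2, 1 => 2
  | i + 2, j + 2 => ackermann (i + 2) (j + 1) * ackermann (i + 1) (ackermann (i + 2) (j + 1))

/-- The two-argument inverse `α(n, m) = min {i ≥ 1 | a i j ≥ m}` with `j = max {⌈n / m⌉, 3}`. -/
noncomputable def alpha₂ (n m : ℕ) : ℕ :=
  sInf {i : ℕ | 1 ≤ i ∧ m ≤ ackermann i (max (n ⌈/⌉ m) 3)}

/-- The inverse-Ackermann function `α(n) = α(n, n)`. -/
noncomputable def alpha (n : ℕ) : ℕ := alpha₂ n n

/-! ### Sequences of live and dead blocks -/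

/-- A block of symbols, designated live (`live = true`) or dead (`live = false`). -/
structure Block (α : Type) where
  live : Bool
  word : List α

/-- A sequence that is partitioned into live and dead blocks. -/
abbrev BlockSeq (α : Type) := List (Block α)

namespace BlockSeq

/-- The underlying sequence of symbols. -/
def word {α : Type} (T : BlockSeq α) : List α := T.flatMap Block.word

/-- The number of live blocks. -/
def numLive {α : Type} (T : BlockSeq α) : ℕ := T.countP Block.live

/-- Renaming of the symbols. -/
def rename {α β : Type} (f : α → β) (T : BlockSeq α) : BlockSeq β :=
  T.map fun B => ⟨B.live, B.word.map f⟩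

/-- The canonical form of `T`: its symbols are renamed `0, 1, 2, …` in the order of their first
appearance, so `a` becomes the number of distinct symbols that precede its first occurrence. -/
def canonical {α : Type} [DecidableEq α] (T : BlockSeq α) : BlockSeq ℕ :=
  T.rename fun a => alphabetSize (T.word.takeWhile fun b => b ≠ a)

/-- Composition `T_top ∘ T_mid`: every live block `B = (a₀, a₁, …)` of `T_top` is replaced with the
copy of `T_mid` under the alphabet mapping `k ↦ a_k`. -/
def comp (top mid : BlockSeq ℕ) : BlockSeq ℕ :=
  top.flatMap fun B => if B.live then mid.rename fun k => B.word.getD k 0 else [B]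

end BlockSeq

/-- A diagonal, ascending or descending. -/
inductive Diag where
  | up
  | down

/-- `insertLive d as T` inserts the `p`-th symbol of `as` into the `p`-th live block of `T`: at the
end of the block if `d` is ascending and at its beginning if `d` is descending. -/
def insertLive {α : Type} (d : Diag) : List α → BlockSeq α → BlockSeq α
  | _, [] => []
  | [], T => T
  | a :: as, B :: T =>
    if B.live then
      (match d with
        | .up => ⟨true, B.word ++ [a]⟩
        | .down => ⟨true, a :: B.word⟩) :: insertLive d as T
    else B :: insertLive d (a :: as) T

/-- The postshuffle (`d` ascending) or preshuffle (`d` descending) of `T_sub` and `T_bot`.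
Every live block `L` of `T_sub` is replaced with a copy of `T_bot`, over an alphabet of its own, into
whose live blocks the symbols of `L` have been inserted; so the dead blocks that follow `L` in `T_sub`
come immediately after that copy. Here `Sum.inl a` is the symbol `a` of `T_sub`, and
`Sum.inr (q, b)` is the symbol `b` in the copy of `T_bot` belonging to the `q`-th block of `T_sub`. -/
def shuffle (d : Diag) (sub bot : BlockSeq ℕ) : BlockSeq (ℕ ⊕ ℕ × ℕ) :=
  sub.zipIdx.flatMap fun Bq =>
    if Bq.1.live then
      insertLive d (Bq.1.word.map Sum.inl)
        (BlockSeq.rename (fun b => (Sum.inr (Bq.2, b) : ℕ ⊕ ℕ × ℕ)) bot)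
    else [⟨false, Bq.1.word.map Sum.inl⟩]

/-! ### The Class I sequences -/

/-- One live block `(1 2 ⋯ j)` followed by one dead block, `⟨1 2 ⋯ j⟩` or `⟨j ⋯ 2 1⟩`
(the symbols being numbered from `0`). -/
def classIBase (d : Diag) (j : ℕ) : BlockSeq ℕ :=
  [⟨true, List.range j⟩,
   ⟨false, match d with
      | .up => List.range j
      | .down => (List.range j).reverse⟩]

/-- The Class I sequence `T_π(i, j)`, for `|π| ≥ 2`, `i ≥ 1`, `j ≥ 0`, in canonical form. -/
def classI (π : List Diag) (i j : ℕ) : BlockSeq ℕ :=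
  if j = 0 then [⟨true, []⟩, ⟨true, []⟩]
  else if π.length ≤ 2 ∨ i ≤ 1 then classIBase (π.getLastD .up) j
  else
    let bot := classI π i (j - 1)
    let mid := classI π.dropLast i bot.numLive
    let top := classI π (i - 1) (alphabetSize mid.word)
    (shuffle (π.getLastD .up) (top.comp mid) bot).canonical
  termination_by (π.length, i, j)
  decreasing_by
    all_goals simp only [Prod.lex_def, List.length_dropLast]
    all_goals simp
    all_goals omega

end GenDS

namespace GenDS

/-! ### Sublists -/

section Lists

variable {α β : Type}

/-! Avoidance follows the recursion for `classI`, and two structural invariants drive it.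
`LiveFirst`: every symbol lies in exactly one live block, which holds its first occurrence.
`LiveOrdered`: after a live block its symbols recur sorted, in the direction given by the last
letter of π, so two of them never alternate as a b a after that block.

Shuffles create nothing new. A copy of T_bot occupies an interval, and a foreign symbol has at most
its first occurrence there (`shuffle_tie`), so a pattern whose symbols interlock enough lies in one
of the two sequences. In a composition, a suitably interlocked pattern either occurs already in
T_top or uses symbols of a single live block B of T_top (`Contained.comp`). In the second case it
splits as σ₁σ₂, with σ₁ in the copy of T_mid and σ₂ among the later dead blocks, where it is sorted
if π ends with ↗.

The heart is the halving step `contained_half` for M_{2h} = σ₁σ₂. If σ₂ is short, σ₁ contains M_h on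
the upper half of the symbols. If σ₂ is longer, its sorted end fixes the order of the lower symbols
in T_mid, and since T_mid is in canonical form their first appearances can be put in front of a part
of σ₁, giving M_h with its symbols reversed. If σ₂ is longer still, it contains 2h, 2h+1, 2h and is
not sorted. Thus one more ↗ doubles the index of the avoided M. The base is |π| = 3
(`classI_three`): there T_mid has every symbol at most twice, and the sequences avoid 12321232 and
12131213, to which the same splitting reduces M_2. The second pattern is not interlocked enough for
shuffles and needs the additional invariant `NoCross`.

The lower bound uses T_π(i,1) with |π| = k+3. By Pascal's rule every symbol occurs at least
i^(k+1)/(k+1)! times (`length_word_classI`), while there are only O(i^k) blocks per symbol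
(`numDead_classI_le`). So for large i, deleting O(1) letters per block makes the sequence sparse and
keeps a constant fraction of it. The alphabet size is bounded by Ackermann's function
(`numLive_classI_le`), which allows i = α(n) − O(k), and disjoint copies fill the n symbols. -/

theorem exists_map_sublist_of_sublist_map {f : α → β} {s : List β} {w : List α}
    (h : s.Sublist (w.map f)) : ∃ s' : List α, s'.Sublist w ∧ s = s'.map f :=
  List.sublist_map_iff.1 h

theorem append_pair_not_nodup {x : α} {w : List α} (h : [x, x].Sublist w) : ¬ w.Nodup := fun hn => by
  have := hn.sublist h
  simp at this

/-- If `u` does not occur in `X`, a sublist of `X ++ Y` starting with `u` lies in `Y`. -/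
theorem sublist_right_of_notMem {X Y s : List α} {u : α} (hu : u ∉ X)
    (h : (u :: s).Sublist (X ++ Y)) : (u :: s).Sublist Y := by
  obtain ⟨a, b, hab, ha, hb⟩ := List.sublist_append_iff.1 h
  cases a with
  | nil => simpa [hab] using hb
  | cons c a =>
    obtain ⟨rfl, -⟩ := List.cons.inj hab
    exact absurd (ha.subset (by simp)) hu

/-- If `u` does not occur in `Y`, a sublist of `X ++ Y` ending with `u` lies in `X`. -/
theorem sublist_left_of_notMem {X Y s : List α} {u : α} (hu : u ∉ Y)
    (h : (s ++ [u]).Sublist (X ++ Y)) : (s ++ [u]).Sublist X := by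
  have := List.reverse_sublist.2 h
  simp only [List.reverse_append, List.reverse_cons, List.reverse_nil, List.nil_append,
    List.singleton_append] at this
  have := sublist_right_of_notMem (by simpa using hu) this
  simpa using List.reverse_sublist.2 this

theorem sublist_right_of_forall {X Y s : List α} (hu : ∀ u ∈ s, u ∉ X)
    (h : s.Sublist (X ++ Y)) : s.Sublist Y := by
  cases s with
  | nil => simp
  | cons u s => exact sublist_right_of_notMem (hu u (by simp)) h

theorem sublist_left_of_forall {X Y s : List α} (hu : ∀ u ∈ s, u ∉ Y)
    (h : s.Sublist (X ++ Y)) : s.Sublist X := by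
  rcases List.eq_nil_or_concat s with rfl | ⟨t, u, rfl⟩
  · simp
  · rw [List.concat_eq_append] at h hu ⊢
    exact sublist_left_of_notMem (hu u (by simp)) h

/-- A left inverse of φ on the letters of w carries the occurrence back. This removes canonical
renamings and the tags of disjoint copies. -/
theorem Contained.of_map {γ : Type} [Nonempty α] {σ : List γ} {w : List α} {φ : α → β}
    (hφ : Set.InjOn φ {a | a ∈ w}) (h : Contained σ (w.map φ)) : Contained σ w := by
  obtain ⟨f, hf, hs⟩ := h
  set ψ := Function.invFunOn φ {a | a ∈ w}
  have hl : Set.LeftInvOn ψ φ {a | a ∈ w} := hφ.leftInvOn_invFunOn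
  refine ⟨ψ ∘ f, ?_, ?_⟩
  · intro a ha b hb hab
    obtain ⟨a', ha', hae⟩ := List.mem_map.1 (hs.subset (List.mem_map_of_mem ha))
    obtain ⟨b', hb', hbe⟩ := List.mem_map.1 (hs.subset (List.mem_map_of_mem hb))
    apply hf ha hb
    simp only [Function.comp] at hab
    rw [← hae, ← hbe, hl ha', hl hb'] at hab
    rw [← hae, ← hbe, hab]
  · have := hs.map ψ
    rw [List.map_map, List.map_map] at this
    convert this
    symm
    conv_rhs => rw [← List.map_id w]
    exact List.map_congr_left fun a ha => hl ha

end Lists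

/-! ### Words of block sequences -/

namespace BlockSeq

variable {α β : Type}

@[simp] theorem word_nil : word ([] : BlockSeq α) = [] := rfl

@[simp] theorem word_cons (B : Block α) (T : BlockSeq α) : word (B :: T) = B.word ++ word T := by
  simp [word]

@[simp] theorem word_append (S T : BlockSeq α) : word (S ++ T) = word S ++ word T := by
  simp [word]

theorem mem_word {T : BlockSeq α} {a : α} : a ∈ T.word ↔ ∃ B ∈ T, a ∈ B.word := by
  simp [word]

@[simp] theorem word_rename (f : α → β) (T : BlockSeq α) : (T.rename f).word = T.word.map f := by
  induction T with
  | nil => rfl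
  | cons B T ih =>
    have : rename f (B :: T) = ⟨B.live, B.word.map f⟩ :: rename f T := rfl
    rw [this, word_cons, ih]; simp

theorem mem_rename {f : α → β} {T : BlockSeq α} {C : Block β} :
    C ∈ T.rename f ↔ ∃ B ∈ T, C = ⟨B.live, B.word.map f⟩ := by
  simp only [rename, List.mem_map]
  exact ⟨fun ⟨B, hB, h⟩ => ⟨B, hB, h.symm⟩, fun ⟨B, hB, h⟩ => ⟨B, hB, h.symm⟩⟩

@[simp] theorem numLive_rename (f : α → β) (T : BlockSeq α) : (T.rename f).numLive = T.numLive := by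
  simp [numLive, rename, List.countP_map, Function.comp_def]

@[simp] theorem numLive_nil : numLive ([] : BlockSeq α) = 0 := rfl

@[simp] theorem numLive_append (S T : BlockSeq α) :
    numLive (S ++ T) = numLive S + numLive T := by simp [numLive]

theorem numLive_cons_live {B : Block α} (h : B.live = true) (T : BlockSeq α) :
    numLive (B :: T) = numLive T + 1 := by simp [numLive, h]

theorem numLive_cons_dead {B : Block α} (h : B.live = false) (T : BlockSeq α) :
    numLive (B :: T) = numLive T := by simp [numLive, h]

end BlockSeq

open BlockSeq

/-! ### Inserting symbols into live blocks -/

/-- The live block obtained from `B` by adding `a` at its end or at its beginning. -/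
def insertBlock {α : Type} (d : Diag) (a : α) (B : Block α) : Block α :=
  match d with
  | .up => ⟨true, B.word ++ [a]⟩
  | .down => ⟨true, a :: B.word⟩

section Insert

variable {α β : Type} {d : Diag}

@[simp] theorem insertBlock_live (a : α) (B : Block α) : (insertBlock d a B).live = true := by
  cases d <;> rfl

theorem mem_insertBlock {a x : α} {B : Block α} :
    x ∈ (insertBlock d a B).word ↔ x = a ∨ x ∈ B.word := by
  cases d <;> simp [insertBlock, or_comm]

theorem insertBlock_length (a : α) (B : Block α) :
    (insertBlock d a B).word.length = B.word.length + 1 := by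
  cases d <;> simp [insertBlock]

@[simp] theorem insertLive_nil_right (as : List α) : insertLive d as [] = [] := by
  cases as <;> rfl

@[simp] theorem insertLive_nil_left (T : BlockSeq α) : insertLive d [] T = T := by
  cases T <;> rfl

theorem insertLive_cons_live {B : Block α} (h : B.live = true) (a : α) (as : List α)
    (T : BlockSeq α) :
    insertLive d (a :: as) (B :: T) = insertBlock d a B :: insertLive d as T := by
  rw [insertLive.eq_def]
  simp only [h, if_true]
  cases d <;> rfl

theorem insertLive_cons_dead {B : Block α} (h : B.live = false) (as : List α)
    (T : BlockSeq α) : insertLive d as (B :: T) = B :: insertLive d as T := by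
  cases as with
  | nil => simp
  | cons a as =>
    rw [insertLive.eq_def]
    simp [h]

theorem mem_insertLive {as : List α} {T : BlockSeq α} {C : Block α} (h : C ∈ insertLive d as T) :
    C ∈ T ∨ ∃ B ∈ T, B.live = true ∧ ∃ a ∈ as, C = insertBlock d a B := by
  induction T generalizing as with
  | nil => simp at h
  | cons B T ih =>
    cases hB : B.live with
    | true =>
      cases as with
      | nil => left; simpa using h
      | cons a as =>
        rw [insertLive_cons_live hB, List.mem_cons] at h
        rcases h with rfl | h
        · exact Or.inr ⟨B, by simp, hB, a, by simp, rfl⟩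
        · rcases ih h with h | ⟨B', hB', hl, a', ha', he⟩
          · exact Or.inl (by simp [h])
          · exact Or.inr ⟨B', by simp [hB'], hl, a', by simp [ha'], he⟩
    | false =>
      rw [insertLive_cons_dead hB, List.mem_cons] at h
      rcases h with rfl | h
      · exact Or.inl (by simp)
      · rcases ih h with h | ⟨B', hB', hl, a', ha', he⟩
        · exact Or.inl (by simp [h])
        · exact Or.inr ⟨B', by simp [hB'], hl, a', ha', he⟩

theorem mem_insertLive_live {as : List α} {T : BlockSeq α} {C : Block α}
    (has : as.length = T.numLive) (h : C ∈ insertLive d as T) (hC : C.live = true) :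
    ∃ B ∈ T, B.live = true ∧ ∃ a ∈ as, C = insertBlock d a B := by
  induction T generalizing as with
  | nil => simp at h
  | cons B T ih =>
    cases hB : B.live with
    | true =>
      cases as with
      | nil => simp [numLive_cons_live hB] at has
      | cons a as =>
        rw [insertLive_cons_live hB, List.mem_cons] at h
        rcases h with rfl | h
        · exact ⟨B, by simp, hB, a, by simp, rfl⟩
        · rw [numLive_cons_live hB] at has
          obtain ⟨B', hB', hl, a', ha', he⟩ := ih (by simpa using has) h
          exact ⟨B', by simp [hB'], hl, a', by simp [ha'], he⟩
    | false =>
      rw [insertLive_cons_dead hB, List.mem_cons] at h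
      rcases h with rfl | h
      · simp [hB] at hC
      · rw [numLive_cons_dead hB] at has
        obtain ⟨B', hB', hl, a', ha', he⟩ := ih has h
        exact ⟨B', by simp [hB'], hl, a', ha', he⟩

theorem numLive_insertLive (as : List α) (T : BlockSeq α) :
    (insertLive d as T).numLive = T.numLive := by
  induction T generalizing as with
  | nil => simp
  | cons B T ih =>
    cases hB : B.live with
    | true =>
      cases as with
      | nil => simp
      | cons a as =>
        rw [insertLive_cons_live hB, numLive_cons_live (by simp), numLive_cons_live hB, ih]
    | false => rw [insertLive_cons_dead hB, numLive_cons_dead hB, numLive_cons_dead hB, ih]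

/-- The inserted symbols form a subsequence of the resulting word. -/
theorem filterMap_insertLive_of_word {p : α → Option β} {as : List α} {T : BlockSeq α}
    (hT : ∀ x ∈ T.word, p x = none) (has : as.length ≤ T.numLive) :
    (insertLive d as T).word.filterMap p = as.filterMap p := by
  induction T generalizing as with
  | nil =>
    have : as = [] := by simpa using has
    simp [this]
  | cons B T ih =>
    simp only [word_cons, List.mem_append] at hT
    have h1 : B.word.filterMap p = [] := by
      rw [List.filterMap_eq_nil_iff]; exact fun a ha => hT a (Or.inl ha)
    cases hB : B.live with
    | true =>
      cases as with
      | nil =>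
        have : (word T).filterMap p = [] := by
          rw [List.filterMap_eq_nil_iff]; exact fun a ha => hT a (Or.inr ha)
        simp [h1, this]
      | cons a as =>
        rw [numLive_cons_live hB] at has
        rw [insertLive_cons_live hB, word_cons, List.filterMap_append,
          ih (fun x hx => hT x (Or.inr hx)) (by simpa using has)]
        have h2 : (insertBlock d a B).word.filterMap p = [a].filterMap p := by
          cases d
          · simp [insertBlock, h1]
          · change (([a] : List α) ++ B.word).filterMap p = _
            rw [List.filterMap_append, h1, List.append_nil]
        rw [h2, ← List.filterMap_append]; rfl
    | false =>
      rw [numLive_cons_dead hB] at has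
      rw [insertLive_cons_dead hB, word_cons, List.filterMap_append, h1,
          ih (fun x hx => hT x (Or.inr hx)) has]
      rfl

/-- Removing the inserted symbols gives the original word. -/
theorem filterMap_insertLive_of_symbols {p : α → Option β} {as : List α} {T : BlockSeq α}
    (has : ∀ a ∈ as, p a = none) :
    (insertLive d as T).word.filterMap p = T.word.filterMap p := by
  induction T generalizing as with
  | nil => simp
  | cons B T ih =>
    cases hB : B.live with
    | true =>
      cases as with
      | nil => simp
      | cons a as =>
        rw [insertLive_cons_live hB, word_cons, List.filterMap_append,
          ih (fun x hx => has x (by simp [hx]))]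
        have h2 : (insertBlock d a B).word.filterMap p = B.word.filterMap p := by
          cases d <;> simp [insertBlock, List.filterMap_append, has a (by simp)]
        rw [h2, word_cons, List.filterMap_append]
    | false =>
      rw [insertLive_cons_dead hB, word_cons, word_cons, List.filterMap_append,
        List.filterMap_append, ih has]

theorem mem_word_insertLive {as : List α} {T : BlockSeq α} {x : α}
    (h : x ∈ (insertLive d as T).word) : x ∈ as ∨ x ∈ T.word := by
  obtain ⟨C, hC, hx⟩ := mem_word.1 h
  rcases mem_insertLive hC with h | ⟨B, hB, -, a, ha, rfl⟩
  · exact Or.inr (mem_word.2 ⟨C, h, hx⟩)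
  · rcases mem_insertBlock.1 hx with rfl | h
    · exact Or.inl ha
    · exact Or.inr (mem_word.2 ⟨B, hB, h⟩)

end Insert

/-! ### Shuffles -/

/-- The part of a shuffle that replaces the block `B` with index `q`. -/
def shufflePiece (d : Diag) (bot : BlockSeq ℕ) (q : ℕ) (B : Block ℕ) : BlockSeq (ℕ ⊕ ℕ × ℕ) :=
  if B.live then
    insertLive d (B.word.map Sum.inl)
      (BlockSeq.rename (fun b => (Sum.inr (q, b) : ℕ ⊕ ℕ × ℕ)) bot)
  else [⟨false, B.word.map Sum.inl⟩]

/-- The shuffle in which the blocks of the first sequence are numbered from `n`. -/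
def shuffleFrom (d : Diag) (bot : BlockSeq ℕ) (n : ℕ) (sub : BlockSeq ℕ) :
    BlockSeq (ℕ ⊕ ℕ × ℕ) :=
  (sub.zipIdx n).flatMap fun Bq => shufflePiece d bot Bq.2 Bq.1

/-- The symbol of the first sequence of a shuffle, if it is one. -/
def subSymbol : ℕ ⊕ ℕ × ℕ → Option ℕ
  | .inl a => some a
  | .inr _ => none

/-- The symbol of the copy number `q` of the second sequence of a shuffle, if it is one. -/
def copySymbol (q : ℕ) : ℕ ⊕ ℕ × ℕ → Option ℕ
  | .inl _ => none
  | .inr (r, b) => if r = q then some b else none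

section Shuffle

variable {d : Diag} {bot sub : BlockSeq ℕ}

theorem shuffle_eq : shuffle d sub bot = shuffleFrom d bot 0 sub := rfl

@[simp] theorem shuffleFrom_nil (n : ℕ) : shuffleFrom d bot n [] = [] := rfl

theorem shuffleFrom_cons (n : ℕ) (B : Block ℕ) :
    shuffleFrom d bot n (B :: sub) = shufflePiece d bot n B ++ shuffleFrom d bot (n + 1) sub := by
  simp [shuffleFrom]

theorem shuffleFrom_append (n : ℕ) (P Q : BlockSeq ℕ) :
    shuffleFrom d bot n (P ++ Q) =
      shuffleFrom d bot n P ++ shuffleFrom d bot (n + P.length) Q := by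
  simp [shuffleFrom, List.zipIdx_append]

theorem shufflePiece_live {q : ℕ} {B : Block ℕ} (h : B.live = true) :
    shufflePiece d bot q B = insertLive d (B.word.map Sum.inl)
      (BlockSeq.rename (fun b => (Sum.inr (q, b) : ℕ ⊕ ℕ × ℕ)) bot) := by
  simp [shufflePiece, h]

theorem shufflePiece_dead {q : ℕ} {B : Block ℕ} (h : B.live = false) :
    shufflePiece d bot q B = [⟨false, B.word.map Sum.inl⟩] := by
  simp [shufflePiece, h]

theorem filterMap_subSymbol_inl (w : List ℕ) : (w.map Sum.inl).filterMap subSymbol = w := by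
  rw [List.filterMap_map]; exact List.filterMap_some

theorem filterMap_copySymbol_inr (q : ℕ) (w : List ℕ) :
    (w.map fun b => (Sum.inr (q, b) : ℕ ⊕ ℕ × ℕ)).filterMap (copySymbol q) = w := by
  rw [List.filterMap_map]
  have : (copySymbol q ∘ fun b => (Sum.inr (q, b) : ℕ ⊕ ℕ × ℕ)) = some := by
    funext b; simp [copySymbol]
  rw [this, List.filterMap_some]

theorem filterMap_subSymbol_shufflePiece (q : ℕ) {B : Block ℕ}
    (h : B.live = true → B.word.length = bot.numLive) :
    (shufflePiece d bot q B).word.filterMap subSymbol = B.word := by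
  cases hB : B.live with
  | true =>
    rw [shufflePiece_live hB, filterMap_insertLive_of_word, filterMap_subSymbol_inl]
    · simp only [word_rename, List.mem_map]
      rintro x ⟨b, -, rfl⟩
      rfl
    · simp [h hB]
  | false => simp [shufflePiece_dead hB, filterMap_subSymbol_inl, -List.filterMap_map]

theorem filterMap_subSymbol_shuffleFrom (n : ℕ)
    (h : ∀ B ∈ sub, B.live = true → B.word.length = bot.numLive) :
    (shuffleFrom d bot n sub).word.filterMap subSymbol = sub.word := by
  induction sub generalizing n with
  | nil => simp
  | cons B sub ih =>
    rw [shuffleFrom_cons, word_append, List.filterMap_append, word_cons,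
      filterMap_subSymbol_shufflePiece n (h B (by simp)),
      ih _ fun B hB => h B (by simp [hB])]

theorem filterMap_copySymbol_shufflePiece {q : ℕ} {B : Block ℕ} (h : B.live = true) :
    (shufflePiece d bot q B).word.filterMap (copySymbol q) = bot.word := by
  rw [shufflePiece_live h, filterMap_insertLive_of_symbols, word_rename, filterMap_copySymbol_inr]
  simp only [List.mem_map]
  rintro a ⟨b, -, rfl⟩
  rfl

theorem inl_mem_shufflePiece {q a : ℕ} {B : Block ℕ}
    (h : Sum.inl a ∈ (shufflePiece d bot q B).word) : a ∈ B.word := by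
  cases hB : B.live with
  | true =>
    rw [shufflePiece_live hB] at h
    rcases mem_word_insertLive h with h | h
    · simpa using h
    · simp at h
  | false => simpa [shufflePiece_dead hB] using h

theorem inr_mem_shufflePiece {q r b : ℕ} {B : Block ℕ}
    (h : Sum.inr (r, b) ∈ (shufflePiece d bot q B).word) :
    r = q ∧ B.live = true ∧ b ∈ bot.word := by
  cases hB : B.live with
  | true =>
    rw [shufflePiece_live hB] at h
    rcases mem_word_insertLive h with h | h
    · simp at h
    · simp only [word_rename, List.mem_map, Sum.inr.injEq, Prod.mk.injEq] at h
      obtain ⟨c, hc, rfl, rfl⟩ := h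
      exact ⟨rfl, rfl, hc⟩
  | false => simp [shufflePiece_dead hB] at h

theorem inl_mem_shuffleFrom {n a : ℕ} (h : Sum.inl a ∈ (shuffleFrom d bot n sub).word) :
    a ∈ sub.word := by
  induction sub generalizing n with
  | nil => simp at h
  | cons B sub ih =>
    rw [shuffleFrom_cons, word_append, List.mem_append] at h
    rw [word_cons, List.mem_append]
    exact h.imp inl_mem_shufflePiece ih

theorem inr_mem_shuffleFrom {n q b : ℕ} (h : Sum.inr (q, b) ∈ (shuffleFrom d bot n sub).word) :
    ∃ P B Q, sub = P ++ B :: Q ∧ n + P.length = q ∧ B.live = true ∧ b ∈ bot.word := by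
  induction sub generalizing n with
  | nil => simp at h
  | cons B sub ih =>
    rw [shuffleFrom_cons, word_append, List.mem_append] at h
    rcases h with h | h
    · obtain ⟨rfl, hB, hb⟩ := inr_mem_shufflePiece h
      exact ⟨[], B, sub, rfl, rfl, hB, hb⟩
    · obtain ⟨P, C, Q, rfl, hP, hC⟩ := ih h
      exact ⟨B :: P, C, Q, rfl, by simp; omega, hC⟩

theorem inr_notMem_shuffleFrom {n q b : ℕ} (h : q < n ∨ n + sub.length ≤ q) :
    Sum.inr (q, b) ∉ (shuffleFrom d bot n sub).word := fun hm => by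
  obtain ⟨P, B, Q, rfl, hP, -⟩ := inr_mem_shuffleFrom hm
  simp at h
  omega

/-- Symbols of a copy of the second sequence occur only within that copy. -/
theorem exists_word_shuffle {q b : ℕ} (h : Sum.inr (q, b) ∈ (shuffle d sub bot).word) :
    ∃ P B Q, sub = P ++ B :: Q ∧ P.length = q ∧ B.live = true ∧
      (shuffle d sub bot).word = (shuffleFrom d bot 0 P).word ++
        ((shufflePiece d bot q B).word ++ (shuffleFrom d bot (q + 1) Q).word) ∧
      (∀ b, Sum.inr (q, b) ∉ (shuffleFrom d bot 0 P).word) ∧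
      (∀ b, Sum.inr (q, b) ∉ (shuffleFrom d bot (q + 1) Q).word) := by
  obtain ⟨P, B, Q, rfl, hP, hB, -⟩ := inr_mem_shuffleFrom h
  rw [Nat.zero_add] at hP
  refine ⟨P, B, Q, rfl, hP, hB, ?_, fun b => inr_notMem_shuffleFrom (by omega),
    fun b => inr_notMem_shuffleFrom (by omega)⟩
  rw [shuffle_eq, shuffleFrom_append, shuffleFrom_cons, word_append, word_append]
  simp [hP]

theorem sublist_sub_of_map_inl {s : List ℕ}
    (h : ∀ B ∈ sub, B.live = true → B.word.length = bot.numLive)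
    (hs : (s.map Sum.inl).Sublist (shuffle d sub bot).word) : s.Sublist sub.word := by
  have := hs.filterMap subSymbol
  rwa [filterMap_subSymbol_inl, shuffle_eq, filterMap_subSymbol_shuffleFrom 0 h] at this

theorem sublist_bot_of_map_inr {s : List ℕ} {q : ℕ}
    (hs : (s.map fun b => (Sum.inr (q, b) : ℕ ⊕ ℕ × ℕ)).Sublist (shuffle d sub bot).word) :
    s.Sublist bot.word := by
  cases s with
  | nil => simp
  | cons b s =>
    obtain ⟨P, B, Q, rfl, hP, hB, hW, h1, h2⟩ := exists_word_shuffle (q := q) (b := b) (hs.subset (by simp))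
    rw [hW] at hs
    have := sublist_left_of_forall (by simp_all) (sublist_right_of_forall (by simp_all) hs)
    have := this.filterMap (copySymbol q)
    rwa [filterMap_copySymbol_inr, filterMap_copySymbol_shufflePiece hB] at this

end Shuffle

/-! ### Block sequences in which live occurrences come first -/

/-- Every symbol occurs in exactly one live block, which contains its first occurrence, and symbols
are not repeated within a block. -/
structure LiveFirst {α : Type} (T : BlockSeq α) : Prop where
  pairwise : T.Pairwise fun B C => C.live = true → List.Disjoint B.word C.word
  nodup : ∀ B ∈ T, B.word.Nodup
  exists_live : ∀ a ∈ T.word, ∃ B ∈ T, B.live = true ∧ a ∈ B.word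

namespace LiveFirst

variable {α β : Type} {P Q T : BlockSeq α} {B : Block α}

theorem notMem_left (h : LiveFirst (P ++ B :: Q)) (hB : B.live = true) {a : α} (ha : a ∈ B.word) :
    a ∉ P.word := fun hP => by
  obtain ⟨C, hC, haC⟩ := mem_word.1 hP
  exact (List.pairwise_append.1 h.pairwise).2.2 C hC B (by simp) hB haC ha

theorem notMem_live_right (h : LiveFirst (P ++ B :: Q)) {a : α} (ha : a ∈ B.word) :
    ∀ C ∈ Q, C.live = true → a ∉ C.word := fun C hC hl haC =>
  (List.pairwise_cons.1 (List.pairwise_append.1 h.pairwise).2.1).1 C hC hl ha haC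

theorem rename {f : α → β} (h : LiveFirst T) (hf : Set.InjOn f {a | a ∈ T.word}) :
    LiveFirst (T.rename f) where
  pairwise := by
    rw [BlockSeq.rename, List.pairwise_map]
    refine h.pairwise.imp_of_mem fun {B C} hB hC hBC hl => ?_
    rw [List.disjoint_left]
    simp only [List.mem_map]
    rintro _ ⟨a, ha, rfl⟩ ⟨b, hb, hab⟩
    have := hf (mem_word.2 ⟨C, hC, hb⟩) (mem_word.2 ⟨B, hB, ha⟩) hab
    subst this
    exact hBC hl ha hb
  nodup := by
    intro C hC
    obtain ⟨B, hB, rfl⟩ := mem_rename.1 hC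
    refine (h.nodup B hB).map_on fun x hx y hy hxy => ?_
    exact hf (mem_word.2 ⟨B, hB, hx⟩) (mem_word.2 ⟨B, hB, hy⟩) hxy
  exists_live := by
    intro a ha
    rw [word_rename, List.mem_map] at ha
    obtain ⟨b, hb, rfl⟩ := ha
    obtain ⟨B, hB, hl, hbB⟩ := h.exists_live b hb
    exact ⟨⟨B.live, B.word.map f⟩, mem_rename.2 ⟨B, hB, rfl⟩, hl, List.mem_map_of_mem hbB⟩

end LiveFirst

/-! ### The live-first property under insertion -/

section Insert

variable {α : Type} {d : Diag}

theorem exists_mem_insertLive_of_mem {as : List α} {T : BlockSeq α} (h : as.length ≤ T.numLive)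
    {a : α} (ha : a ∈ as) : ∃ C ∈ insertLive d as T, C.live = true ∧ a ∈ C.word := by
  induction T generalizing as with
  | nil =>
    have : as = [] := by simpa using h
    simp [this] at ha
  | cons B T ih =>
    cases hB : B.live with
    | true =>
      cases as with
      | nil => simp at ha
      | cons b as =>
        rw [insertLive_cons_live hB]
        rw [numLive_cons_live hB] at h
        rcases List.mem_cons.1 ha with rfl | ha
        · exact ⟨_, List.mem_cons_self, by simp, mem_insertBlock.2 (Or.inl rfl)⟩
        · obtain ⟨C, hC, hl⟩ := ih (by simpa using h) ha
          exact ⟨C, List.mem_cons_of_mem _ hC, hl⟩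
    | false =>
      rw [insertLive_cons_dead hB]
      rw [numLive_cons_dead hB] at h
      obtain ⟨C, hC, hl⟩ := ih h ha
      exact ⟨C, List.mem_cons_of_mem _ hC, hl⟩

theorem exists_mem_insertLive_of_live (as : List α) {T : BlockSeq α} {B : Block α} (hB : B ∈ T)
    (hl : B.live = true) :
    ∃ C ∈ insertLive d as T, C.live = true ∧ ∀ a ∈ B.word, a ∈ C.word := by
  induction T generalizing as with
  | nil => simp at hB
  | cons D T ih =>
    cases hD : D.live with
    | true =>
      cases as with
      | nil => exact ⟨B, by simpa using hB, hl, fun _ h => h⟩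
      | cons b as =>
        rw [insertLive_cons_live hD]
        rcases List.mem_cons.1 hB with rfl | hB
        · exact ⟨_, List.mem_cons_self, by simp, fun a ha => mem_insertBlock.2 (Or.inr ha)⟩
        · obtain ⟨C, hC, hl⟩ := ih as hB
          exact ⟨C, List.mem_cons_of_mem _ hC, hl⟩
    | false =>
      rw [insertLive_cons_dead hD]
      rcases List.mem_cons.1 hB with rfl | hB
      · simp [hD] at hl
      · obtain ⟨C, hC, hl⟩ := ih as hB
        exact ⟨C, List.mem_cons_of_mem _ hC, hl⟩

theorem LiveFirst.insertLive {as : List α} {T : BlockSeq α} (hT : LiveFirst T) (has : as.Nodup)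
    (hd : List.Disjoint as T.word) (hl : as.length ≤ T.numLive) :
    LiveFirst (insertLive d as T) where
  pairwise := by
    obtain ⟨hp, -, -⟩ := hT
    clear hl
    induction T generalizing as with
    | nil => simp
    | cons B T ih =>
      rw [List.pairwise_cons] at hp
      have hdT : List.Disjoint as (word T) := fun a ha hb => hd ha (by simp [hb])
      cases hB : B.live with
      | true =>
        cases as with
        | nil => simpa using hp
        | cons b as =>
          rw [insertLive_cons_live hB, List.pairwise_cons]
          have hdT' : List.Disjoint as (word T) := fun a ha hb => hdT (by simp [ha]) hb
          refine ⟨fun C hC hCl x hx hxC => ?_, ih has.of_cons hdT' hp.2⟩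
          rcases mem_insertBlock.1 hx with rfl | hx
          · rcases mem_word_insertLive (mem_word.2 ⟨C, hC, hxC⟩) with h | h
            · exact (List.nodup_cons.1 has).1 h
            · exact hdT (by simp) h
          · rcases mem_insertLive hC with h | ⟨D, hD, hDl, a, ha, rfl⟩
            · exact hp.1 C h hCl hx hxC
            · rcases mem_insertBlock.1 hxC with rfl | hxD
              · exact hd (List.mem_cons_of_mem _ ha) (by simp [hx])
              · exact hp.1 D hD hDl hx hxD
      | false =>
        rw [insertLive_cons_dead hB, List.pairwise_cons]
        refine ⟨fun C hC hCl x hx hxC => ?_, ih has hdT hp.2⟩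
        rcases mem_insertLive hC with h | ⟨D, hD, hDl, a, ha, rfl⟩
        · exact hp.1 C h hCl hx hxC
        · rcases mem_insertBlock.1 hxC with rfl | hxD
          · exact hd ha (by simp [hx])
          · exact hp.1 D hD hDl hx hxD
  nodup := by
    intro C hC
    rcases mem_insertLive hC with h | ⟨D, hD, hDl, a, ha, rfl⟩
    · exact hT.nodup C h
    · have h1 := hT.nodup D hD
      have h2 : a ∉ D.word := fun h => hd ha (mem_word.2 ⟨D, hD, h⟩)
      cases d
      · simp only [insertBlock]
        rw [List.nodup_append]
        simp only [h1, List.nodup_singleton, List.mem_singleton, true_and]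
        rintro x hx y rfl rfl
        exact h2 hx
      · exact List.nodup_cons.2 ⟨h2, h1⟩
  exists_live := by
    intro a ha
    rcases mem_word_insertLive ha with h | h
    · exact exists_mem_insertLive_of_mem hl h
    · obtain ⟨B, hB, hBl, haB⟩ := hT.exists_live a h
      obtain ⟨C, hC, hCl, hBC⟩ := exists_mem_insertLive_of_live (d := d) as hB hBl
      exact ⟨C, hC, hCl, hBC a haB⟩

end Insert

/-! ### The live-first property under shuffles, and patterns in shuffles -/

section Shuffle

variable {d : Diag} {bot sub : BlockSeq ℕ}

theorem mem_shuffleFrom {n : ℕ} {C : Block (ℕ ⊕ ℕ × ℕ)} (h : C ∈ shuffleFrom d bot n sub) :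
    ∃ q, ∃ B ∈ sub, C ∈ shufflePiece d bot q B := by
  induction sub generalizing n with
  | nil => simp at h
  | cons B sub ih =>
    rw [shuffleFrom_cons, List.mem_append] at h
    rcases h with h | h
    · exact ⟨n, B, by simp, h⟩
    · obtain ⟨q, B, hB, hC⟩ := ih h
      exact ⟨q, B, by simp [hB], hC⟩

theorem injective_inr_pair (q : ℕ) :
    Function.Injective fun b : ℕ => (Sum.inr (q, b) : ℕ ⊕ ℕ × ℕ) := fun a b h => by
  simpa using h

theorem LiveFirst.shufflePiece {B : Block ℕ} {q : ℕ} (hbot : LiveFirst bot)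
    (hn : B.word.Nodup) (hl : B.live = true) (hlen : B.word.length = bot.numLive) :
    LiveFirst (shufflePiece d bot q B) := by
  rw [shufflePiece_live hl]
  apply LiveFirst.insertLive
  · exact hbot.rename (injective_inr_pair q).injOn
  · exact hn.map Sum.inl_injective
  · rw [List.disjoint_left]
    simp only [word_rename, List.mem_map]
    rintro _ ⟨a, -, rfl⟩ ⟨b, -, h⟩
    cases h
  · simp [hlen]

theorem LiveFirst.shuffle (hbot : LiveFirst bot) (hsub : LiveFirst sub)
    (hlen : ∀ B ∈ sub, B.live = true → B.word.length = bot.numLive) :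
    LiveFirst (shuffle d sub bot) where
  pairwise := by
    rw [shuffle_eq]
    generalize 0 = n
    obtain ⟨hp, hn, -⟩ := hsub
    induction sub generalizing n with
    | nil => simp
    | cons B sub ih =>
      rw [List.pairwise_cons] at hp
      rw [shuffleFrom_cons, List.pairwise_append]
      refine ⟨?_, ih (fun B hB => hlen B (by simp [hB])) _ hp.2 (fun B hB => hn B (by simp [hB])),
        fun x hx y hy hyl a hax hay => ?_⟩
      · cases hB : B.live with
        | true => exact (LiveFirst.shufflePiece hbot (hn B (by simp)) hB (hlen B (by simp) hB)).pairwise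
        | false => simp [shufflePiece_dead hB]
      -- Pieces replacing different blocks can share only symbols of `sub`, because each copy of
      -- `bot` has its own alphabet.
      · rcases a with a | ⟨r, b⟩
        · have h1 := inl_mem_shufflePiece (mem_word.2 ⟨x, hx, hax⟩)
          obtain ⟨q, C, hC, hyC⟩ := mem_shuffleFrom hy
          have h2 := inl_mem_shufflePiece (mem_word.2 ⟨y, hyC, hay⟩)
          cases hCl : C.live with
          | true => exact hp.1 C hC hCl h1 h2
          | false =>
            rw [shufflePiece_dead hCl, List.mem_singleton] at hyC
            simp [hyC] at hyl
        · obtain ⟨rfl, -, -⟩ := inr_mem_shufflePiece (mem_word.2 ⟨x, hx, hax⟩)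
          exact inr_notMem_shuffleFrom (by omega) (mem_word.2 ⟨y, hy, hay⟩)
  nodup := by
    intro C hC
    obtain ⟨q, B, hB, hCB⟩ := mem_shuffleFrom hC
    cases hl : B.live with
    | true => exact (LiveFirst.shufflePiece hbot (hsub.nodup B hB) hl (hlen B hB hl)).nodup C hCB
    | false =>
      rw [shufflePiece_dead hl, List.mem_singleton] at hCB
      rw [hCB]
      exact (hsub.nodup B hB).map Sum.inl_injective
  exists_live := by
    have key : ∀ B ∈ sub, B.live = true → ∃ P Q : BlockSeq (ℕ ⊕ ℕ × ℕ), ∃ q,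
        GenDS.shuffle d sub bot = P ++ GenDS.shufflePiece d bot q B ++ Q := by
      intro B hB _
      obtain ⟨P, Q, rfl⟩ := List.append_of_mem hB
      exact ⟨shuffleFrom d bot 0 P, shuffleFrom d bot (0 + P.length + 1) Q, 0 + P.length, by
        rw [shuffle_eq, shuffleFrom_append, shuffleFrom_cons, List.append_assoc]⟩
    rintro (a | ⟨q, b⟩) ha
    · obtain ⟨B, hB, hl, haB⟩ := hsub.exists_live a (inl_mem_shuffleFrom ha)
      obtain ⟨P, Q, q, h⟩ := key B hB hl
      obtain ⟨C, hC, hCl, haC⟩ := exists_mem_insertLive_of_mem (d := d)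
        (as := B.word.map Sum.inl) (T := bot.rename fun b => (Sum.inr (q, b) : ℕ ⊕ ℕ × ℕ))
        (by simp [hlen B hB hl]) (List.mem_map_of_mem haB)
      rw [← shufflePiece_live hl] at hC
      exact ⟨C, by rw [h]; simp [hC], hCl, haC⟩
    · obtain ⟨P, B, Q, rfl, rfl, hl, hb⟩ := inr_mem_shuffleFrom ha
      obtain ⟨C, hC, hCl, haC⟩ := (LiveFirst.shufflePiece (d := d) (q := 0 + P.length) hbot (hsub.nodup B (by simp))
        hl (hlen B (by simp) hl)).exists_live (Sum.inr (0 + P.length, b)) (by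
          have : b ∈ (GenDS.shufflePiece d bot (0 + P.length) B).word.filterMap
            (copySymbol (0 + P.length)) := by
            rwa [filterMap_copySymbol_shufflePiece hl]
          obtain ⟨x, hx, hxb⟩ := List.mem_filterMap.1 this
          rcases x with x | ⟨r, c⟩
          · simp [copySymbol] at hxb
          · simp only [copySymbol] at hxb
            split_ifs at hxb with h
            simp only [Option.some.injEq] at hxb
            rwa [h, hxb] at hx)
      refine ⟨C, ?_, hCl, haC⟩
      rw [shuffle_eq, shuffleFrom_append, shuffleFrom_cons]
      simp only [List.mem_append]
      exact Or.inr (Or.inl hC)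

/-- If `v` has a non-first occurrence between two occurrences of a symbol of a copy of the second
sequence of a shuffle, then `v` belongs to the same copy. -/
theorem shuffle_tie (hsub : LiveFirst sub)
    (hlen : ∀ B ∈ sub, B.live = true → B.word.length = bot.numLive) {q b : ℕ} {v : ℕ ⊕ ℕ × ℕ}
    (h : [v, Sum.inr (q, b), v, Sum.inr (q, b)].Sublist (shuffle d sub bot).word ∨
      [Sum.inr (q, b), v, v, Sum.inr (q, b)].Sublist (shuffle d sub bot).word) :
    ∃ c, v = Sum.inr (q, c) := by
  set u : ℕ ⊕ ℕ × ℕ := Sum.inr (q, b) with hu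
  have hm : Sum.inr (q, b) ∈ (shuffle d sub bot).word := by
    rcases h with h | h <;> exact h.subset (by simp [hu])
  obtain ⟨P, B, Q, rfl, hP, hB, hW, h1, h2⟩ := exists_word_shuffle hm
  have huP := h1 b
  have huQ := h2 b
  rw [hW] at h
  set X := (shuffleFrom d bot 0 P).word with hX
  set I := (shufflePiece d bot q B).word with hI
  set Y := (shuffleFrom d bot (q + 1) Q).word
  -- All occurrences of u lie in the interval I, so v has an occurrence in I that is preceded by
  -- another v, either before I or within I.
  have key : v ∈ I ∧ (v ∈ X ∨ [v, v].Sublist I) := by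
    rcases h with h | h
    · have h3 : [v, u].Sublist I := by
        have : [u, v, u].Sublist (X ++ (I ++ Y)) := (List.sublist_cons_self _ _).trans h
        have := sublist_right_of_notMem huP this
        exact (List.sublist_cons_self _ _).trans (sublist_left_of_notMem (s := [u, v]) huQ this)
      refine ⟨h3.subset (by simp), ?_⟩
      by_contra! hcon
      have h4 := sublist_right_of_notMem hcon.1 h
      have h5 := sublist_left_of_notMem (s := [v, u, v]) huQ h4
      exact hcon.2 (List.Sublist.trans (by simp) h5)
    · have h3 := sublist_right_of_notMem huP h
      have h4 := sublist_left_of_notMem (s := [u, v, v]) huQ h3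
      have h5 : [v, v].Sublist I := List.Sublist.trans (by simp) h4
      exact ⟨h5.subset (by simp), Or.inr h5⟩
  obtain ⟨hvI, hv⟩ := key
  rcases v with a | ⟨r, c⟩
  -- A symbol of `sub` inside I belongs to the live block B. It occurs once in I, and that is its
  -- first occurrence overall.
  · exfalso
    have haB := inl_mem_shufflePiece hvI
    rcases hv with hv | hv
    · exact hsub.notMem_left hB haB (inl_mem_shuffleFrom hv)
    · have := hv.filterMap subSymbol
      rw [hI, filterMap_subSymbol_shufflePiece q (hlen B (by simp))] at this
      exact append_pair_not_nodup this (hsub.nodup B (by simp))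
  · obtain ⟨rfl, -⟩ := inr_mem_shufflePiece hvI
    exact ⟨c, rfl⟩

/-- In `σ`, a non-first occurrence of `y` lies between two occurrences of `x`. -/
def Tied (σ : List ℕ) (x y : ℕ) : Prop := [y, x, y, x].Sublist σ ∨ [x, y, y, x].Sublist σ

/-- This is `shuffle_tie` read on the pattern: a tie passes membership in a copy of `bot` from x on
to y. -/
theorem Tied.map_inr (hsub : LiveFirst sub)
    (hlen : ∀ B ∈ sub, B.live = true → B.word.length = bot.numLive) {σ : List ℕ} {x y q b : ℕ}
    (h : Tied σ x y) {f : ℕ → ℕ ⊕ ℕ × ℕ} (hf : (σ.map f).Sublist (shuffle d sub bot).word)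
    (hx : f x = Sum.inr (q, b)) : ∃ c, f y = Sum.inr (q, c) := by
  refine shuffle_tie (d := d) (b := b) hsub hlen (h.imp (fun h => ?_) fun h => ?_)
  · simpa [hx] using (h.map f).trans hf
  · simpa [hx] using (h.map f).trans hf

theorem Contained.of_forall_inl {σ : List ℕ} {f : ℕ → ℕ ⊕ ℕ × ℕ}
    (hlen : ∀ B ∈ sub, B.live = true → B.word.length = bot.numLive)
    (hi : Set.InjOn f {a | a ∈ σ}) (hf : (σ.map f).Sublist (shuffle d sub bot).word)
    (h : ∀ x ∈ σ, ∃ a, f x = Sum.inl a) : Contained σ sub.word := by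
  choose! g hg using h
  refine ⟨g, fun x hx y hy hxy => hi hx hy (by rw [hg x hx, hg y hy, hxy]), ?_⟩
  apply sublist_sub_of_map_inl (d := d) hlen
  rw [List.map_map]
  convert hf using 1
  exact List.map_congr_left fun x hx => (hg x hx).symm

theorem Contained.of_forall_inr {σ : List ℕ} {f : ℕ → ℕ ⊕ ℕ × ℕ} {q : ℕ}
    (hi : Set.InjOn f {a | a ∈ σ}) (hf : (σ.map f).Sublist (shuffle d sub bot).word)
    (h : ∀ x ∈ σ, ∃ b, f x = Sum.inr (q, b)) : Contained σ bot.word := by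
  choose! g hg using h
  refine ⟨g, fun x hx y hy hxy => hi hx hy (by rw [hg x hx, hg y hy, hxy]), ?_⟩
  apply sublist_bot_of_map_inr (d := d) (q := q) (sub := sub)
  rw [List.map_map]
  convert hf using 1
  exact List.map_congr_left fun x hx => (hg x hx).symm

/-- A pattern all of whose symbols are tied to and from one of them occurs in a shuffle only if it
occurs in one of the two sequences. -/
theorem Contained.shuffle (hsub : LiveFirst sub)
    (hlen : ∀ B ∈ sub, B.live = true → B.word.length = bot.numLive) {σ : List ℕ} {c : ℕ}
    (hc : ∀ x ∈ σ, x ≠ c → Tied σ x c ∧ Tied σ c x)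
    (h : Contained σ (shuffle d sub bot).word) :
    Contained σ sub.word ∨ Contained σ bot.word := by
  obtain ⟨f, hi, hf⟩ := h
  by_cases hall : ∀ x ∈ σ, ∃ a, f x = Sum.inl a
  · exact Or.inl (Contained.of_forall_inl hlen hi hf hall)
  · right
    push Not at hall
    obtain ⟨x, hx, hxn⟩ := hall
    rcases hfx : f x with a | ⟨q, b⟩
    · exact absurd hfx (hxn a)
    -- Membership in copy q spreads from x to the hub c, and from c to all other symbols.
    have hcq : ∃ b', f c = Sum.inr (q, b') := by
      by_cases hxc : x = c
      · exact ⟨b, by rw [← hxc, hfx]⟩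
      · exact (hc x hx hxc).1.map_inr hsub hlen hf hfx
    obtain ⟨b', hb'⟩ := hcq
    refine Contained.of_forall_inr (q := q) hi hf fun y hy => ?_
    by_cases hyc : y = c
    · exact ⟨b', by rw [hyc, hb']⟩
    · exact (hc y hy hyc).2.map_inr hsub hlen hf hb'

end Shuffle

/-! ### Canonical form -/

/-- The symbols of `w` make their first appearances in the order `0, 1, 2, …`. -/
def FirstAppearanceOrdered (w : List ℕ) : Prop :=
  ∀ w₁ a w₂, w = w₁ ++ a :: w₂ → a ∉ w₁ → (List.range a).Sublist w₁

section Canonical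

variable {α : Type} [DecidableEq α]

/-- The number of symbols that appear before the first occurrence of `a` in `w`. -/
def firstRank (w : List α) (a : α) : ℕ := alphabetSize (w.takeWhile fun b => b ≠ a)

theorem takeWhile_ne_eq {w₁ w₂ : List α} {a : α} (ha : a ∉ w₁) :
    ((w₁ ++ a :: w₂).takeWhile fun b => b ≠ a) = w₁ := by
  rw [List.takeWhile_append_of_pos]
  · simp
  · intro b hb
    simp only [decide_eq_true_eq]
    rintro rfl
    exact ha hb

theorem firstRank_eq {w₁ w₂ : List α} {a : α} (ha : a ∉ w₁) :
    firstRank (w₁ ++ a :: w₂) a = alphabetSize w₁ := by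
  rw [firstRank, takeWhile_ne_eq ha]

theorem firstRank_append_of_mem {w₁ w₂ : List α} {a : α} (ha : a ∈ w₁) :
    firstRank (w₁ ++ w₂) a = firstRank w₁ a := by
  obtain ⟨u, v, rfl, hu⟩ := List.eq_append_cons_of_mem ha
  rw [List.append_assoc, List.cons_append, firstRank_eq hu, firstRank_eq hu]

/-- Induction on the last letter: earlier ranks do not change, and a new letter receives as its rank
the number of symbols before it. -/
theorem range_sublist_map_firstRank (w : List α) :
    (List.range (alphabetSize w)).Sublist (w.map (firstRank w)) := by
  induction w using List.reverseRecOn with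
  | nil => simp [alphabetSize]
  | append_singleton w a ih =>
    have hmap : w.map (firstRank (w ++ [a])) = w.map (firstRank w) :=
      List.map_congr_left fun x hx => firstRank_append_of_mem hx
    rw [List.map_append, hmap]
    by_cases ha : a ∈ w
    · have : alphabetSize (w ++ [a]) = alphabetSize w := by
        simp [alphabetSize, ha]
      rw [this]
      exact ih.trans (List.sublist_append_left _ _)
    · have : alphabetSize (w ++ [a]) = alphabetSize w + 1 := by
        simp only [alphabetSize, List.toFinset_append, List.toFinset_cons, List.toFinset_nil]
        rw [Finset.card_union_of_disjoint (by simpa using ha)]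
        simp
      rw [this, List.range_succ]
      refine ih.append ?_
      simp [firstRank_eq ha]

theorem firstAppearanceOrdered_map_firstRank (w : List α) :
    FirstAppearanceOrdered (w.map (firstRank w)) := by
  intro w₁ b w₂ hw hb
  obtain ⟨u, v, rfl, rfl, hv⟩ := List.map_eq_append_iff.1 hw
  obtain ⟨a, v, rfl, rfl, rfl⟩ := List.map_eq_cons_iff.1 hv
  have ha : a ∉ u := fun h => hb (List.mem_map_of_mem h)
  rw [firstRank_eq ha]
  have : u.map (firstRank (u ++ a :: v)) = u.map (firstRank u) :=
    List.map_congr_left fun x hx => firstRank_append_of_mem hx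
  rw [this]
  exact range_sublist_map_firstRank u

theorem injOn_firstRank (w : List α) : Set.InjOn (firstRank w) {a | a ∈ w} := by
  intro a ha b hb hab
  by_contra hne
  -- Whichever of the two symbols appears first belongs to the prefix before the other but not to
  -- its own, so the ranks differ.
  wlog hlt : b ∈ (w.takeWhile fun c => c ≠ a) generalizing a b
  · refine this hb ha hab.symm (Ne.symm hne) ?_
    obtain ⟨u, v, rfl, hu⟩ := List.eq_append_cons_of_mem ha
    rw [takeWhile_ne_eq hu] at hlt
    rw [List.takeWhile_append_of_pos]
    · simp [hne]
    · intro x hx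
      simp only [decide_eq_true_eq]
      rintro rfl
      exact hlt hx
  obtain ⟨u, v, rfl, hu⟩ := List.eq_append_cons_of_mem ha
  rw [takeWhile_ne_eq hu] at hlt
  obtain ⟨s, t, rfl, hs⟩ := List.eq_append_cons_of_mem hlt
  rw [firstRank_eq hu] at hab
  rw [List.append_assoc, List.cons_append, firstRank_eq hs] at hab
  have : alphabetSize s < alphabetSize (s ++ b :: t) := by
    apply Finset.card_lt_card
    rw [Finset.ssubset_iff_of_subset]
    · exact ⟨b, by simp, by simpa using hs⟩
    · intro x; simp +contextual
  omega

theorem canonical_eq (T : BlockSeq α) : T.canonical = T.rename (firstRank T.word) := rfl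

end Canonical

/-- The alphabet is closed downwards, hence an initial segment of ℕ. In a composition this matches
the symbols of T_mid with the positions in a live block of length ‖T_mid‖. -/
theorem FirstAppearanceOrdered.mem_iff {w : List ℕ} (h : FirstAppearanceOrdered w) (k : ℕ) :
    k ∈ w ↔ k < alphabetSize w := by
  have hdown : ∀ a ∈ w, ∀ b < a, b ∈ w := by
    intro a ha b hb
    obtain ⟨u, v, rfl, hu⟩ := List.eq_append_cons_of_mem ha
    have := (h u a v rfl hu).subset (List.mem_range.2 hb)
    simp [this]
  have hex : ∃ n, ∀ k, k ∈ w ↔ k < n := by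
    have hb : ∃ n, n ∉ w := by
      obtain ⟨n, hn⟩ := Infinite.exists_notMem_finset w.toFinset
      exact ⟨n, by simpa using hn⟩
    classical
    refine ⟨Nat.find hb, fun k => ⟨fun hk => ?_, fun hk => ?_⟩⟩
    · by_contra! hle
      rcases hle.eq_or_lt with h | h
      · exact Nat.find_spec hb (h ▸ hk)
      · exact Nat.find_spec hb (hdown k hk _ h)
    · by_contra hk'
      exact Nat.find_min hb hk hk'
  obtain ⟨n, hn⟩ := hex
  have : w.toFinset = Finset.range n := by ext k; simp [hn]
  rw [hn, alphabetSize, this, Finset.card_range]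

/-- In a word in canonical form, an increasing sequence of symbols can be put in front of a
subsequence that starts with a larger symbol. -/
theorem FirstAppearanceOrdered.sublist {w r s : List ℕ} {a : ℕ} (h : FirstAppearanceOrdered w)
    (hs : (a :: s).Sublist w) (hr : (r ++ [a]).Pairwise (· < ·)) : (r ++ a :: s).Sublist w := by
  obtain ⟨u, v, rfl, hu⟩ := List.eq_append_cons_of_mem (a := a) (hs.subset (by simp))
  have h1 := sublist_right_of_notMem hu hs
  refine List.Sublist.append (List.Sublist.trans ?_ (h u a v rfl hu)) h1
  rw [List.pairwise_append] at hr
  refine (List.sublist_of_subperm_of_pairwise (r := (· < ·)) ?_ hr.1 List.pairwise_lt_range)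
  refine List.subperm_of_subset (hr.1.imp fun h => ne_of_lt h) fun x hx => ?_
  simpa using hr.2.2 x hx a (by simp)

/-! ### Order of the dead occurrences -/

/-- After a live block in which `a` precedes `b`, all occurrences of `a` precede all occurrences of
`b` (`d` ascending), or conversely (`d` descending). -/
def LiveOrdered {α : Type} (d : Diag) (T : BlockSeq α) : Prop :=
  ∀ B ∈ T, B.live = true → ∀ a b, [a, b].Sublist B.word →
    ¬ (match d with
      | .up => [a, b, b, a]
      | .down => [a, b, a, b]).Sublist T.word

section LiveOrdered

variable {α β : Type} {d : Diag}

theorem LiveOrdered.rename {T : BlockSeq α} {f : α → β} (h : LiveOrdered d T)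
    (hf : Set.InjOn f {a | a ∈ T.word}) : LiveOrdered d (T.rename f) := by
  intro C hC hl a b hab hs
  obtain ⟨B, hB, rfl⟩ := mem_rename.1 hC
  obtain ⟨t, ht, htab⟩ := exists_map_sublist_of_sublist_map hab
  match t, htab, ht with
  | [x, y], htab, ht =>
    simp only [List.map_cons, List.map_nil, List.cons.injEq, and_true] at htab
    obtain ⟨rfl, rfl⟩ := htab
    have hx : x ∈ T.word := mem_word.2 ⟨B, hB, ht.subset (by simp)⟩
    have hy : y ∈ T.word := mem_word.2 ⟨B, hB, ht.subset (by simp)⟩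
    have key : ∀ l : List α, (∀ c ∈ l, c ∈ T.word) →
        (l.map f).Sublist (T.rename f).word → l.Sublist T.word := by
      intro l hl hs
      rw [word_rename] at hs
      obtain ⟨t, ht, hlt⟩ := exists_map_sublist_of_sublist_map hs
      have : l = t := by
        clear hs
        induction l generalizing t with
        | nil => simpa using hlt.symm
        | cons c l ih =>
          cases t with
          | nil => simp at hlt
          | cons e t =>
            simp only [List.map_cons, List.cons.injEq] at hlt
            rw [hf (hl c (by simp)) (ht.subset (by simp)) hlt.1,
              ih (fun c hc => hl c (by simp [hc])) t ((List.sublist_cons_self _ _).trans ht) hlt.2]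
      exact this ▸ ht
    have := h B hB hl x y ht
    cases d
    · exact this (key _ (by simp [hx, hy]) hs)
    · exact this (key _ (by simp [hx, hy]) hs)

/-- Whichever of a, b comes first in B, the word formed by these two and a later a b a contains both
forbidden words, abba and abab up to the names. The direction d is therefore immaterial. -/
theorem LiveOrdered.not_alternating {T P Q : BlockSeq α} {B : Block α} (h : LiveOrdered d T)
    (hT : T = P ++ B :: Q) (hB : B.live = true) {a b : α} (ha : a ∈ B.word)
    (hb : b ∈ B.word) (hab : a ≠ b) : ¬ [a, b, a].Sublist Q.word := by
  intro hs
  have hBT : B ∈ T := by simp [hT]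
  have key : ∀ s : List α, s.Sublist B.word → (s ++ [a, b, a]).Sublist T.word := by
    intro s hs'
    rw [hT, word_append, word_cons]
    exact (hs'.append hs).trans (List.sublist_append_right _ _)
  have h2 : [a, b].Sublist B.word ∨ [b, a].Sublist B.word := by
    obtain ⟨u, v, huv⟩ := List.append_of_mem ha
    rw [huv] at hb ⊢
    simp only [List.mem_append, List.mem_cons, hab.symm, false_or] at hb
    rcases hb with hb | hb
    · exact Or.inr ((List.singleton_sublist.2 hb).append (List.singleton_sublist.2 (by simp)))
    · refine Or.inl (List.Sublist.trans ?_ (List.sublist_append_right _ _))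
      simpa using hb
  rcases h2 with h2 | h2
  · have h3 := key _ h2
    refine h B hBT hB a b h2 (List.Sublist.trans ?_ h3)
    cases d <;> simp
  · have h3 := key _ h2
    refine h B hBT hB b a h2 (List.Sublist.trans ?_ h3)
    cases d <;> simp

/-- A live block of the shuffle is a live block of `bot` with one symbol of `sub` added. Two symbols
of `bot` inherit their order. For a mixed pair, the forbidden word would have a non-first occurrence
of the symbol of `sub` between two occurrences of the other, against `shuffle_tie`. No order in
`sub` is needed, which is why only the last letter of π counts. -/
theorem LiveOrdered.shuffle {bot sub : BlockSeq ℕ} (hbot : LiveOrdered d bot)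
    (hsub : LiveFirst sub) (hlen : ∀ B ∈ sub, B.live = true → B.word.length = bot.numLive) :
    LiveOrdered d (shuffle d sub bot) := by
  intro C hC hl a b hab hs
  obtain ⟨q, B, hB, hCB⟩ := mem_shuffleFrom hC
  cases hBl : B.live with
  | false =>
    rw [shufflePiece_dead hBl, List.mem_singleton] at hCB
    simp [hCB] at hl
  | true =>
    rw [shufflePiece_live hBl] at hCB
    obtain ⟨D', hD', hDl, c', hc', rfl⟩ :=
      mem_insertLive_live (by simp [hlen B hB hBl]) hCB hl
    obtain ⟨c, hc, rfl⟩ := List.mem_map.1 hc'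
    obtain ⟨D, hD, rfl⟩ := mem_rename.1 hD'
    have key : [a, b].Sublist (D.word.map fun b => (Sum.inr (q, b) : ℕ ⊕ ℕ × ℕ)) → False := by
      intro h
      obtain ⟨t, ht, htab⟩ := exists_map_sublist_of_sublist_map h
      match t, htab, ht with
      | [x, y], htab, ht =>
        simp only [List.map_cons, List.map_nil, List.cons.injEq, and_true] at htab
        obtain ⟨rfl, rfl⟩ := htab
        refine hbot D hD hDl x y ht ?_
        cases d
        · exact sublist_bot_of_map_inr (d := .up) (sub := sub) (q := q) (by simpa using hs)
        · exact sublist_bot_of_map_inr (d := .down) (sub := sub) (q := q) (by simpa using hs)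
    cases d with
    | up =>
      simp only [insertBlock] at hab
      by_cases hbc : b = Sum.inl c
      · subst hbc
        have ha : a ∈ D.word.map fun b => (Sum.inr (q, b) : ℕ ⊕ ℕ × ℕ) := by
          have : [a].Sublist (D.word.map fun b => (Sum.inr (q, b) : ℕ ⊕ ℕ × ℕ)) := by
            have h3 : ([a] ++ [(Sum.inl c : ℕ ⊕ ℕ × ℕ)]).Sublist
              ((D.word.map fun b => (Sum.inr (q, b) : ℕ ⊕ ℕ × ℕ)) ++ [Sum.inl c]) := hab
            exact (List.append_sublist_append_right _).1 h3
          exact this.subset (by simp)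
        obtain ⟨x, -, rfl⟩ := List.mem_map.1 ha
        obtain ⟨y, hy⟩ := shuffle_tie hsub hlen (Or.inr hs)
        cases hy
      · exact key (sublist_left_of_notMem (s := [a]) (by simpa using hbc) hab)
    | down =>
      simp only [insertBlock] at hab
      by_cases hac : a = Sum.inl c
      · subst hac
        have hb : b ∈ D.word.map fun b => (Sum.inr (q, b) : ℕ ⊕ ℕ × ℕ) := by
          have := List.cons_sublist_cons.1 hab
          exact this.subset (by simp)
        obtain ⟨x, -, rfl⟩ := List.mem_map.1 hb
        obtain ⟨y, hy⟩ := shuffle_tie hsub hlen (Or.inl hs)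
        cases hy
      · exact key (sublist_right_of_notMem (X := [Sum.inl c]) (by simpa using hac) hab)

end LiveOrdered

/-! ### Composition -/

/-- The part of a composition that replaces the block `B`. -/
def compPiece (mid : BlockSeq ℕ) (B : Block ℕ) : BlockSeq ℕ :=
  if B.live then mid.rename fun k => B.word.getD k 0 else [B]

section Comp

variable {d : Diag} {top mid : BlockSeq ℕ} {n : ℕ}

@[simp] theorem comp_nil : BlockSeq.comp [] mid = [] := rfl

theorem comp_cons (B : Block ℕ) : BlockSeq.comp (B :: top) mid = compPiece mid B ++ top.comp mid := by
  simp [BlockSeq.comp, compPiece]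

theorem comp_append (P Q : BlockSeq ℕ) :
    BlockSeq.comp (P ++ Q) mid = P.comp mid ++ Q.comp mid := by
  simp [BlockSeq.comp]

theorem compPiece_live {B : Block ℕ} (h : B.live = true) :
    compPiece mid B = mid.rename fun k => B.word.getD k 0 := by
  simp [compPiece, h]

theorem compPiece_dead {B : Block ℕ} (h : B.live = false) : compPiece mid B = [B] := by
  simp [compPiece, h]

theorem getD_mem {w : List ℕ} {k : ℕ} (h : k < w.length) : w.getD k 0 ∈ w := by
  rw [List.getD_eq_getElem _ _ h]
  exact List.getElem_mem h

theorem injOn_getD {w : List ℕ} (h : w.Nodup) :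
    Set.InjOn (fun k => w.getD k 0) {k | k < w.length} := by
  intro a ha b hb hab
  simp only [Set.mem_ofPred_eq] at ha hb
  simp only [List.getD_eq_getElem _ _ ha, List.getD_eq_getElem _ _ hb] at hab
  exact (h.getElem_inj_iff).1 hab

theorem mem_compPiece (hmid : ∀ k ∈ mid.word, k < n) {B : Block ℕ}
    (hB : B.live = true → B.word.length = n) {a : ℕ} (h : a ∈ (compPiece mid B).word) :
    a ∈ B.word := by
  cases hl : B.live with
  | true =>
    rw [compPiece_live hl, word_rename, List.mem_map] at h
    obtain ⟨k, hk, rfl⟩ := h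
    exact getD_mem (by rw [hB hl]; exact hmid k hk)
  | false => simpa [compPiece_dead hl] using h

theorem mem_comp (hmid : ∀ k ∈ mid.word, k < n)
    (hlen : ∀ B ∈ top, B.live = true → B.word.length = n) {a : ℕ} (h : a ∈ (top.comp mid).word) :
    a ∈ top.word := by
  induction top with
  | nil => simp at h
  | cons B top ih =>
    rw [comp_cons, word_append, List.mem_append] at h
    rw [word_cons, List.mem_append]
    exact h.imp (mem_compPiece hmid (hlen B (by simp))) (ih fun B hB => hlen B (by simp [hB]))

theorem mem_live_comp {C : Block ℕ} (hC : C ∈ top.comp mid) (hl : C.live = true) :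
    ∃ B ∈ top, B.live = true ∧ ∃ D ∈ mid, D.live = true ∧
      C = ⟨D.live, D.word.map fun k => B.word.getD k 0⟩ := by
  induction top with
  | nil => simp at hC
  | cons B top ih =>
    rw [comp_cons, List.mem_append] at hC
    rcases hC with hC | hC
    · cases hB : B.live with
      | true =>
        rw [compPiece_live hB] at hC
        obtain ⟨D, hD, rfl⟩ := mem_rename.1 hC
        exact ⟨B, by simp, hB, D, hD, hl, rfl⟩
      | false =>
        rw [compPiece_dead hB, List.mem_singleton] at hC
        rw [hC, hB] at hl
        cases hl
    · obtain ⟨B', hB', h⟩ := ih hC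
      exact ⟨B', by simp [hB'], h⟩

theorem LiveFirst.compPiece (hmid : LiveFirst mid) (hm : ∀ k ∈ mid.word, k < n) {B : Block ℕ}
    (hn : B.word.Nodup) (hl : B.live = true) (hB : B.word.length = n) :
    LiveFirst (compPiece mid B) := by
  rw [compPiece_live hl]
  exact hmid.rename ((injOn_getD hn).mono fun k hk => by rw [Set.mem_ofPred_eq, hB]; exact hm k hk)

theorem LiveFirst.comp (htop : LiveFirst top) (hmid : LiveFirst mid)
    (hm : ∀ k, k ∈ mid.word ↔ k < n) (hlen : ∀ B ∈ top, B.live = true → B.word.length = n) :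
    LiveFirst (top.comp mid) where
  pairwise := by
    obtain ⟨hp, hn, -⟩ := htop
    induction top with
    | nil => simp
    | cons B top ih =>
      rw [List.pairwise_cons] at hp
      rw [comp_cons, List.pairwise_append]
      refine ⟨?_, ih (fun B hB => hlen B (by simp [hB])) hp.2 (fun B hB => hn B (by simp [hB])),
        fun x hx y hy hyl a hax hay => ?_⟩
      · cases hB : B.live with
        | true =>
          exact (hmid.compPiece (fun k => (hm k).1) (hn B (by simp)) hB (hlen B (by simp) hB)).pairwise
        | false => simp [compPiece_dead hB]
      · have h1 := mem_compPiece (fun k => (hm k).1) (hlen B (by simp)) (mem_word.2 ⟨x, hx, hax⟩)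
        obtain ⟨C, hC, hCl, D, hD, -, rfl⟩ := mem_live_comp hy hyl
        obtain ⟨k, hk, rfl⟩ := List.mem_map.1 hay
        refine hp.1 C hC hCl h1 (getD_mem ?_)
        rw [hlen C (by simp [hC]) hCl, ← hm]
        exact mem_word.2 ⟨D, hD, hk⟩
  nodup := by
    intro C hC
    obtain ⟨B, hB, hCB⟩ := List.mem_flatMap.1 hC
    change C ∈ GenDS.compPiece mid B at hCB
    cases hl : B.live with
    | true =>
      exact (hmid.compPiece (fun k => (hm k).1) (htop.nodup B hB) hl (hlen B hB hl)).nodup C hCB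
    | false =>
      rw [compPiece_dead hl, List.mem_singleton] at hCB
      exact hCB ▸ htop.nodup B hB
  exists_live := by
    intro a ha
    obtain ⟨B, hB, hl, haB⟩ := htop.exists_live a (mem_comp (fun k => (hm k).1) hlen ha)
    obtain ⟨k, hk, rfl⟩ := List.getElem_of_mem haB
    -- Every k < n does occur in `mid`, so no symbol of B loses its live occurrence.
    have hk' : k ∈ mid.word := by rwa [hm, ← hlen B hB hl]
    obtain ⟨D, hD, hDl, hkD⟩ := hmid.exists_live k hk'
    refine ⟨⟨D.live, D.word.map fun k => B.word.getD k 0⟩, ?_, hDl, ?_⟩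
    · refine List.mem_flatMap.2 ⟨B, hB, ?_⟩
      rw [if_pos hl]
      exact mem_rename.2 ⟨D, hD, rfl⟩
    · exact List.mem_map.2 ⟨k, hkD, List.getD_eq_getElem _ _ hk⟩

/-- A subsequence of a composition that uses every copy of the second sequence only for a
subsequence of the replaced block is a subsequence of the first sequence. -/
theorem sublist_of_sublist_comp {s : List ℕ} (h : s.Sublist (top.comp mid).word)
    (H : ∀ B ∈ top, B.live = true → ∀ t, t <:+: s → t.Sublist (compPiece mid B).word →
      t.Sublist B.word) : s.Sublist top.word := by
  induction top generalizing s with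
  | nil => simpa using h
  | cons B top ih =>
    rw [comp_cons, word_append] at h
    obtain ⟨s₁, s₂, rfl, h1, h2⟩ := List.sublist_append_iff.1 h
    rw [word_cons]
    refine List.Sublist.append ?_ (ih h2 fun B hB hl t ht => H B (by simp [hB]) hl t
      (ht.trans (List.suffix_append _ _).isInfix))
    cases hl : B.live with
    | true => exact H B (by simp) hl _ (List.prefix_append _ _).isInfix h1
    | false => simpa [compPiece_dead hl] using h1

theorem sublist_of_sublist_comp_of_notMem (hm : ∀ k ∈ mid.word, k < n)
    (hlen : ∀ B ∈ top, B.live = true → B.word.length = n) {s : List ℕ}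
    (h : s.Sublist (top.comp mid).word)
    (H : ∀ B ∈ top, B.live = true → ∀ x ∈ s, x ∉ B.word) : s.Sublist top.word := by
  refine sublist_of_sublist_comp h fun B hB hl t ht hs => ?_
  cases t with
  | nil => simp
  | cons a t =>
    exact absurd (mem_compPiece hm (hlen B hB) (hs.subset (by simp)))
      (H B hB hl a (ht.subset (by simp)))

/-- A constant word without immediate repetitions has length at most one. -/
theorem sublist_singleton_of_isChain_ne {t : List ℕ} (hc : t.IsChain (· ≠ ·))
    (h : ∀ x ∈ t, ∀ y ∈ t, x = y) : ∀ w : List ℕ, (∀ x ∈ t, x ∈ w) → t.Sublist w := by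
  intro w hw
  match t, hc with
  | [], _ => simp
  | [a], _ => simpa using hw
  | a :: b :: t, hc =>
    simp only [List.isChain_cons_cons] at hc
    exact absurd (h a (by simp) b (by simp)) hc.1

/-- If no two different symbols of `s` share a live block of `top`, and no symbol of `s` is repeated
immediately, then `s` does not notice the composition. -/
theorem sublist_of_sublist_comp_of_separate (hm : ∀ k ∈ mid.word, k < n)
    (hlen : ∀ B ∈ top, B.live = true → B.word.length = n) {s : List ℕ}
    (h : s.Sublist (top.comp mid).word) (hc : s.IsChain (· ≠ ·))
    (H : ∀ B ∈ top, B.live = true → ∀ x ∈ s, ∀ y ∈ s, x ∈ B.word → y ∈ B.word → x = y) :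
    s.Sublist top.word := by
  refine sublist_of_sublist_comp h fun B hB hl t ht hs => ?_
  have hmem : ∀ x ∈ t, x ∈ B.word := fun x hx => mem_compPiece hm (hlen B hB) (hs.subset hx)
  exact sublist_singleton_of_isChain_ne (hc.infix ht)
    (fun x hx y hy => H B hB hl x (ht.subset hx) y (ht.subset hy) (hmem x hx) (hmem y hy)) _ hmem

/-- In `σ`, the symbols `x` and `y` alternate after an occurrence of `x` followed by one of `z`. -/
def Separated (σ : List ℕ) (x y z : ℕ) : Prop :=
  [x, z, x, y, x].Sublist σ ∨ [x, z, y, x, y].Sublist σ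

theorem LiveFirst.notMem_comp_left {P Q : BlockSeq ℕ} {B : Block ℕ}
    (htop : LiveFirst (P ++ B :: Q)) (hm : ∀ k ∈ mid.word, k < n)
    (hlen : ∀ B' ∈ P ++ B :: Q, B'.live = true → B'.word.length = n) (hl : B.live = true) {a : ℕ}
    (ha : a ∈ B.word) : a ∉ (P.comp mid).word := fun h =>
  htop.notMem_left hl ha (mem_comp hm (fun B hB => hlen B (by simp [hB])) h)

/-- The live blocks in Q are disjoint from B, so the symbols of B meet only dead blocks there, and
composition leaves these unchanged. -/
theorem LiveFirst.sublist_comp_right {P Q : BlockSeq ℕ} {B : Block ℕ}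
    (htop : LiveFirst (P ++ B :: Q)) (hm : ∀ k ∈ mid.word, k < n)
    (hlen : ∀ B' ∈ P ++ B :: Q, B'.live = true → B'.word.length = n) {s : List ℕ}
    (hs : ∀ x ∈ s, x ∈ B.word) (h : s.Sublist (Q.comp mid).word) : s.Sublist Q.word :=
  sublist_of_sublist_comp_of_notMem hm (fun B hB => hlen B (by simp [hB])) h
    fun C hC hCl x hx => htop.notMem_live_right (hs x hx) C hC hCl

/-- No x precedes the copy that replaces B, and z does not occur in that copy. Hence everything
after z comes after the copy, where x and y cannot alternate by `LiveOrdered`. -/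
theorem LiveFirst.not_separated {P Q : BlockSeq ℕ} {B : Block ℕ} (htop : LiveFirst (P ++ B :: Q))
    (ho : LiveOrdered d (P ++ B :: Q)) (hm : ∀ k ∈ mid.word, k < n)
    (hlen : ∀ B' ∈ P ++ B :: Q, B'.live = true → B'.word.length = n) (hl : B.live = true)
    {x y z : ℕ} (hx : x ∈ B.word) (hy : y ∈ B.word) (hxy : x ≠ y) (hz : z ∉ B.word) :
    ¬ [x, z, x, y, x].Sublist (BlockSeq.comp (P ++ B :: Q) mid).word ∧
      ¬ [x, z, y, x, y].Sublist (BlockSeq.comp (P ++ B :: Q) mid).word := by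
  have key : ∀ s, (∀ a ∈ s, a ∈ B.word) →
      (x :: z :: s).Sublist (BlockSeq.comp (P ++ B :: Q) mid).word → s.Sublist Q.word := by
    intro s hs h
    rw [comp_append, comp_cons, word_append, word_append] at h
    have h1 := sublist_right_of_notMem (htop.notMem_comp_left hm hlen hl hx) h
    have h2 := (List.sublist_cons_self _ _).trans h1
    have h3 := sublist_right_of_notMem
      (fun hz' => hz (mem_compPiece hm (hlen B (by simp)) hz')) h2
    exact htop.sublist_comp_right hm hlen hs ((List.sublist_cons_self _ _).trans h3)
  exact ⟨fun h => ho.not_alternating rfl hl hx hy hxy (key _ (by simp [hx, hy]) h),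
    fun h => ho.not_alternating rfl hl hy hx hxy.symm (key _ (by simp [hx, hy]) h)⟩

/-- A pattern with separated symbols that occurs in a composition occurs in the first sequence or
uses symbols of only one of its live blocks. -/
theorem Contained.comp (htop : LiveFirst top) (ho : LiveOrdered d top)
    (hm : ∀ k ∈ mid.word, k < n) (hlen : ∀ B ∈ top, B.live = true → B.word.length = n)
    {σ : List ℕ} (hc : σ.IsChain (· ≠ ·))
    (hsep : ∀ x ∈ σ, ∀ y ∈ σ, ∀ z ∈ σ, x ≠ y → x ≠ z → y ≠ z →
      Separated σ x y z ∨ Separated σ y x z)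
    (h : Contained σ (top.comp mid).word) :
    Contained σ top.word ∨ ∃ (P : BlockSeq ℕ) (B : Block ℕ) (Q : BlockSeq ℕ) (σ₁ σ₂ : List ℕ) (g : ℕ → ℕ), top = P ++ B :: Q ∧ B.live = true ∧
      σ = σ₁ ++ σ₂ ∧ Set.InjOn g {a | a ∈ σ} ∧ (∀ x ∈ σ, g x < n) ∧
      (σ₁.map g).Sublist mid.word ∧ (σ₂.map fun x => B.word.getD (g x) 0).Sublist Q.word := by
  obtain ⟨f, hi, hf⟩ := h
  -- If no live block holds two symbols of the occurrence, each copy of `mid` contributes at most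
  -- one letter, which the replaced block could supply as well.
  by_cases hsing : ∀ B ∈ top, B.live = true → ∀ x ∈ σ, ∀ y ∈ σ, f x ∈ B.word → f y ∈ B.word → x = y
  · left
    refine ⟨f, hi, sublist_of_sublist_comp_of_separate hm hlen hf ?_ ?_⟩
    · rw [List.isChain_map]
      exact hc.imp_of_mem_imp fun a b ha hb hab h => hab (hi ha hb h)
    · intro B hB hl a ha b hb haB hbB
      obtain ⟨x, hx, rfl⟩ := List.mem_map.1 ha
      obtain ⟨y, hy, rfl⟩ := List.mem_map.1 hb
      rw [hsing B hB hl x hx y hy haB hbB]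
  right
  push Not at hsing
  obtain ⟨B, hB, hl, x, hx, y, hy, hxB, hyB, hxy⟩ := hsing
  obtain ⟨P, Q, rfl⟩ := List.append_of_mem hB
  have hfxy : f x ≠ f y := fun h => hxy (hi hx hy h)
  -- Two symbols share B; separation then rules out a third symbol outside B.
  have hall : ∀ z ∈ σ, f z ∈ B.word := by
    intro z hz
    by_contra hzB
    have hxz : x ≠ z := fun h => hzB (h ▸ hxB)
    have hyz : y ≠ z := fun h => hzB (h ▸ hyB)
    have h1 := htop.not_separated ho hm hlen hl hxB hyB hfxy hzB
    have h2 := htop.not_separated ho hm hlen hl hyB hxB hfxy.symm hzB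
    rcases hsep x hx y hy z hz hxy hxz hyz with (h | h) | (h | h)
    · exact h1.1 ((h.map f).trans hf)
    · exact h1.2 ((h.map f).trans hf)
    · exact h2.1 ((h.map f).trans hf)
    · exact h2.2 ((h.map f).trans hf)
  have hBn := hlen B hB hl
  have hBd := htop.nodup B hB
  -- The position in B is the symbol of `mid` that is renamed to f x.
  set g : ℕ → ℕ := fun x => B.word.idxOf (f x) with hg
  have hgl : ∀ x ∈ σ, g x < B.word.length := fun x hx => List.idxOf_lt_length_iff.2 (hall x hx)
  have hgB : ∀ x ∈ σ, B.word.getD (g x) 0 = f x := fun x hx => by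
    rw [List.getD_eq_getElem _ _ (hgl x hx)]
    exact List.getElem_idxOf (hgl x hx)
  rw [comp_append, comp_cons, word_append, word_append] at hf
  have hf' := sublist_right_of_forall (by
    intro u hu
    obtain ⟨z, hz, rfl⟩ := List.mem_map.1 hu
    exact htop.notMem_comp_left hm hlen hl (hall z hz)) hf
  obtain ⟨s₁, s₂, hs, h1, h2⟩ := List.sublist_append_iff.1 hf'
  obtain ⟨σ₁, σ₂, rfl, rfl, rfl⟩ := List.map_eq_append_iff.1 hs
  refine ⟨P, B, Q, σ₁, σ₂, g, rfl, hl, rfl, ?_, fun x hx => hBn ▸ hgl x hx, ?_, ?_⟩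
  · intro a ha b hb hab
    apply hi ha hb
    rw [← hgB a ha, ← hgB b hb, hab]
  · rw [compPiece_live hl, word_rename] at h1
    obtain ⟨t, ht, hft⟩ := exists_map_sublist_of_sublist_map h1
    have : σ₁.map g = t := by
      have h3 : (σ₁.map f).map (fun a => B.word.idxOf a) = t := by
        rw [hft, List.map_map]
        conv_rhs => rw [← List.map_id t]
        refine List.map_congr_left fun k hk => ?_
        have hk' : k < B.word.length := by rw [hBn]; exact hm k (ht.subset hk)
        simp only [Function.comp, List.getD_eq_getElem _ _ hk', id]
        exact hBd.idxOf_getElem k hk'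
      rw [← h3, List.map_map]
      rfl
    rw [this]
    exact ht
  · have h3 : σ₂.map (fun x => B.word.getD (g x) 0) = σ₂.map f :=
      List.map_congr_left fun x hx => hgB x (by simp [hx])
    rw [h3]
    refine htop.sublist_comp_right hm hlen (fun a ha => ?_) h2
    obtain ⟨z, hz, rfl⟩ := List.mem_map.1 ha
    exact hall z (by simp [hz])

end Comp

/-! ### The recursive structure of the Class I sequences -/

/-- The last letter of `π`. -/
def lastDiag (π : List Diag) : Diag := π.getLastD .up

theorem classI_zero (π : List Diag) (i : ℕ) : classI π i 0 = [⟨true, []⟩, ⟨true, []⟩] := by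
  rw [classI]; simp

theorem classI_base {π : List Diag} {i j : ℕ} (h : π.length ≤ 2 ∨ i ≤ 1) (hj : j ≠ 0) :
    classI π i j = classIBase (lastDiag π) j := by
  rw [classI, if_neg hj, if_pos h]; rfl

/-- The sequence `T_bot` in the definition of `classI π i (j + 1)` is `classI π i j`; this is
`T_mid`. -/
def classIMid (π : List Diag) (i j : ℕ) : BlockSeq ℕ :=
  classI π.dropLast i (classI π i j).numLive

/-- The sequence `T_top` in the definition of `classI π i (j + 1)`. -/
def classITop (π : List Diag) (i j : ℕ) : BlockSeq ℕ :=
  classI π (i - 1) (alphabetSize (classIMid π i j).word)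

theorem classI_succ {π : List Diag} {i : ℕ} (h : 2 < π.length) (hi : 1 < i) (j : ℕ) :
    classI π i (j + 1) = (shuffle (lastDiag π) ((classITop π i j).comp (classIMid π i j))
      (classI π i j)).canonical := by
  rw [classI, if_neg (by omega), if_neg (by omega)]; rfl

/-- Lexicographic induction on (|π|, i, j), with one hypothesis for each of T_bot, T_mid and T_top.
The value i = 0 falls under the base case. -/
theorem classI_induction {motive : List Diag → ℕ → ℕ → Prop}
    (zero : ∀ π i, motive π i 0)
    (base : ∀ π i j, (π.length ≤ 2 ∨ i ≤ 1) → j ≠ 0 → motive π i j)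
    (succ : ∀ π i j, 2 < π.length → 1 < i → motive π i j →
      motive π.dropLast i (classI π i j).numLive →
      motive π (i - 1) (alphabetSize (classIMid π i j).word) → motive π i (j + 1)) :
    ∀ π i j, motive π i j := by
  intro π
  induction hp : π.length generalizing π with
  | zero =>
    intro i j
    cases j with
    | zero => exact zero _ _
    | succ j => exact base _ _ _ (by omega) (by omega)
  | succ p ihp =>
    intro i
    induction i with
    | zero =>
      intro j
      cases j with
      | zero => exact zero _ _
      | succ j => exact base _ _ _ (by omega) (by omega)
    | succ i ihi =>
      intro j
      induction j with
      | zero => exact zero _ _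
      | succ j ihj =>
        by_cases h : π.length ≤ 2 ∨ i + 1 ≤ 1
        · exact base _ _ _ h (by omega)
        · push Not at h
          exact succ _ _ _ h.1 h.2 ihj (ihp _ (by simp [hp]) _ _) (ihi _)

/-- The structural properties of `T_π(i, j)`. -/
structure Regular (j : ℕ) (T : BlockSeq ℕ) : Prop where
  liveFirst : LiveFirst T
  ordered : FirstAppearanceOrdered T.word
  length_live : ∀ B ∈ T, B.live = true → B.word.length = j
  numLive_pos : 0 < T.numLive

theorem classIBase_word (d : Diag) (j : ℕ) : (classIBase d j).word =
    List.range j ++ (match d with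
      | .up => List.range j
      | .down => (List.range j).reverse) := by
  cases d <;> simp [classIBase]

theorem mem_classIBase_word {d : Diag} {j x : ℕ} : x ∈ (classIBase d j).word ↔ x < j := by
  rw [classIBase_word]; cases d <;> simp

theorem alphabetSize_classIBase (d : Diag) (j : ℕ) : alphabetSize (classIBase d j).word = j := by
  have : (classIBase d j).word.toFinset = Finset.range j := by
    ext x; rw [List.mem_toFinset, mem_classIBase_word, Finset.mem_range]
  rw [alphabetSize, this, Finset.card_range]

theorem firstAppearanceOrdered_range_append (j : ℕ) {w : List ℕ} (hw : ∀ x ∈ w, x < j) :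
    FirstAppearanceOrdered (List.range j ++ w) := by
  intro w₁ a w₂ h ha
  have haj : a < j := by
    have : a ∈ List.range j ++ w := by rw [h]; simp
    rcases List.mem_append.1 this with h | h
    · simpa using h
    · exact hw a h
  obtain ⟨c, rfl⟩ := Nat.exists_eq_add_of_lt haj
  have h1 : List.range (a + c + 1) ++ w =
      List.range a ++ a :: ((List.range c).map (fun x => a + 1 + x) ++ w) := by
    rw [show a + c + 1 = (a + 1) + c by ring, List.range_add, List.range_succ]
    simp
  rw [h1, List.append_eq_append_iff] at h
  rcases h with ⟨u, rfl, -⟩ | ⟨u, h2, h3⟩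
  · simp
  · cases u with
    | nil => simp [h2]
    | cons b u =>
      simp only [List.cons_append, List.cons.injEq] at h3
      exfalso
      have : a ∈ List.range a := by rw [h2]; simp [h3.1]
      simp at this

theorem regular_classIBase (d : Diag) (j : ℕ) : Regular j (classIBase d j) where
  liveFirst :=
    { pairwise := by simp [classIBase]
      nodup := by
        intro B hB
        simp only [classIBase, List.mem_cons, List.not_mem_nil, or_false] at hB
        rcases hB with rfl | rfl
        · exact List.nodup_range
        · cases d
          · exact List.nodup_range
          · exact List.nodup_reverse.2 List.nodup_range
      exists_live := fun a ha => ⟨⟨true, List.range j⟩, by simp [classIBase], rfl,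
        List.mem_range.2 (mem_classIBase_word.1 ha)⟩ }
  ordered := by
    rw [classIBase_word]
    exact firstAppearanceOrdered_range_append j (by cases d <;> simp)
  length_live := by simp [classIBase]
  numLive_pos := by simp [classIBase, numLive]

theorem liveOrdered_classIBase (d : Diag) (j : ℕ) : LiveOrdered d (classIBase d j) := by
  intro B hB hl a b hab hs
  simp only [classIBase, List.mem_cons, List.not_mem_nil, or_false] at hB
  rcases hB with rfl | rfl
  · have hlt : ∀ {x y}, [x, y].Sublist (List.range j) → x < y := fun h => by
      simpa using List.pairwise_lt_range.sublist h
    have h1 := hlt hab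
    rw [classIBase_word] at hs
    have hnn : ∀ {x}, ¬ [x, x].Sublist (List.range j) := fun h => lt_irrefl _ (hlt h)
    have hr : ∀ {x y}, [x, y].Sublist (List.range j).reverse → y < x := fun h => hlt (by
      simpa using List.reverse_sublist.2 h)
    obtain ⟨s, t, hst, h2, h3⟩ := List.sublist_append_iff.1 hs
    -- The live block has no repetition, so it takes at most two letters of the forbidden word. The
    -- last two letters then fall into the dead block and contradict its order.
    have hs2 : s.length ≤ 2 := by
      by_contra! hlen
      match s, hlen with
      | x :: y :: z :: s, _ =>
        cases d
        · simp only [List.cons_append, List.cons.injEq] at hst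
          obtain ⟨rfl, rfl, rfl, -⟩ := hst
          exact hnn (x := b) (List.Sublist.trans (by simp) h2)
        · simp only [List.cons_append, List.cons.injEq] at hst
          obtain ⟨rfl, rfl, rfl, -⟩ := hst
          exact hnn (x := a) (List.Sublist.trans (by simp) h2)
    cases d
    · have ht : [b, a].Sublist t := by
        match s, hs2 with
        | [], _ => obtain rfl : [a, b, b, a] = t := hst; simp
        | [x], _ => obtain ⟨-, rfl⟩ := List.cons.inj hst; simp
        | [x, y], _ =>
          obtain rfl : [b, a] = t := (List.cons.inj (List.cons.inj hst).2).2
          simp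
      exact absurd (hlt (ht.trans h3)) (by omega)
    · have ht : [a, b].Sublist t := by
        match s, hs2 with
        | [], _ => obtain rfl : [a, b, a, b] = t := hst; simp
        | [x], _ => obtain ⟨-, rfl⟩ := List.cons.inj hst; simp
        | [x, y], _ =>
          obtain rfl : [a, b] = t := (List.cons.inj (List.cons.inj hst).2).2
          simp
      exact absurd (hr (ht.trans h3)) (by omega)
  · simp at hl

theorem live_length_comp {top mid : BlockSeq ℕ} {l : ℕ}
    (h : ∀ D ∈ mid, D.live = true → D.word.length = l) :
    ∀ C ∈ top.comp mid, C.live = true → C.word.length = l := by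
  intro C hC hl
  obtain ⟨B, -, -, D, hD, hDl, rfl⟩ := mem_live_comp hC hl
  simp [h D hD hDl]

theorem numLive_comp (top mid : BlockSeq ℕ) :
    (top.comp mid).numLive = top.numLive * mid.numLive := by
  induction top with
  | nil => simp
  | cons B top ih =>
    rw [comp_cons, numLive_append, ih]
    cases h : B.live with
    | true => rw [compPiece_live h, numLive_rename, numLive_cons_live h]; ring
    | false =>
      rw [compPiece_dead h, numLive_cons_dead h, numLive_cons_dead h]; simp

theorem numLive_shuffle (d : Diag) (sub bot : BlockSeq ℕ) :
    (shuffle d sub bot).numLive = sub.numLive * bot.numLive := by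
  rw [shuffle_eq]
  generalize 0 = n
  induction sub generalizing n with
  | nil => simp
  | cons B sub ih =>
    rw [shuffleFrom_cons, numLive_append, ih]
    cases h : B.live with
    | true =>
      rw [shufflePiece_live h, numLive_insertLive, numLive_rename, numLive_cons_live h]; ring
    | false =>
      rw [shufflePiece_dead h, numLive_cons_dead h, numLive_cons_dead rfl]; simp

theorem live_length_shuffle {d : Diag} {sub bot : BlockSeq ℕ} {j : ℕ}
    (hlen : ∀ B ∈ sub, B.live = true → B.word.length = bot.numLive)
    (h : ∀ D ∈ bot, D.live = true → D.word.length = j) :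
    ∀ C ∈ shuffle d sub bot, C.live = true → C.word.length = j + 1 := by
  intro C hC hl
  obtain ⟨q, B, hB, hCB⟩ := mem_shuffleFrom hC
  cases hBl : B.live with
  | false =>
    rw [shufflePiece_dead hBl, List.mem_singleton] at hCB
    simp [hCB] at hl
  | true =>
    rw [shufflePiece_live hBl] at hCB
    obtain ⟨D', hD', hDl, c', hc', rfl⟩ := mem_insertLive_live (by simp [hlen B hB hBl]) hCB hl
    obtain ⟨D, hD, rfl⟩ := mem_rename.1 hD'
    rw [insertBlock_length]
    simp [h D hD hDl]

/-- The hypotheses under which `T_π(i, j)` is assembled from `T_top`, `T_mid` and `T_bot`. -/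
structure Assembly (j : ℕ) (top mid bot : BlockSeq ℕ) : Prop where
  top : Regular (alphabetSize mid.word) top
  mid : Regular bot.numLive mid
  bot : Regular j bot

namespace Assembly

variable {j : ℕ} {top mid bot : BlockSeq ℕ} (h : Assembly j top mid bot)
include h

theorem mem_mid (k : ℕ) : k ∈ mid.word ↔ k < alphabetSize mid.word := h.mid.ordered.mem_iff k

theorem liveFirst_comp : LiveFirst (top.comp mid) :=
  h.top.liveFirst.comp h.mid.liveFirst h.mem_mid h.top.length_live

theorem length_live_comp : ∀ C ∈ top.comp mid, C.live = true → C.word.length = bot.numLive :=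
  live_length_comp h.mid.length_live

theorem regular (d : Diag) : Regular (j + 1) (shuffle d (top.comp mid) bot).canonical where
  liveFirst := by
    rw [canonical_eq]
    exact (h.bot.liveFirst.shuffle h.liveFirst_comp h.length_live_comp).rename (injOn_firstRank _)
  ordered := by
    rw [canonical_eq, word_rename]
    exact firstAppearanceOrdered_map_firstRank _
  length_live := by
    rw [canonical_eq]
    intro C hC hl
    obtain ⟨B, hB, rfl⟩ := mem_rename.1 hC
    simpa using live_length_shuffle h.length_live_comp h.bot.length_live B hB hl
  numLive_pos := by
    rw [canonical_eq, numLive_rename, numLive_shuffle, numLive_comp]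
    exact Nat.mul_pos (Nat.mul_pos h.top.numLive_pos h.mid.numLive_pos) h.bot.numLive_pos

theorem liveOrdered {d : Diag} (hbot : LiveOrdered d bot) :
    LiveOrdered d (shuffle d (top.comp mid) bot).canonical := by
  rw [canonical_eq]
  exact (hbot.shuffle h.liveFirst_comp h.length_live_comp).rename (injOn_firstRank _)

end Assembly

theorem regular_classI : ∀ π i j, Regular j (classI π i j) := by
  apply classI_induction
  · intro π i
    rw [classI_zero]
    exact
      { liveFirst := ⟨by simp, by simp, by simp⟩
        ordered := by intro w₁ a w₂ h; simp at h
        length_live := by simp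
        numLive_pos := by simp [numLive] }
  · intro π i j h hj
    rw [classI_base h hj]
    exact regular_classIBase _ _
  · intro π i j h hi h1 h2 h3
    rw [classI_succ h hi]
    exact Assembly.regular ⟨h3, h2, h1⟩ _

theorem assembly_classI (π : List Diag) (i j : ℕ) :
    Assembly j (classITop π i j) (classIMid π i j) (classI π i j) :=
  ⟨regular_classI _ _ _, regular_classI _ _ _, regular_classI _ _ _⟩

theorem liveOrdered_classI : ∀ π i j, LiveOrdered (lastDiag π) (classI π i j) := by
  apply classI_induction
  · intro π i
    rw [classI_zero]
    intro B hB hl a b hab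
    simp only [List.mem_cons, List.not_mem_nil, or_false, or_self] at hB
    simp [hB] at hab
  · intro π i j h hj
    rw [classI_base h hj]
    exact liveOrdered_classIBase _ _
  · intro π i j h hi h1 _ _
    rw [classI_succ h hi]
    exact (assembly_classI π i j).liveOrdered h1

/-! ### Patterns avoided when `|π| = 3` -/

section Split

variable {α : Type}

theorem append_cons_inj_of_first {u₁ u₂ v₁ v₂ : List α} {z : α}
    (h : u₁ ++ z :: v₁ = u₂ ++ z :: v₂) (h1 : z ∉ u₁) (h2 : z ∉ u₂) : u₁ = u₂ ∧ v₁ = v₂ := by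
  induction u₁ generalizing u₂ with
  | nil =>
    cases u₂ with
    | nil => simpa using h
    | cons b u₂ => simp at h h2; exact absurd h.1 h2.1
  | cons a u₁ ih =>
    cases u₂ with
    | nil => simp at h h1; exact absurd h.1.symm h1.1
    | cons b u₂ =>
      simp only [List.cons_append, List.cons.injEq] at h
      simp only [List.mem_cons, not_or] at h1 h2
      obtain ⟨rfl, rfl⟩ := ih h.2 h1.2 h2.2
      exact ⟨by rw [h.1], rfl⟩

theorem sublist_split_of_count_one {i₁ i₂ s t : List α} {z : α}
    (h : (s ++ z :: t).Sublist (i₁ ++ z :: i₂)) (h1 : z ∉ i₁) (h2 : z ∉ i₂) :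
    s.Sublist i₁ ∧ t.Sublist i₂ := by
  induction i₁ generalizing s with
  | nil =>
    cases s with
    | nil => exact ⟨List.Sublist.refl _, by simpa using h⟩
    | cons a s =>
      exfalso
      have h3 : (s ++ z :: t).Sublist i₂ := by
        rw [List.nil_append, List.cons_append] at h
        cases h with
        | cons _ h => exact (List.sublist_cons_self _ _).trans h
        | cons_cons _ h => exact h
      exact h2 (h3.subset (by simp))
  | cons b i₁ ih =>
    simp only [List.mem_cons, not_or] at h1
    rw [List.cons_append] at h
    have key : ∀ s', (s' ++ z :: t).Sublist (i₁ ++ z :: i₂) → s'.Sublist i₁ ∧ t.Sublist i₂ :=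
      fun s' h' => ih h' h1.2
    generalize hl : s ++ z :: t = l at h
    cases h with
    | cons _ h =>
      subst hl
      exact ⟨(key s h).1.cons _, (key s h).2⟩
    | cons_cons _ h =>
      cases s with
      | nil => simp at hl; exact absurd hl.1 h1.1
      | cons a s =>
        simp only [List.cons_append, List.cons.injEq] at hl
        obtain ⟨rfl, rfl⟩ := hl
        exact ⟨(key s h).1.cons_cons _, (key s h).2⟩

/-- No two symbols alternate as `x y x` both before and after the first occurrence of a symbol. -/
def NoCross (w : List α) : Prop :=
  ∀ w₁ z w₂, w = w₁ ++ z :: w₂ → z ∉ w₁ → ∀ x y, x ≠ y → [x, y, x].Sublist w₁ →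
    ¬ [x, y, x].Sublist w₂

theorem NoCross.map {β : Type} {w : List α} (h : NoCross w) {φ : α → β}
    (hφ : Set.InjOn φ {a | a ∈ w}) : NoCross (w.map φ) := by
  intro w₁ z w₂ hw hz x y hxy h1 h2
  obtain ⟨u, v, rfl, rfl, hv⟩ := List.map_eq_append_iff.1 hw
  obtain ⟨a, v, rfl, rfl, rfl⟩ := List.map_eq_cons_iff.1 hv
  have : Nonempty α := ⟨a⟩
  have hl := hφ.leftInvOn_invFunOn
  set ψ := Function.invFunOn φ {b | b ∈ u ++ a :: v}
  have hinv : ∀ t : List α, (∀ b ∈ t, b ∈ u ++ a :: v) → (t.map φ).map ψ = t := by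
    intro t ht
    rw [List.map_map]
    conv_rhs => rw [← List.map_id t]
    exact List.map_congr_left fun b hb => hl (ht b hb)
  have h1' := h1.map ψ
  have h2' := h2.map ψ
  rw [hinv u (by simp +contextual)] at h1'
  rw [hinv v (by simp +contextual)] at h2'
  refine h u a v rfl (fun h => hz (List.mem_map_of_mem h)) (ψ x) (ψ y) ?_ h1' h2'
  obtain ⟨x', hx', rfl⟩ := List.mem_map.1 (h1.subset (by simp : x ∈ _))
  obtain ⟨y', hy', rfl⟩ := List.mem_map.1 (h1.subset (by simp : y ∈ _))
  rw [hl (by simp [hx']), hl (by simp [hy'])]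
  exact fun h => hxy (by rw [h])

theorem noCross_of_twice {w : List α} (h : ∀ x, ¬ [x, x, x].Sublist w) : NoCross w := by
  rintro w₁ z w₂ rfl - x y - h1 h2
  refine h x (List.Sublist.trans ?_ (h1.append (h2.trans (List.sublist_cons_self z w₂))))
  simp

/-- The place of the first occurrence may be any place within a nonempty live block. -/
theorem NoCross.of_live {P Q : BlockSeq α} {D : Block α} (hT : LiveFirst (P ++ D :: Q))
    (h : NoCross (word (P ++ D :: Q))) (hl : D.live = true) {D₁ D₂ : List α}
    (hD : D.word = D₁ ++ D₂) (hne : D.word ≠ []) {x y : α} (hxy : x ≠ y)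
    (h1 : [x, y, x].Sublist (P.word ++ D₁)) : ¬ [x, y, x].Sublist (D₂ ++ Q.word) := by
  intro h2
  have hDn := hT.nodup D (by simp)
  -- If x were in D, it would not occur in P, and the first x y x would repeat x within D.
  have hx : x ∉ D.word := fun hx => by
    have h3 := sublist_right_of_notMem (hT.notMem_left hl hx) h1
    have h4 : [x, x].Sublist D.word :=
      List.Sublist.trans (by simp) (h3.trans (hD ▸ List.sublist_append_left _ _))
    exact append_pair_not_nodup h4 hDn
  rw [hD, List.mem_append, not_or] at hx
  have h3 := sublist_left_of_notMem (s := [x, y]) hx.1 h1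
  have h4 := sublist_right_of_notMem hx.2 h2
  -- Both alternations avoid D altogether, so the cut may be moved to the first symbol of D, which
  -- makes its first appearance there because D is live.
  obtain ⟨z, D', hz⟩ := List.exists_cons_of_ne_nil hne
  refine h P.word z (D' ++ Q.word) (by rw [word_append, word_cons, hz]; simp)
    (hT.notMem_left hl (by simp [hz])) x y hxy h3 (h4.trans (List.sublist_append_right _ _))

end Split

/-! ### The property `NoCross` under shuffles -/

section Shuffle

variable {d : Diag} {bot sub : BlockSeq ℕ}

theorem filterMap_copySymbol_eq_nil {q : ℕ} {w : List (ℕ ⊕ ℕ × ℕ)} (h : ∀ b, Sum.inr (q, b) ∉ w) :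
    w.filterMap (copySymbol q) = [] := by
  rw [List.filterMap_eq_nil_iff]
  rintro (a | ⟨r, b⟩) ha
  · rfl
  · rw [copySymbol, if_neg]
    rintro rfl
    exact h b ha

theorem filterMap_subSymbol_inl_cons (a : ℕ) (w : List (ℕ ⊕ ℕ × ℕ)) :
    (Sum.inl a :: w).filterMap subSymbol = a :: w.filterMap subSymbol := rfl

theorem filterMap_subSymbol_inr_cons (b : ℕ × ℕ) (w : List (ℕ ⊕ ℕ × ℕ)) :
    (Sum.inr b :: w).filterMap subSymbol = w.filterMap subSymbol := rfl

theorem filterMap_copySymbol_inr_cons (q b : ℕ) (w : List (ℕ ⊕ ℕ × ℕ)) :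
    (Sum.inr (q, b) :: w).filterMap (copySymbol q) = b :: w.filterMap (copySymbol q) := by
  simp [copySymbol]

theorem mem_filterMap_copySymbol {q b : ℕ} {w : List (ℕ ⊕ ℕ × ℕ)} :
    b ∈ w.filterMap (copySymbol q) ↔ Sum.inr (q, b) ∈ w := by
  rw [List.mem_filterMap]
  constructor
  · rintro ⟨(a | ⟨r, c⟩), ha, hb⟩
    · cases hb
    · rw [copySymbol] at hb
      split_ifs at hb with h
      cases hb
      exact h ▸ ha
  · exact fun h => ⟨_, h, by simp [copySymbol]⟩

theorem mem_filterMap_subSymbol {a : ℕ} {w : List (ℕ ⊕ ℕ × ℕ)} :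
    a ∈ w.filterMap subSymbol ↔ Sum.inl a ∈ w := by
  rw [List.mem_filterMap]
  constructor
  · rintro ⟨(c | c), hc, h⟩
    · cases h; exact hc
    · cases h
  · exact fun h => ⟨_, h, rfl⟩

theorem exists_insertLive_split {α : Type} (as₁ : List α) (a : α) (as₂ : List α) {T : BlockSeq α}
    (h : (as₁ ++ a :: as₂).length ≤ T.numLive) :
    ∃ (P : BlockSeq α) (D : Block α) (Q : BlockSeq α), T = P ++ D :: Q ∧ D.live = true ∧
      insertLive d (as₁ ++ a :: as₂) T =
        insertLive d as₁ P ++ insertBlock d a D :: insertLive d as₂ Q := by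
  induction T generalizing as₁ with
  | nil => simp at h
  | cons B T ih =>
    cases hB : B.live with
    | true =>
      cases as₁ with
      | nil => exact ⟨[], B, T, rfl, hB, by simp [insertLive_cons_live hB]⟩
      | cons b as₁ =>
        rw [numLive_cons_live hB] at h
        obtain ⟨P, D, Q, rfl, hD, he⟩ := ih as₁ (by simpa using h)
        refine ⟨B :: P, D, Q, rfl, hD, ?_⟩
        rw [List.cons_append, insertLive_cons_live hB, he, insertLive_cons_live hB,
          List.cons_append]
    | false =>
      rw [numLive_cons_dead hB] at h
      obtain ⟨P, D, Q, rfl, hD, he⟩ := ih as₁ h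
      refine ⟨B :: P, D, Q, rfl, hD, ?_⟩
      rw [insertLive_cons_dead hB, he, insertLive_cons_dead hB, List.cons_append]

/-- A symbol of `sub` that occurs in a copy of `bot` splits the copy within a live block. -/
theorem exists_split_shufflePiece {q e : ℕ} {B : Block ℕ} (hl : B.live = true)
    (hlen : B.word.length = bot.numLive) (hn : B.word.Nodup) (heB : e ∈ B.word) :
    ∃ (P : BlockSeq ℕ) (D : Block ℕ) (Q : BlockSeq ℕ) (D₁ D₂ : List ℕ)
      (i₁ i₂ : List (ℕ ⊕ ℕ × ℕ)), bot = P ++ D :: Q ∧ D.live = true ∧ D.word = D₁ ++ D₂ ∧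
      (shufflePiece d bot q B).word = i₁ ++ Sum.inl e :: i₂ ∧ Sum.inl e ∉ i₁ ∧ Sum.inl e ∉ i₂ ∧
      i₁.filterMap (copySymbol q) = P.word ++ D₁ ∧
      i₂.filterMap (copySymbol q) = D₂ ++ Q.word := by
  set φ : ℕ → ℕ ⊕ ℕ × ℕ := fun b => Sum.inr (q, b) with hφ
  obtain ⟨u, v, huv⟩ := List.append_of_mem heB
  have hnd := hn
  rw [huv, List.nodup_append] at hnd
  have heu : e ∉ u := fun h => hnd.2.2 e h e (by simp) rfl
  have hev : e ∉ v := (List.nodup_cons.1 hnd.2.1).1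
  have hlen' : (u.map Sum.inl ++ (Sum.inl e : ℕ ⊕ ℕ × ℕ) :: v.map Sum.inl).length ≤ (bot.rename φ).numLive := by
    rw [numLive_rename, ← hlen, huv]; simp
  obtain ⟨P', D', Q', hT, hDl, he⟩ := exists_insertLive_split (d := d) _ _ _ hlen'
  obtain ⟨P, R, rfl, rfl, hR⟩ := List.map_eq_append_iff.1 hT
  obtain ⟨D, Q, rfl, rfl, rfl⟩ := List.map_eq_cons_iff.1 hR
  change _ = insertLive d _ (BlockSeq.rename φ P) ++ insertBlock d _ ⟨D.live, D.word.map φ⟩ ::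
    insertLive d _ (BlockSeq.rename φ Q) at he
  rw [← List.map_cons, ← List.map_append, ← huv, ← shufflePiece_live hl] at he
  have hword : ∀ (w : List ℕ) (T : BlockSeq ℕ),
      (insertLive d (w.map Sum.inl) (T.rename φ)).word.filterMap (copySymbol q) = T.word := by
    intro w T
    rw [filterMap_insertLive_of_symbols, word_rename, filterMap_copySymbol_inr]
    simp only [List.mem_map]
    rintro a ⟨b, -, rfl⟩
    rfl
  have hnot : ∀ (w : List ℕ) (T : BlockSeq ℕ), e ∉ w →
      Sum.inl e ∉ (insertLive d (w.map Sum.inl) (T.rename φ)).word := by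
    intro w T hw h
    rcases mem_word_insertLive h with h | h
    · exact hw (by simpa using h)
    · simp [hφ] at h
  have hφe : Sum.inl e ∉ D.word.map φ := by simp [hφ]
  have hφD : (D.word.map φ).filterMap (copySymbol q) = D.word := filterMap_copySymbol_inr q _
  rw [he, word_append, word_cons]
  -- An ascending insertion cuts the block behind its last symbol, a descending one before its
  -- first.
  cases d with
  | up =>
    refine ⟨P, D, Q, D.word, [], _ ++ D.word.map φ, _, rfl, hDl, by simp,
      by simp only [insertBlock, List.append_assoc, List.singleton_append]; rfl, ?_, hnot v Q hev,
      ?_, hword v Q⟩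
    · rw [List.mem_append, not_or]
      exact ⟨hnot u P heu, hφe⟩
    · rw [List.filterMap_append, hword, hφD]
  | down =>
    refine ⟨P, D, Q, [], D.word, _, D.word.map φ ++ _, rfl, hDl, by simp,
      by simp only [insertBlock, List.cons_append]; rfl, hnot u P heu, ?_, ?_, ?_⟩
    · rw [List.mem_append, not_or]
      exact ⟨hφe, hnot v Q hev⟩
    · rw [hword, List.append_nil]
    · rw [List.filterMap_append, hword, hφD]

theorem filterMap_copySymbol_of_word {q : ℕ} {B : Block ℕ} {X Y : List (ℕ ⊕ ℕ × ℕ)}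
    (hl : B.live = true) (hX : ∀ b, Sum.inr (q, b) ∉ X) (hY : ∀ b, Sum.inr (q, b) ∉ Y) :
    (X ++ ((shufflePiece d bot q B).word ++ Y)).filterMap (copySymbol q) = bot.word := by
  rw [List.filterMap_append, List.filterMap_append, filterMap_copySymbol_eq_nil hX,
    filterMap_copySymbol_eq_nil hY, filterMap_copySymbol_shufflePiece hl]
  simp

/-- By ties, x and y both come from `sub` or both from one copy of `bot`, so the crossing can be
projected to that sequence. If z comes from the other one, the cut lands inside a nonempty live
block instead of at a first occurrence, and `NoCross.of_live` applies. -/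
theorem NoCross.shuffle {j : ℕ} (hbot : NoCross bot.word) (hbotr : Regular j bot)
    (hsub : NoCross sub.word) (hsubf : LiveFirst sub)
    (hlen : ∀ B ∈ sub, B.live = true → B.word.length = bot.numLive) :
    NoCross (shuffle d sub bot).word := by
  intro w₁ z w₂ hW hz x y hxy h1 h2
  have hseven : [x, y, x, z, x, y, x].Sublist (GenDS.shuffle d sub bot).word := by
    rw [hW]; exact h1.append (h2.cons_cons z)
  rcases x with a | ⟨q, b⟩
  · obtain ⟨c, rfl⟩ : ∃ c, y = Sum.inl c := by
      rcases y with c | ⟨r, c⟩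
      · exact ⟨c, rfl⟩
      · obtain ⟨e, he⟩ := shuffle_tie (d := d) (q := r) (b := c) (v := Sum.inl a) hsubf hlen
          (Or.inl (List.Sublist.trans (by simp) hseven))
        cases he
    have hac : a ≠ c := fun h => hxy (by rw [h])
    rcases z with e | ⟨q, e⟩
    · have hF := filterMap_subSymbol_shuffleFrom (d := d) 0 hlen
      rw [← shuffle_eq, hW, List.filterMap_append, filterMap_subSymbol_inl_cons] at hF
      exact hsub _ e _ hF.symm (fun h => hz (mem_filterMap_subSymbol.1 h)) a c hac
        (h1.filterMap subSymbol) (h2.filterMap subSymbol)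
    -- Seen from `sub`, a symbol z of a copy cuts within the live block B that the copy replaces. B
    -- is nonempty since `bot` has a live block.
    · obtain ⟨P, B, Q, rfl, rfl, hl, hW', hX, hY⟩ :=
        exists_word_shuffle (d := d) (sub := sub) (bot := bot) (q := q) (b := e) (by rw [hW]; simp)
      have hzI : Sum.inr (P.length, e) ∈ (shufflePiece d bot P.length B).word := by
        have : Sum.inr (P.length, e) ∈ (GenDS.shuffle d (P ++ B :: Q) bot).word := by
          rw [hW]; simp
        rw [hW', List.mem_append, List.mem_append] at this
        rcases this with h | h | h
        · exact absurd h (hX e)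
        · exact h
        · exact absurd h (hY e)
      obtain ⟨i₁, i₂, hI, hi₁⟩ := List.eq_append_cons_of_mem hzI
      rw [hI] at hW'
      obtain ⟨rfl, rfl⟩ := append_cons_inj_of_first (u₁ := w₁) (v₁ := w₂)
        (u₂ := (shuffleFrom d bot 0 P).word ++ i₁)
        (v₂ := i₂ ++ (shuffleFrom d bot (P.length + 1) Q).word) (z := Sum.inr (P.length, e))
        (by rw [← hW, hW']; simp) hz (by
          rw [List.mem_append, not_or]; exact ⟨hX e, hi₁⟩)
      have hB := filterMap_subSymbol_shufflePiece (d := d) (bot := bot) P.length (B := B)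
        (hlen B (by simp))
      rw [hI, List.filterMap_append, filterMap_subSymbol_inr_cons] at hB
      have hlen' := hlen B (by simp) hl
      have hp := hbotr.numLive_pos
      have h1' := h1.filterMap subSymbol
      have h2' := h2.filterMap subSymbol
      rw [List.filterMap_append, filterMap_subSymbol_shuffleFrom _
        fun B hB => hlen B (by simp [hB])] at h1' h2'
      refine hsub.of_live hsubf hl hB.symm (fun h => ?_) hac h1' h2'
      rw [h, List.length_nil] at hlen'
      omega
  · obtain ⟨c, rfl⟩ := shuffle_tie (d := d) (q := q) (b := b) (v := y) hsubf hlen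
      (Or.inr (List.Sublist.trans
        (.cons_cons _ (.cons_cons _ (.cons _ (.cons _ (.cons _ (.refl _)))))) hseven))
    have hbc : b ≠ c := fun h => hxy (by rw [h])
    obtain ⟨P, B, Q, rfl, rfl, hl, hW', hX, hY⟩ :=
      exists_word_shuffle (d := d) (sub := sub) (bot := bot) (q := q) (b := b)
        (hseven.subset (by simp))
    have hzI : z ∈ (shufflePiece d bot P.length B).word := by
      have h3 : [Sum.inr (P.length, b), z, Sum.inr (P.length, b)].Sublist
        (GenDS.shuffle d (P ++ B :: Q) bot).word := List.Sublist.trans (by simp) hseven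
      rw [hW'] at h3
      exact (sublist_left_of_notMem (s := [Sum.inr (P.length, b), z]) (hY b)
        (sublist_right_of_notMem (hX b) h3)).subset (by simp)
    have hF := filterMap_copySymbol_of_word (d := d) (bot := bot) hl hX hY
    have h1' := h1.filterMap (copySymbol P.length)
    have h2' := h2.filterMap (copySymbol P.length)
    simp only [filterMap_copySymbol_inr_cons, List.filterMap_nil] at h1' h2'
    rcases z with e | ⟨r, e⟩
    -- Here z is inserted into a live block D of the copy, and its occurrence there is its only one
    -- in the copy.
    · have heB := inl_mem_shufflePiece hzI
      obtain ⟨P₀, D, Q₀, D₁, D₂, i₁, i₂, rfl, hDl, hD, hI, hi₁, -, hf₁, hf₂⟩ :=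
        exists_split_shufflePiece (d := d) (q := P.length) hl (hlen B (by simp) hl)
          (hsubf.nodup B (by simp)) heB
      rw [hI] at hW'
      obtain ⟨rfl, rfl⟩ := append_cons_inj_of_first (u₁ := w₁) (v₁ := w₂)
        (u₂ := (shuffleFrom d (P₀ ++ D :: Q₀) 0 P).word ++ i₁)
        (v₂ := i₂ ++ (shuffleFrom d (P₀ ++ D :: Q₀) (P.length + 1) Q).word) (z := Sum.inl e)
        (by rw [← hW, hW']; simp) hz (by
          rw [List.mem_append, not_or]
          exact ⟨fun h => hsubf.notMem_left hl heB (inl_mem_shuffleFrom h), hi₁⟩)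
      rw [List.filterMap_append, filterMap_copySymbol_eq_nil hX, hf₁, List.nil_append] at h1'
      rw [List.filterMap_append, filterMap_copySymbol_eq_nil hY, hf₂, List.append_nil] at h2'
      refine hbot.of_live hbotr.liveFirst hDl hD (fun h => ?_) hbc h1' h2'
      have hj := hbotr.length_live D (by simp) hDl
      rw [h, List.length_nil] at hj
      -- D is nonempty: b lies in some live block, and all live blocks have the same length.
      have hb : b ∈ word (P₀ ++ D :: Q₀) := by
        have := h2'.subset (show b ∈ [b, c, b] by simp)
        rw [word_append, word_cons, hD]
        simp only [List.mem_append] at this ⊢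
        tauto
      obtain ⟨C, hC, hCl, hbC⟩ := hbotr.liveFirst.exists_live b hb
      have := hbotr.length_live C hC hCl
      rw [← hj, List.length_eq_zero_iff] at this
      simp [this] at hbC
    · obtain ⟨rfl, -⟩ := inr_mem_shufflePiece hzI
      rw [← hW', hW, List.filterMap_append, filterMap_copySymbol_inr_cons] at hF
      exact hbot _ e _ hF.symm (fun h => hz (mem_filterMap_copySymbol.1 h)) b c hbc h1' h2'

end Shuffle

theorem not_triple_classIBase (d : Diag) (j x : ℕ) : ¬ [x, x, x].Sublist (classIBase d j).word := by
  intro h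
  have h1 : List.replicate 3 x = [x, x, x] := rfl
  rw [← h1, List.replicate_sublist_iff, classIBase_word, List.count_append] at h
  have h2 := List.nodup_iff_count_le_one.1 (List.nodup_range (n := j)) x
  cases d
  · simp only at h; omega
  · simp only [List.count_reverse] at h; omega

theorem map_getD_range (w : List ℕ) : (List.range w.length).map (fun k => w.getD k 0) = w := by
  apply List.ext_getElem
  · simp
  · intro i h1 h2
    simp [h2]

theorem LiveFirst.mem_of_shared {P Q : BlockSeq ℕ} {B C : Block ℕ} (h : LiveFirst (P ++ B :: Q))
    (hC : C ∈ P ++ B :: Q) (hl : C.live = true) {x : ℕ} (hx : x ∈ C.word) (hxB : x ∉ B.word)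
    (hxP : x ∈ P.word) : C ∈ P := by
  simp only [List.mem_append, List.mem_cons] at hC
  rcases hC with hC | rfl | hC
  · exact hC
  · exact absurd hx hxB
  · obtain ⟨D, hD, hxD⟩ := mem_word.1 hxP
    exact absurd hx ((List.pairwise_append.1 h.pairwise).2.2 D hD C (by simp [hC]) hl hxD)

/-- First occurrences keep their places because the base sequence begins with its whole alphabet in
order. Symbols x, y sharing a live block cannot alternate after the copy replacing it, by
`LiveOrdered`; otherwise x y x does not notice the composition and can be pulled back to `top`. -/
theorem NoCross.comp {d d' : Diag} {top : BlockSeq ℕ} {l : ℕ} (htop : NoCross top.word)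
    (hf : LiveFirst top) (ho : LiveOrdered d top)
    (hlen : ∀ B ∈ top, B.live = true → B.word.length = l) :
    NoCross (top.comp (classIBase d' l)).word := by
  intro v₁ z v₂ hV hz x y hxy h1 h2
  have hm : ∀ k ∈ (classIBase d' l).word, k < l := fun k => mem_classIBase_word.1
  have hzV : z ∈ (top.comp (classIBase d' l)).word := by rw [hV]; simp
  obtain ⟨B, hB, hl, hzB⟩ := hf.exists_live z (mem_comp hm hlen hzV)
  obtain ⟨P, Q, rfl⟩ := List.append_of_mem hB
  obtain ⟨B₁, B₂, hB12⟩ := List.append_of_mem hzB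
  have hBn := hf.nodup B (by simp)
  have hzB₁ : z ∉ B₁ := by
    rw [hB12, List.nodup_append] at hBn
    exact fun h => hBn.2.2 z h z (by simp) rfl
  -- The copy that replaces B starts with B itself.
  have hI : ∃ I, (compPiece (classIBase d' l) B).word = B.word ++ I := by
    rw [compPiece_live hl, word_rename, classIBase_word, List.map_append, ← hlen B (by simp) hl,
      map_getD_range]
    exact ⟨_, rfl⟩
  obtain ⟨I, hI⟩ := hI
  have hIB : ∀ a ∈ I, a ∈ B.word := fun a ha =>
    mem_compPiece hm (hlen B (by simp)) (by rw [hI]; simp [ha])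
  have hXB : ∀ {a}, a ∈ B.word → a ∉ (BlockSeq.comp P (classIBase d' l)).word :=
    fun ha => hf.notMem_comp_left hm hlen hl ha
  rw [comp_append, comp_cons, word_append, word_append, hI, hB12] at hV
  obtain ⟨rfl, rfl⟩ := append_cons_inj_of_first (u₁ := v₁) (v₁ := v₂)
    (u₂ := (BlockSeq.comp P (classIBase d' l)).word ++ B₁)
    (v₂ := B₂ ++ I ++ (BlockSeq.comp Q (classIBase d' l)).word) (z := z) (by rw [← hV]; simp) hz
    (by rw [List.mem_append, not_or]; exact ⟨hXB hzB, hzB₁⟩)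
  have hB₁B : ∀ {a}, a ∈ B₁ → a ∈ B.word := fun h => by rw [hB12]; simp [h]
  have hB₂B : ∀ {a}, a ∈ B₂ → a ∈ B.word := fun h => by rw [hB12]; simp [h]
  have hx : x ∉ B.word := fun hx => by
    have h3 := sublist_right_of_notMem (hXB hx) h1
    have h4 : [x, x].Sublist B.word := List.Sublist.trans (by simp)
      (h3.trans (hB12 ▸ List.sublist_append_left B₁ _))
    exact append_pair_not_nodup h4 hBn
  have h3 : [x, y, x].Sublist (BlockSeq.comp P (classIBase d' l)).word :=
    sublist_left_of_notMem (s := [x, y]) (fun h => hx (hB₁B h)) h1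
  have h4 : [x, y, x].Sublist (BlockSeq.comp Q (classIBase d' l)).word := by
    refine sublist_right_of_notMem (fun h => ?_) h2
    rcases List.mem_append.1 h with h | h
    · exact hx (hB₂B h)
    · exact hx (hIB x h)
  have hlenP : ∀ C ∈ P, C.live = true → C.word.length = l := fun C hC => hlen C (by simp [hC])
  have hlenQ : ∀ C ∈ Q, C.live = true → C.word.length = l := fun C hC => hlen C (by simp [hC])
  by_cases hsep : ∃ C ∈ P ++ B :: Q, C.live = true ∧ x ∈ C.word ∧ y ∈ C.word
  · obtain ⟨C, hC, hCl, hxC, hyC⟩ := hsep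
    have hCP := hf.mem_of_shared hC hCl hxC hx (mem_comp hm hlenP (h3.subset (by simp)))
    obtain ⟨P₁, P₂, rfl⟩ := List.append_of_mem hCP
    rw [List.append_assoc, List.cons_append] at hf ho hlen
    have h5 : [x, y, x].Sublist (BlockSeq.comp (P₂ ++ B :: Q) (classIBase d' l)).word := by
      rw [comp_append, comp_cons, word_append, word_append]
      exact h4.trans ((List.sublist_append_right _ _).trans (List.sublist_append_right _ _))
    exact ho.not_alternating rfl hCl hxC hyC hxy
      (hf.sublist_comp_right hm hlen (by simp [hxC, hyC]) h5)
  · have hchain : [x, y, x].IsChain (· ≠ ·) := by simp [hxy, hxy.symm]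
    have hone : ∀ C ∈ P ++ B :: Q, C.live = true → ∀ a ∈ [x, y, x], ∀ b ∈ [x, y, x],
        a ∈ C.word → b ∈ C.word → a = b := by
      intro C hC hCl a ha b hb haC hbC
      have hn : ¬ (x ∈ C.word ∧ y ∈ C.word) := fun h => hsep ⟨C, hC, hCl, h⟩
      simp only [List.mem_cons, List.not_mem_nil, or_false] at ha hb
      rcases ha with rfl | rfl | rfl <;> rcases hb with rfl | rfl | rfl <;> tauto
    have h5 := sublist_of_sublist_comp_of_separate hm hlenP h3 hchain
      fun C hC => hone C (by simp [hC])
    have h6 := sublist_of_sublist_comp_of_separate hm hlenQ h4 hchain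
      fun C hC => hone C (by simp [hC])
    refine htop (word P ++ B₁) z (B₂ ++ word Q) (by simp [hB12]) ?_ x y hxy
      (h5.trans (List.sublist_append_left _ _)) (h6.trans (List.sublist_append_right _ _))
    rw [List.mem_append, not_or]
    exact ⟨hf.notMem_left hl hzB, hzB₁⟩

/-- The pattern `12321232`. -/
def patternA : List ℕ := [1, 2, 3, 2, 1, 2, 3, 2]

/-- The pattern `12131213`. -/
def patternB : List ℕ := [1, 2, 1, 3, 1, 2, 1, 3]

/-- A pattern in which `x` occurs three times before `y x` does not fit into one copy of a sequence
with at most two occurrences of every symbol. -/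
theorem not_contained_comp {d : Diag} {top mid : BlockSeq ℕ} {n : ℕ} (hf : LiveFirst top)
    (ho : LiveOrdered d top) (hm : ∀ k ∈ mid.word, k < n)
    (hlen : ∀ B ∈ top, B.live = true → B.word.length = n)
    (htwice : ∀ x, ¬ [x, x, x].Sublist mid.word) {σ : List ℕ} (hc : σ.IsChain (· ≠ ·))
    (hsep : ∀ x ∈ σ, ∀ y ∈ σ, ∀ z ∈ σ, x ≠ y → x ≠ z → y ≠ z →
      Separated σ x y z ∨ Separated σ y x z) {x y : ℕ} (hxy : x ≠ y)
    (hσ : [x, x, x, y, x].Sublist σ) (h : ¬ Contained σ top.word) :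
    ¬ Contained σ (top.comp mid).word := by
  intro hcon
  rcases hcon.comp hf ho hm hlen hc hsep with hcon | ⟨P, B, Q, σ₁, σ₂, g, rfl, hl, rfl, hi, hg, h1, h2⟩
  · exact h hcon
  have hx : x ∈ σ₁ ++ σ₂ := hσ.subset (by simp)
  have hy : y ∈ σ₁ ++ σ₂ := hσ.subset (by simp)
  have hBl := hlen B (by simp) hl
  have h3 : ¬ [x, x, x].Sublist σ₁ := fun h => htwice (g x) ((h.map g).trans h1)
  have h4 : [x, y, x].Sublist σ₂ := by
    -- At most two of the three initial x fit into σ₁, so σ₂ contains x y x, an alternation after B.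
    obtain ⟨s, t, hst, hs, ht⟩ := List.sublist_append_iff.1 hσ
    match s, hst with
    | [], hst => rw [List.nil_append] at hst; subst hst; exact List.Sublist.trans (by simp) ht
    | [a], hst =>
      simp only [List.cons_append, List.nil_append, List.cons.injEq] at hst
      obtain ⟨-, rfl⟩ := hst
      exact List.Sublist.trans (by simp) ht
    | [a, b], hst =>
      simp only [List.cons_append, List.nil_append, List.cons.injEq] at hst
      obtain ⟨-, -, rfl⟩ := hst
      exact ht
    | a :: b :: c :: s, hst =>
      simp only [List.cons_append, List.cons.injEq] at hst
      obtain ⟨rfl, rfl, rfl, -⟩ := hst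
      exact absurd (List.Sublist.trans (by simp) hs) h3
  refine ho.not_alternating rfl hl (a := B.word.getD (g x) 0) (b := B.word.getD (g y) 0)
    (getD_mem (hBl ▸ hg x hx)) (getD_mem (hBl ▸ hg y hy)) ?_ ?_
  · intro he
    exact hxy (hi hx hy (injOn_getD (hf.nodup B (by simp)) (hBl ▸ hg x hx : g x < _)
      (hBl ▸ hg y hy : g y < _) he))
  · exact (h4.map _).trans h2

theorem separated_patternA : ∀ x ∈ patternA, ∀ y ∈ patternA, ∀ z ∈ patternA, x ≠ y → x ≠ z →
    y ≠ z → Separated patternA x y z ∨ Separated patternA y x z := by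
  unfold Separated patternA; decide

theorem separated_patternB : ∀ x ∈ patternB, ∀ y ∈ patternB, ∀ z ∈ patternB, x ≠ y → x ≠ z →
    y ≠ z → Separated patternB x y z ∨ Separated patternB y x z := by
  unfold Separated patternB; decide

/-- In 12131213 the symbols 1 and 2 are tied to each other and 3 is tied to 1, but 1 is not tied to
3. So 3 might come from `sub` while 1 and 2 come from a copy; this remaining case is excluded by
`NoCross`. -/
theorem patternB_shuffle {d : Diag} {sub bot : BlockSeq ℕ} (hsub : LiveFirst sub)
    (hlen : ∀ B ∈ sub, B.live = true → B.word.length = bot.numLive)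
    (hcross : NoCross (shuffle d sub bot).word)
    (h : Contained patternB (shuffle d sub bot).word) :
    Contained patternB sub.word ∨ Contained patternB bot.word := by
  obtain ⟨f, hi, hf⟩ := h
  by_cases hall : ∀ x ∈ patternB, ∃ a, f x = Sum.inl a
  · exact Or.inl (Contained.of_forall_inl hlen hi hf hall)
  right
  push Not at hall
  obtain ⟨x, hx, hxn⟩ := hall
  rcases hfx : f x with a | ⟨q, b⟩
  · exact absurd hfx (hxn a)
  have t21 : Tied patternB 2 1 := by unfold Tied patternB; decide
  have t12 : Tied patternB 1 2 := by unfold Tied patternB; decide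
  have t31 : Tied patternB 3 1 := by unfold Tied patternB; decide
  have h1 : ∃ c, f 1 = Sum.inr (q, c) := by
    have : x = 1 ∨ x = 2 ∨ x = 3 := by simp [patternB] at hx; omega
    rcases this with rfl | rfl | rfl
    · exact ⟨b, hfx⟩
    · exact t21.map_inr hsub hlen hf hfx
    · exact t31.map_inr hsub hlen hf hfx
  obtain ⟨c, hc⟩ := h1
  obtain ⟨e, he⟩ := t12.map_inr hsub hlen hf hc
  refine Contained.of_forall_inr (q := q) hi hf fun y hy => ?_
  have : y = 1 ∨ y = 2 ∨ y = 3 := by simp [patternB] at hy; omega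
  rcases this with rfl | rfl | rfl
  · exact ⟨c, hc⟩
  · exact ⟨e, he⟩
  by_contra hf3
  obtain ⟨P, B, Q, rfl, rfl, hl, hW, hX, hY⟩ := exists_word_shuffle (d := d) (sub := sub)
    (bot := bot) (q := q) (b := c) (hc ▸ hf.subset (List.mem_map_of_mem (by decide)))
  -- The part 121 3 121 begins and ends with a symbol of the copy, hence lies in the copy. A symbol
  -- of `sub` in the role of 3 has its first occurrence there, between two alternations.
  have h7 : [f 1, f 2, f 1, f 3, f 1, f 2, f 1].Sublist (shuffle d (P ++ B :: Q) bot).word :=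
    List.Sublist.trans (List.Sublist.map f
      (by decide : [1, 2, 1, 3, 1, 2, 1].Sublist patternB)) hf
  have h8 : [f 1, f 2, f 1, f 3, f 1, f 2, f 1].Sublist (shufflePiece d bot P.length B).word := by
    rw [hW, hc] at h7
    rw [hc]
    exact sublist_left_of_notMem (s := [_, _, _, _, _, _]) (hY c)
      (sublist_right_of_notMem (hX c) h7)
  have h3I : f 3 ∈ (shufflePiece d bot P.length B).word := h8.subset (by simp)
  rcases hf3e : f 3 with a | ⟨r, b'⟩
  · rw [hf3e] at h3I h8
    have haB := inl_mem_shufflePiece h3I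
    obtain ⟨-, -, -, -, -, i₁, i₂, -, -, -, hI, hi₁, hi₂, -, -⟩ :=
      exists_split_shufflePiece (d := d) (q := P.length) hl (hlen B (by simp) hl)
        (hsub.nodup B (by simp)) haB
    rw [hI] at h8 hW
    obtain ⟨h9, h10⟩ := sublist_split_of_count_one (s := [f 1, f 2, f 1]) h8 hi₁ hi₂
    refine hcross ((shuffleFrom d bot 0 P).word ++ i₁) (Sum.inl a)
      (i₂ ++ (shuffleFrom d bot (P.length + 1) Q).word) (by rw [hW]; simp) ?_ (f 1) (f 2) ?_
      (h9.trans (List.sublist_append_right _ _)) (h10.trans (List.sublist_append_left _ _))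
    · rw [List.mem_append, not_or]
      exact ⟨fun h => hsub.notMem_left hl haB (inl_mem_shuffleFrom h), hi₁⟩
    · intro h
      have := hi (show 1 ∈ patternB by decide) (show 2 ∈ patternB by decide) h
      omega
  · rw [hf3e] at h3I
    obtain ⟨rfl, -⟩ := inr_mem_shufflePiece h3I
    exact hf3 ⟨b', hf3e⟩

/-- For `|π| ≤ 3` the Class I sequences avoid `12321232` and `12131213`. -/
theorem classI_three : ∀ π i j, π.length = 3 →
    ¬ Contained patternA (classI π i j).word ∧ ¬ Contained patternB (classI π i j).word ∧
      NoCross (classI π i j).word := by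
  have twice : ∀ w : List ℕ, (∀ x, ¬ [x, x, x].Sublist w) →
      ¬ Contained patternA w ∧ ¬ Contained patternB w ∧ NoCross w := by
    intro w hw
    refine ⟨?_, ?_, noCross_of_twice hw⟩
    · rintro ⟨f, -, hf⟩
      exact hw (f 2) (List.Sublist.trans
        (List.Sublist.map f (by decide : [2, 2, 2].Sublist patternA)) hf)
    · rintro ⟨f, -, hf⟩
      exact hw (f 1) (List.Sublist.trans
        (List.Sublist.map f (by decide : [1, 1, 1].Sublist patternB)) hf)
  apply classI_induction
  · intro π i _
    rw [classI_zero]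
    exact twice _ (by simp)
  · intro π i j h hj _
    rw [classI_base h hj]
    exact twice _ (not_triple_classIBase _ _)
  · intro π i j h hi h1 _ h3 hp
    obtain ⟨hA1, hB1, hC1⟩ := h1 hp
    obtain ⟨hA3, hB3, hC3⟩ := h3 hp
    have hasm := assembly_classI π i j
    -- Since |π⁻| = 2, T_mid is a base sequence, in which no symbol occurs three times.
    have hmid : classIMid π i j = classIBase (lastDiag π.dropLast) (classI π i j).numLive := by
      have := hasm.bot.numLive_pos
      exact classI_base (by simp [hp]) (by omega)
    have htop : classITop π i j = classI π (i - 1) (alphabetSize (classIMid π i j).word) := rfl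
    have ho : LiveOrdered (lastDiag π) (classITop π i j) := liveOrdered_classI _ _ _
    rw [← htop] at hA3 hB3 hC3
    have htw : ∀ x, ¬ [x, x, x].Sublist (classIMid π i j).word := by
      rw [hmid]; exact not_triple_classIBase _ _
    have hm : ∀ k ∈ (classIMid π i j).word, k < alphabetSize (classIMid π i j).word :=
      fun k => (hasm.mem_mid k).1
    -- The pattern 12321232 contains 2 2 2 3 2, and below 12131213 contains 1 1 1 2 1.
    have hA := not_contained_comp hasm.top.liveFirst ho hm hasm.top.length_live htw
      (σ := patternA) (by decide) separated_patternA (x := 2) (y := 3) (by decide) (by decide) hA3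
    have hB := not_contained_comp hasm.top.liveFirst ho hm hasm.top.length_live htw
      (σ := patternB) (by decide) separated_patternB (x := 1) (y := 2) (by decide) (by decide) hB3
    have hC : NoCross ((classITop π i j).comp (classIMid π i j)).word := by
      have hlen := hasm.top.length_live
      rw [hmid, alphabetSize_classIBase] at hlen
      rw [hmid]
      exact hC3.comp hasm.top.liveFirst ho hlen
    have hW := NoCross.shuffle (d := lastDiag π) hC1 hasm.bot hC hasm.liveFirst_comp
      hasm.length_live_comp
    rw [classI_succ h hi, canonical_eq, word_rename]
    refine ⟨fun hcon => ?_, fun hcon => ?_, hW.map (injOn_firstRank _)⟩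
    · rcases (hcon.of_map (injOn_firstRank _)).shuffle hasm.liveFirst_comp hasm.length_live_comp
        (c := 2) (by unfold Tied patternA; decide) with h | h
      · exact hA h
      · exact hA1 h
    · rcases patternB_shuffle hasm.liveFirst_comp hasm.length_live_comp hW
        (hcon.of_map (injOn_firstRank _)) with h | h
      · exact hB h
      · exact hB1 h

/-! ### The `M`-shaped sequences -/

theorem pairwise_range' (s n : ℕ) : (List.range' s n).Pairwise (· < ·) :=
  List.pairwise_lt_range'

theorem sublist_range' {l : List ℕ} {s n : ℕ} (hl : l.Pairwise (· < ·))
    (h : ∀ x ∈ l, s ≤ x ∧ x < s + n) : l.Sublist (List.range' s n) := by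
  refine List.sublist_of_subperm_of_pairwise (r := (· < ·)) ?_ hl List.pairwise_lt_range'
  exact List.subperm_of_subset (hl.imp fun h => ne_of_lt h) fun x hx => by
    simpa using h x hx

theorem sublist_reverse_range' {l : List ℕ} {s n : ℕ} (hl : l.Pairwise (· > ·))
    (h : ∀ x ∈ l, s ≤ x ∧ x < s + n) : l.Sublist (List.range' s n).reverse := by
  rw [← List.reverse_sublist, List.reverse_reverse]
  exact sublist_range' (List.pairwise_reverse.2 hl) fun x hx => h x (by simpa using hx)

/-- One monotone word is taken from each of the four strokes of M_k. Consecutive strokes share a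
turning point, which is counted in the earlier one; hence the shorter ranges of the last three. -/
theorem sublist_mShape {k : ℕ} {a b c e : List ℕ} (ha : a.Pairwise (· < ·))
    (ha' : ∀ x ∈ a, 1 ≤ x ∧ x ≤ k + 1) (hb : b.Pairwise (· > ·)) (hb' : ∀ x ∈ b, 1 ≤ x ∧ x ≤ k)
    (hc : c.Pairwise (· < ·)) (hc' : ∀ x ∈ c, 2 ≤ x ∧ x ≤ k + 1) (he : e.Pairwise (· > ·))
    (he' : ∀ x ∈ e, 1 ≤ x ∧ x ≤ k) : (a ++ b ++ c ++ e).Sublist (mShape k) := by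
  refine (((sublist_range' ha fun x hx => ?_).append (sublist_reverse_range' hb fun x hx => ?_)).append
    (sublist_range' hc fun x hx => ?_)).append (sublist_reverse_range' he fun x hx => ?_)
  · have := ha' x hx; omega
  · have := hb' x hx; omega
  · have := hc' x hx; omega
  · have := he' x hx; omega

theorem mem_mShape {k x : ℕ} (h : x ∈ mShape k) : 1 ≤ x ∧ x ≤ k + 1 := by
  simp only [mShape, List.mem_append, List.mem_reverse, List.mem_range'_1] at h
  omega

theorem isChain_mShape (k : ℕ) : (mShape k).IsChain (· ≠ ·) := by
  have hup : ∀ s n, (List.range' s n).IsChain (· ≠ ·) := fun s n =>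
    ((pairwise_range' _ _).imp fun h => ne_of_lt h).isChain
  have hdown : ∀ s n, (List.range' s n).reverse.IsChain (· ≠ ·) := fun s n =>
    (List.pairwise_reverse.2 ((pairwise_range' _ _).imp fun h => (ne_of_lt h).symm)).isChain
  cases k with
  | zero => simp [mShape]
  | succ k =>
    have h1 : (List.range' 1 (k + 1)).reverse = (k + 1) :: (List.range' 1 k).reverse := by
      rw [← List.range'_append_1 (s := 1) (m := k) (n := 1)]
      simp [add_comm]
    unfold mShape
    refine List.IsChain.append (List.IsChain.append (List.IsChain.append (hup _ _) (hdown _ _) ?_)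
      (hup _ _) ?_) (hdown _ _) ?_
    all_goals
      intro x hx y hy
      simp only [List.getLast?_append, List.head?_reverse, List.getLast?_reverse,
        List.getLast?_range', List.head?_range'] at hx hy
      simp at hx hy
      omega

theorem tied_mShape {k x : ℕ} (hx : x ∈ mShape k) (h1 : x ≠ 1) :
    Tied (mShape k) x 1 ∧ Tied (mShape k) 1 x := by
  have := mem_mShape hx
  constructor
  · left
    exact sublist_mShape (a := [1, x]) (b := [1]) (c := [x]) (e := []) (by simp; omega)
      (by simp; omega) (by simp) (by simp; omega) (by simp) (by simp; omega) (by simp) (by simp)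
  · right
    exact sublist_mShape (a := [1, x]) (b := []) (c := [x]) (e := [1]) (by simp; omega)
      (by simp; omega) (by simp) (by simp) (by simp) (by simp; omega) (by simp) (by simp; omega)

theorem separated_mShape {k : ℕ} : ∀ x ∈ mShape k, ∀ y ∈ mShape k, ∀ z ∈ mShape k, x ≠ y → x ≠ z →
    y ≠ z → Separated (mShape k) x y z ∨ Separated (mShape k) y x z := by
  intro x hx y hy z hz hxy hxz hyz
  wlog hlt : x < y generalizing x y
  · exact (this y hy x hx hxy.symm hyz hxz (by omega)).symm
  left
  have hx := mem_mShape hx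
  have hy := mem_mShape hy
  have hz := mem_mShape hz
  by_cases h1 : z < x
  · left
    exact sublist_mShape (a := [x]) (b := [z]) (c := [x, y]) (e := [x]) (by simp)
      (by simp; omega) (by simp) (by simp; omega) (by simp; omega) (by simp; omega) (by simp)
      (by simp; omega)
  right
  by_cases h2 : z < y
  · exact sublist_mShape (a := [x, z, y]) (b := [x]) (c := [y]) (e := []) (by simp; omega)
      (by simp; omega) (by simp) (by simp; omega) (by simp) (by simp; omega) (by simp)
      (by simp)
  · exact sublist_mShape (a := [x, z]) (b := [y, x]) (c := [y]) (e := []) (by simp; omega)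
      (by simp; omega) (by simp; omega) (by simp; omega) (by simp) (by simp; omega) (by simp)
      (by simp)

section SplitAt

variable {α : Type} {a b c e : List α}

theorem prefix_of_append_eq (h : a ++ b = c ++ e) (hl : b.length ≤ e.length) : c.Sublist a := by
  have hlen := congrArg List.length h
  simp only [List.length_append] at hlen
  exact (List.prefix_of_prefix_length_le ⟨e, h.symm⟩ ⟨b, rfl⟩ (by omega)).sublist

theorem suffix_of_append_eq (h : a ++ b = c ++ e) (hl : e.length ≤ b.length) : e.Sublist b :=
  (List.suffix_of_suffix_length_le ⟨c, h.symm⟩ ⟨a, rfl⟩ hl).sublist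

end SplitAt

/-- If all symbols of an occurrence of `M_{2h}` in `T_top ∘ T_mid` belong to one live block of
`T_top`, after which they are ordered, then `M_h` occurs in `T_mid`. -/
theorem contained_half {h : ℕ} (hh : 1 ≤ h) {σ₁ σ₂ w : List ℕ} {g : ℕ → ℕ}
    (hσ : mShape (2 * h) = σ₁ ++ σ₂) (hg : Set.InjOn g {a | a ∈ mShape (2 * h)})
    (hw : FirstAppearanceOrdered w) (h1 : (σ₁.map g).Sublist w)
    (h2 : ∀ x ∈ mShape (2 * h), ∀ y ∈ mShape (2 * h), g x < g y → ¬ [y, x].Sublist σ₂) :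
    Contained (mShape h) w := by
  have hmem : ∀ x, 1 ≤ x → x ≤ 2 * h + 1 → x ∈ mShape (2 * h) := by
    intro x hx hx'
    simp only [mShape, List.mem_append, List.mem_range'_1]
    omega
  have hlt : ∀ x y, 1 ≤ x → x ≤ 2 * h + 1 → 1 ≤ y → y ≤ 2 * h + 1 → x ≠ y → [y, x].Sublist σ₂ →
      g y < g x := by
    intro x y hx hx' hy hy' hxy hs
    have h3 := h2 x (hmem x hx hx') y (hmem y hy hy')
    rcases lt_trichotomy (g x) (g y) with h4 | h4 | h4
    · exact absurd hs (h3 h4)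
    · exact absurd (hg (hmem x hx hx') (hmem y hy hy') h4) hxy
    · exact h4
  have hD : (List.range' 1 (2 * h)).reverse =
      (List.range' (h + 1) h).reverse ++ (List.range' 1 h).reverse := by
    rw [← List.reverse_append, two_mul, ← List.range'_append_1 (s := 1) (m := h) (n := h),
      add_comm 1 h]
  -- Here σ₂ lies within the final h … 1, so σ₁ contains M_h on the symbols h+1, …, 2h+1.
  by_cases hc1 : σ₂.length ≤ h
  · have hs : mShape (2 * h) = (List.range' 1 (2 * h + 1) ++ (List.range' 1 (2 * h)).reverse ++
        List.range' 2 (2 * h) ++ (List.range' (h + 1) h).reverse) ++ (List.range' 1 h).reverse := by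
      rw [List.append_assoc _ (List.range' (h + 1) h).reverse, ← hD]; rfl
    rw [hσ] at hs
    have h3 := prefix_of_append_eq hs (by simpa using hc1)
    have hmap : ∀ s n, (List.range' s n).map (fun x => h + x) = List.range' (h + s) n :=
      fun s n => List.map_add_range' ..
    refine ⟨fun x => g (h + x), ?_, ?_⟩
    · intro x hx y hy hxy
      have hx := mem_mShape hx
      have hy := mem_mShape hy
      have := hg (hmem (h + x) (by omega) (by omega)) (hmem (h + y) (by omega) (by omega)) hxy
      omega
    · have h4 : (mShape h).map (fun x => g (h + x)) = ((mShape h).map fun x => h + x).map g := by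
        rw [List.map_map]; rfl
      rw [h4]
      refine (List.Sublist.map g (List.Sublist.trans ?_ h3)).trans h1
      simp only [mShape, List.map_append, List.map_reverse, hmap]
      refine ((List.Sublist.append ?_ ?_).append ?_).append (List.Sublist.refl _)
      · exact sublist_range' List.pairwise_lt_range' fun x hx => by
          rw [List.mem_range'_1] at hx; omega
      · refine sublist_reverse_range' (List.pairwise_reverse.2 List.pairwise_lt_range') fun x hx => ?_
        rw [List.mem_reverse, List.mem_range'_1] at hx; omega
      · exact sublist_range' List.pairwise_lt_range' fun x hx => by
          rw [List.mem_range'_1] at hx; omega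
  push Not at hc1
  -- From here on σ₂ contains h+1, h, …, 1, and its order forces g (h+1) < … < g 1.
  have hdec : ∀ x y, 1 ≤ x → x < y → y ≤ h + 1 → g y < g x := by
    intro x y hx hxy hy
    refine hlt x y hx (by omega) (by omega) (by omega) (by omega) ?_
    have hs : mShape (2 * h) = (List.range' 1 (2 * h + 1) ++ (List.range' 1 (2 * h)).reverse ++
        List.range' 2 (2 * h) ++ (List.range' (h + 2) (h - 1)).reverse) ++
          (List.range' 1 (h + 1)).reverse := by
      have : (List.range' 1 (2 * h)).reverse =
          (List.range' (h + 2) (h - 1)).reverse ++ (List.range' 1 (h + 1)).reverse := by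
        rw [← List.reverse_append, show h + 2 = 1 + (h + 1) by ring, List.range'_append_1]
        congr 2; omega
      rw [List.append_assoc _ (List.range' (h + 2) (h - 1)).reverse, ← this]; rfl
    rw [hσ] at hs
    refine List.Sublist.trans ?_ (suffix_of_append_eq hs (by simpa using hc1))
    exact sublist_reverse_range' (by simpa using hxy) (by simp; omega)
  have hU2 : List.range' 2 (2 * h) = List.range' 2 (2 * h - 2) ++ ([2 * h] ++ [2 * h + 1]) := by
    have h3 : [2 * h] ++ [2 * h + 1] = List.range' (2 + (2 * h - 2)) 2 := by
      rw [show 2 + (2 * h - 2) = 2 * h by omega]; rfl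
    rw [h3, List.range'_append_1]
    congr 1; omega
  -- This bound means that σ₂ starts no earlier than the second peak 2h+1.
  by_cases hc2 : σ₂.length ≤ 2 * h + 1
  · have hs : mShape (2 * h) = (List.range' 1 (2 * h + 1) ++ (List.range' 1 (2 * h)).reverse ++
        (List.range' 2 (2 * h - 2) ++ [2 * h])) ++
          ([2 * h + 1] ++ (List.range' 1 (2 * h)).reverse) := by
      rw [mShape, hU2]; simp
    rw [hσ] at hs
    have h3 := prefix_of_append_eq hs (by simpa using hc2)
    have h4 : List.range' 2 (2 * h - 2) ++ [2 * h] = List.range' 2 (2 * h - 1) := by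
      have h5 : [2 * h] = List.range' (2 + (2 * h - 2)) 1 := by
        rw [show 2 + (2 * h - 2) = 2 * h by omega]; rfl
      rw [h5, List.range'_append_1]
      congr 1; omega
    rw [h4] at h3
    have h5 : (List.range' 1 (h + 1) ++ (List.range' 1 h).reverse ++ List.range' 2 h).Sublist σ₁ := by
      refine List.Sublist.trans ((List.Sublist.append ?_ ?_).append ?_) h3
      · exact sublist_range' List.pairwise_lt_range' fun x hx => by
          rw [List.mem_range'_1] at hx; omega
      · refine sublist_reverse_range' (List.pairwise_reverse.2 List.pairwise_lt_range') fun x hx => ?_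
        rw [List.mem_reverse, List.mem_range'_1] at hx; omega
      · exact sublist_range' List.pairwise_lt_range' fun x hx => by
          rw [List.mem_range'_1] at hx; omega
    have h6 := (h5.map g).trans h1
    have h7 : List.range' 1 (h + 1) = 1 :: List.range' 2 h := by
      rw [List.range'_succ]
    rw [h7, List.cons_append, List.cons_append, List.map_cons] at h6
    -- σ₁ contains 1 … h+1 … 1 … h+1. Canonical form supplies h+1, …, 2 in front of the first 1,
    -- which yields M_h under x ↦ h+2−x.
    have h8 := hw.sublist (r := (List.range' 2 h).reverse.map g) h6 (by
      have : (List.range' 2 h).reverse.map g ++ [g 1] = (List.range' 1 (h + 1)).reverse.map g := by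
        rw [h7]; simp
      rw [this, List.pairwise_map, List.pairwise_reverse]
      refine (pairwise_range' _ _).imp_of_mem fun {a b} ha hb hab => ?_
      rw [List.mem_range'_1] at ha hb
      exact hdec a b ha.1 hab (by omega))
    have hrev : ∀ s n, s + n ≤ h + 2 → 1 ≤ s → (List.range' s n).map (fun x => h + 2 - x) =
        (List.range' (h + 3 - s - n) n).reverse := by
      intro s n hsn hs1
      apply List.ext_getElem
      · simp
      · intro i hi hi'
        simp at hi
        simp
        omega
    refine ⟨fun x => g (h + 2 - x), ?_, ?_⟩
    · intro x hx y hy hxy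
      have hx := mem_mShape hx
      have hy := mem_mShape hy
      have := hg (hmem (h + 2 - x) (by omega) (by omega)) (hmem (h + 2 - y) (by omega) (by omega)) hxy
      omega
    · have h9 : (mShape h).map (fun x => g (h + 2 - x)) =
          ((mShape h).map fun x => h + 2 - x).map g := by
        rw [List.map_map]; rfl
      rw [h9]
      convert h8 using 1
      simp only [mShape, List.map_append (f := fun x => h + 2 - x),
        List.map_reverse (f := fun x => h + 2 - x)]
      rw [
        hrev 1 (h + 1) (by omega) le_rfl, hrev 1 h (by omega) le_rfl, hrev 2 h (by omega) (by omega)]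
      rw [show h + 3 - 1 - (h + 1) = 1 by omega, show h + 3 - 1 - h = 2 by omega,
        show h + 3 - 2 - h = 1 by omega, h7]
      simp
  -- Now σ₂ contains 2h, 2h+1, 2h, which no order of these two symbols allows.
  · exfalso
    push Not at hc2
    have hs : mShape (2 * h) = (List.range' 1 (2 * h + 1) ++ (List.range' 1 (2 * h)).reverse ++
        List.range' 2 (2 * h - 2)) ++
          ([2 * h] ++ ([2 * h + 1] ++ (List.range' 1 (2 * h)).reverse)) := by
      rw [mShape, hU2]; simp
    rw [hσ] at hs
    have h3 := suffix_of_append_eq hs (by simpa using hc2)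
    have h4 : [2 * h].Sublist (List.range' 1 (2 * h)).reverse := by
      rw [List.singleton_sublist, List.mem_reverse, List.mem_range'_1]; omega
    have h5 : [2 * h, 2 * h + 1, 2 * h].Sublist σ₂ :=
      List.Sublist.trans ((h4.cons_cons _).cons_cons _) h3
    have h6 := hlt (2 * h + 1) (2 * h) (by omega) (by omega) (by omega) (by omega) (by omega)
      (List.Sublist.trans (by simp) h5)
    have h7 := hlt (2 * h) (2 * h + 1) (by omega) (by omega) (by omega) (by omega) (by omega)
      (List.Sublist.trans (by simp) h5)
    omega

theorem pair_sublist_of_lt {w : List ℕ} {a b : ℕ} (hab : a < b) (hb : b < w.length) :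
    [w.getD a 0, w.getD b 0].Sublist w := by
  have h : [a, b].Sublist (List.range w.length) := by
    rw [List.range_eq_range']
    exact sublist_range' (by simpa using hab) (by simp; omega)
  have := h.map fun k => w.getD k 0
  rwa [map_getD_range] at this

/-- If `π` ends with `↗` and the copies of `T_mid` cannot hold an initial part of `M_k` whose
complement is ordered, then `T_π` avoids `M_k`. -/
theorem classI_avoids_of_mid {π : List Diag} (hπ : lastDiag π = .up) {k : ℕ} (hk : 1 ≤ k)
    (hmid : ∀ i j, ∀ σ₁ σ₂ : List ℕ, ∀ g : ℕ → ℕ, mShape k = σ₁ ++ σ₂ →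
      Set.InjOn g {a | a ∈ mShape k} → (σ₁.map g).Sublist (classI π.dropLast i j).word →
      (∀ x ∈ mShape k, ∀ y ∈ mShape k, g x < g y → ¬ [y, x].Sublist σ₂) → False) :
    ∀ i j, ¬ Contained (mShape k) (classI π i j).word := by
  have key : ∀ π' i j, π' = π → ¬ Contained (mShape k) (classI π' i j).word := by
    -- For k ≥ 1 the symbol 1 occurs three times, which excludes M_k from the base cases.
    have h111 : [1, 1, 1].Sublist (mShape k) :=
      sublist_mShape (a := [1]) (b := [1]) (c := []) (e := [1]) (by simp) (by simp) (by simp)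
        (by simp; omega) (by simp) (by simp) (by simp) (by simp; omega)
    apply classI_induction
    · rintro π i - ⟨f, -, hf⟩
      have := (h111.map f).trans hf
      simp [classI_zero] at this
    · rintro π i j h hj - ⟨f, -, hf⟩
      rw [classI_base h hj] at hf
      exact not_triple_classIBase _ _ (f 1) ((h111.map f).trans hf)
    · rintro π' i j h hi h1 - h3 rfl hcon
      have h1 := h1 rfl
      have h3 := h3 rfl
      have hasm := assembly_classI π' i j
      have ho : LiveOrdered .up (classITop π' i j) := hπ ▸ liveOrdered_classI π' _ _
      have hm : ∀ k ∈ (classIMid π' i j).word, k < alphabetSize (classIMid π' i j).word :=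
        fun k => (hasm.mem_mid k).1
      rw [classI_succ h hi, canonical_eq, word_rename] at hcon
      rcases (hcon.of_map (injOn_firstRank _)).shuffle hasm.liveFirst_comp hasm.length_live_comp
        (fun x hx h1 => tied_mShape hx h1) with hcon | hcon
      · rcases hcon.comp hasm.top.liveFirst ho hm hasm.top.length_live (isChain_mShape k)
          separated_mShape with hcon | ⟨P, B, Q, σ₁, σ₂, g, hT, hl, hσ, hi, hg, hs1, hs2⟩
        · exact h3 hcon
        · refine hmid _ _ σ₁ σ₂ g hσ hi hs1 fun x hx y hy hxy hyx => ?_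
          have hB : B ∈ classITop π' i j := by rw [hT]; simp
          have hlen := hasm.top.length_live B hB hl
          -- With g x < g y, the block B shows x before y; a later y x would complete the forbidden
          -- abba.
          have hp := pair_sublist_of_lt hxy (hlen ▸ hg y hy)
          refine ho B hB hl _ _ hp ?_
          rw [hT, word_append, word_cons]
          exact (hp.append ((hyx.map _).trans hs2)).trans (List.sublist_append_right _ _)
      · exact h1 hcon
  exact fun i j => key π i j rfl

theorem lastDiag_up (x y : Diag) (k : ℕ) :
    lastDiag ([.up, x, y] ++ List.replicate (k + 1) .up) = .up := by
  rw [lastDiag, List.replicate_succ', ← List.append_assoc, List.getLastD_concat]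

theorem dropLast_up (x y : Diag) (k : ℕ) :
    ([Diag.up, x, y] ++ List.replicate (k + 1) Diag.up).dropLast =
      ([.up, x, y] ++ List.replicate k .up : List Diag) := by
  rw [List.replicate_succ', ← List.append_assoc, List.dropLast_concat]

/-- The base of the doubling. Each way of splitting 123212321 either leaves one of the two avoided
patterns in T_mid, if necessary after prepending first appearances, or makes σ₂ unsorted. -/
theorem false_of_mid_three {x y : Diag} (i j : ℕ) (σ₁ σ₂ : List ℕ) (g : ℕ → ℕ)
    (hσ : mShape 2 = σ₁ ++ σ₂) (hg : Set.InjOn g {a | a ∈ mShape 2})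
    (h1 : (σ₁.map g).Sublist (classI [.up, x, y] i j).word)
    (h2 : ∀ x ∈ mShape 2, ∀ y ∈ mShape 2, g x < g y → ¬ [y, x].Sublist σ₂) : False := by
  obtain ⟨hA, hB, -⟩ := classI_three [.up, x, y] i j rfl
  have hfa := (regular_classI [.up, x, y] i j).ordered
  set w := (classI [.up, x, y] i j).word
  have hM : mShape 2 = [1, 2, 3, 2, 1, 2, 3, 2, 1] := rfl
  rw [hM] at hσ
  have m1 : 1 ∈ mShape 2 := by decide
  have m2 : 2 ∈ mShape 2 := by decide
  have m3 : 3 ∈ mShape 2 := by decide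
  have hlt : ∀ a ∈ mShape 2, ∀ b ∈ mShape 2, a ≠ b → [b, a].Sublist σ₂ → g b < g a := by
    intro a ha b hb hab hs
    rcases lt_trichotomy (g a) (g b) with h4 | h4 | h4
    · exact absurd hs (h2 a ha b hb h4)
    · exact absurd (hg ha hb h4) hab
    · exact h4
  have hinj : ∀ φ : ℕ → ℕ, φ 1 ∈ mShape 2 → φ 2 ∈ mShape 2 → φ 3 ∈ mShape 2 → φ 1 ≠ φ 2 →
      φ 1 ≠ φ 3 → φ 2 ≠ φ 3 → ∀ s : List ℕ, (∀ a ∈ s, a = 1 ∨ a = 2 ∨ a = 3) →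
      Set.InjOn (fun a => g (φ a)) {a | a ∈ s} := by
    intro φ p1 p2 p3 h12 h13 h23 s hs a ha b hb hab
    rcases hs a ha with rfl | rfl | rfl <;> rcases hs b hb with rfl | rfl | rfl
    all_goals first
      | rfl
      | exact absurd (hg p1 p2 hab) h12
      | exact absurd (hg p1 p3 hab) h13
      | exact absurd (hg p2 p3 hab) h23
      | exact absurd (hg p2 p1 hab) h12.symm
      | exact absurd (hg p3 p1 hab) h13.symm
      | exact absurd (hg p3 p2 hab) h23.symm
  have hpatA : ∀ a ∈ patternA, a = 1 ∨ a = 2 ∨ a = 3 := by decide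
  have hpatB : ∀ a ∈ patternB, a = 1 ∨ a = 2 ∨ a = 3 := by decide
  have hlen : σ₂.length ≤ 1 ∨ σ₂.length = 2 ∨ σ₂.length = 3 ∨ 4 ≤ σ₂.length := by omega
  rcases hlen with hlen | hlen | hlen | hlen
  · have h3 : patternA.Sublist σ₁ :=
      prefix_of_append_eq (e := [1]) (hσ.symm.trans rfl) (by simpa using hlen)
    exact hA ⟨g, hinj id m1 m2 m3 (by decide) (by decide) (by decide) _ hpatA,
      (h3.map g).trans h1⟩
  · have h3 : [1, 2, 3, 2, 1, 2, 3].Sublist σ₁ :=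
      prefix_of_append_eq (e := [2, 1]) (hσ.symm.trans rfl) (by simp [hlen])
    have h4 : [2, 1].Sublist σ₂ :=
      suffix_of_append_eq (c := [1, 2, 3, 2, 1, 2, 3]) (hσ.symm.trans rfl) (by simp [hlen])
    -- The word 2·1232123 is 12131213 with 1 and 2 exchanged.
    have h5 := hfa.sublist (r := [g 2]) ((h3.map g).trans h1)
      (by simpa using hlt 1 m1 2 m2 (by decide) h4)
    exact hB ⟨fun a => g (if a = 1 then 2 else if a = 2 then 1 else 3),
      hinj (fun a => if a = 1 then 2 else if a = 2 then 1 else 3) m2 m1 m3 (by decide) (by decide)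
        (by decide) _ hpatB, h5⟩
  · have h3 : [1, 2, 3, 2, 1, 2].Sublist σ₁ :=
      prefix_of_append_eq (e := [3, 2, 1]) (hσ.symm.trans rfl) (by simp [hlen])
    have h4 : [3, 2, 1].Sublist σ₂ :=
      suffix_of_append_eq (c := [1, 2, 3, 2, 1, 2]) (hσ.symm.trans rfl) (by simp [hlen])
    have h21 := hlt 1 m1 2 m2 (by decide) (List.Sublist.trans (by simp) h4)
    have h32 := hlt 2 m2 3 m3 (by decide) (List.Sublist.trans (by simp) h4)
    -- The word 32·123212 is 12321232 with 1 and 3 exchanged.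
    have h5 := hfa.sublist (r := [g 3, g 2]) ((h3.map g).trans h1)
      (by simp [h21, h32, h32.trans h21])
    exact hA ⟨fun a => g (if a = 1 then 3 else if a = 2 then 2 else 1),
      hinj (fun a => if a = 1 then 3 else if a = 2 then 2 else 1) m3 m2 m1 (by decide) (by decide)
        (by decide) _ hpatA, h5⟩
  · have h4 : [2, 3, 2, 1].Sublist σ₂ :=
      suffix_of_append_eq (c := [1, 2, 3, 2, 1]) (hσ.symm.trans rfl) (by simpa using hlen)
    have h5 := hlt 2 m2 3 m3 (by decide) (List.Sublist.trans (by simp) h4)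
    have h6 := hlt 3 m3 2 m2 (by decide) (List.Sublist.trans (by simp) h4)
    omega

/-- For `π ∈ ↗{↗,↘}²↗ᵏ`, the Class I sequences `T_π(i, j)` avoid `M_{2ᵏ}`. -/
theorem classI_avoids (k : ℕ) (x y : Diag) : ∀ i j,
    ¬ Contained (mShape (2 ^ (k + 1)))
      (classI ([.up, x, y] ++ List.replicate (k + 1) .up) i j).word := by
  induction k with
  | zero =>
    refine classI_avoids_of_mid (lastDiag_up x y 0) (by norm_num) ?_
    rw [dropLast_up]
    exact fun i j σ₁ σ₂ g => false_of_mid_three i j σ₁ σ₂ g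
  | succ k ih =>
    refine classI_avoids_of_mid (lastDiag_up x y (k + 1)) Nat.one_le_two_pow ?_
    intro i j σ₁ σ₂ g hσ hg h1 h2
    rw [dropLast_up] at h1
    rw [pow_succ, mul_comm] at hσ hg h2
    exact ih i j (contained_half Nat.one_le_two_pow hσ hg (regular_classI _ i j).ordered h1 h2)

/-! ### Counting blocks and symbols -/

namespace BlockSeq

/-- The number of dead blocks. -/
def numDead {α : Type} (T : BlockSeq α) : ℕ := T.countP fun B => !B.live

section

variable {α β : Type}

@[simp] theorem numDead_nil : numDead ([] : BlockSeq α) = 0 := rfl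

@[simp] theorem numDead_append (S T : BlockSeq α) :
    numDead (S ++ T) = numDead S + numDead T := by simp [numDead]

theorem numDead_cons_live {B : Block α} (h : B.live = true) (T : BlockSeq α) :
    numDead (B :: T) = numDead T := by simp [numDead, h]

theorem numDead_cons_dead {B : Block α} (h : B.live = false) (T : BlockSeq α) :
    numDead (B :: T) = numDead T + 1 := by simp [numDead, h]

@[simp] theorem numDead_rename (f : α → β) (T : BlockSeq α) : (T.rename f).numDead = T.numDead := by
  simp [numDead, rename, List.countP_map, Function.comp_def]

theorem length_eq_numLive_add_numDead (T : BlockSeq α) : T.length = T.numLive + T.numDead := by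
  induction T with
  | nil => rfl
  | cons B T ih =>
    cases h : B.live with
    | true => rw [numLive_cons_live h, numDead_cons_live h, List.length_cons, ih]; omega
    | false => rw [numLive_cons_dead h, numDead_cons_dead h, List.length_cons, ih]; omega

end

end BlockSeq

section Count

variable {d : Diag}

theorem numDead_insertLive {α : Type} (as : List α) (T : BlockSeq α) :
    (insertLive d as T).numDead = T.numDead := by
  induction T generalizing as with
  | nil => simp
  | cons B T ih =>
    cases hB : B.live with
    | true =>
      cases as with
      | nil => simp
      | cons a as =>
        rw [insertLive_cons_live hB, numDead_cons_live (by simp), numDead_cons_live hB, ih]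
    | false => rw [insertLive_cons_dead hB, numDead_cons_dead hB, numDead_cons_dead hB, ih]

theorem length_word_insertLive {α : Type} {as : List α} {T : BlockSeq α}
    (h : as.length ≤ T.numLive) :
    (insertLive d as T).word.length = as.length + T.word.length := by
  induction T generalizing as with
  | nil =>
    have : as = [] := by simpa using h
    simp [this]
  | cons B T ih =>
    cases hB : B.live with
    | true =>
      cases as with
      | nil => simp
      | cons a as =>
        rw [numLive_cons_live hB, List.length_cons] at h
        rw [insertLive_cons_live hB, word_cons, List.length_append, insertBlock_length,
          ih (by omega), word_cons, List.length_append, List.length_cons]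
        ring
    | false =>
      rw [numLive_cons_dead hB] at h
      rw [insertLive_cons_dead hB, word_cons, List.length_append, ih h, word_cons,
        List.length_append]
      ring

theorem numDead_comp (top mid : BlockSeq ℕ) :
    (top.comp mid).numDead = top.numDead + top.numLive * mid.numDead := by
  induction top with
  | nil => simp
  | cons B top ih =>
    rw [comp_cons, numDead_append, ih]
    cases h : B.live with
    | true =>
      rw [compPiece_live h, numDead_rename, numLive_cons_live h, numDead_cons_live h]; ring
    | false =>
      rw [compPiece_dead h, numDead_cons_dead h, numLive_cons_dead h, numDead_cons_dead h]
      simp; ring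

theorem numDead_shuffle (sub bot : BlockSeq ℕ) :
    (shuffle d sub bot).numDead = sub.numDead + sub.numLive * bot.numDead := by
  rw [shuffle_eq]
  generalize 0 = n
  induction sub generalizing n with
  | nil => simp
  | cons B sub ih =>
    rw [shuffleFrom_cons, numDead_append, ih]
    cases h : B.live with
    | true =>
      rw [shufflePiece_live h, numDead_insertLive, numDead_rename, numLive_cons_live h,
        numDead_cons_live h]
      ring
    | false =>
      rw [shufflePiece_dead h, numDead_cons_dead rfl, numLive_cons_dead h, numDead_cons_dead h]
      simp; ring

/-- Each live block of length n makes way for a copy of `mid`; the removed letters stand on the left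
to avoid subtraction. -/
theorem length_word_comp {top mid : BlockSeq ℕ} {n : ℕ}
    (hlen : ∀ B ∈ top, B.live = true → B.word.length = n) :
    (top.comp mid).word.length + top.numLive * n =
      top.word.length + top.numLive * mid.word.length := by
  induction top with
  | nil => simp
  | cons B top ih =>
    have ih := ih fun B hB => hlen B (by simp [hB])
    rw [comp_cons, word_append, List.length_append, word_cons, List.length_append]
    cases h : B.live with
    | true =>
      rw [compPiece_live h, word_rename, List.length_map, numLive_cons_live h,
        hlen B (by simp) h]
      linarith
    | false =>
      rw [compPiece_dead h, numLive_cons_dead h, word_cons, word_nil, List.append_nil]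
      linarith

theorem length_word_shuffle {sub bot : BlockSeq ℕ}
    (hlen : ∀ B ∈ sub, B.live = true → B.word.length = bot.numLive) :
    (shuffle d sub bot).word.length = sub.word.length + sub.numLive * bot.word.length := by
  rw [shuffle_eq]
  generalize 0 = n
  induction sub generalizing n with
  | nil => simp
  | cons B sub ih =>
    rw [shuffleFrom_cons, word_append, List.length_append, ih fun B hB => hlen B (by simp [hB]),
      word_cons, List.length_append]
    cases h : B.live with
    | true =>
      rw [shufflePiece_live h, length_word_insertLive (by simp [hlen B (by simp) h]),
        numLive_cons_live h, word_rename, List.length_map, List.length_map]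
      ring
    | false =>
      rw [shufflePiece_dead h, numLive_cons_dead h]
      simp; ring

/-- The live blocks partition the alphabet. -/
theorem LiveFirst.alphabetSize_eq {T : BlockSeq ℕ} (h : LiveFirst T) {j : ℕ}
    (hlen : ∀ B ∈ T, B.live = true → B.word.length = j) :
    alphabetSize T.word = j * T.numLive := by
  have h1 : T.word.toFinset = (word (T.filter Block.live)).toFinset := by
    ext a
    simp only [List.mem_toFinset]
    constructor
    · intro ha
      obtain ⟨B, hB, hl, haB⟩ := h.exists_live a ha
      exact mem_word.2 ⟨B, List.mem_filter.2 ⟨hB, hl⟩, haB⟩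
    · intro ha
      obtain ⟨B, hB, haB⟩ := mem_word.1 ha
      exact mem_word.2 ⟨B, (List.mem_filter.1 hB).1, haB⟩
  have h2 : (word (T.filter Block.live)).Nodup := by
    unfold word
    rw [List.nodup_flatMap]
    refine ⟨fun B hB => h.nodup B (List.mem_filter.1 hB).1, ?_⟩
    refine (h.pairwise.filter _).imp_of_mem fun {B C} hB hC hBC => ?_
    exact hBC (List.mem_filter.1 hC).2
  rw [alphabetSize, h1, List.toFinset_card_of_nodup h2]
  clear h1 h2 h
  induction T with
  | nil => simp
  | cons B T ih =>
    have ih := ih fun B hB => hlen B (by simp [hB])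
    cases hl : B.live with
    | true =>
      rw [List.filter_cons_of_pos hl, word_cons, List.length_append, ih, numLive_cons_live hl,
        hlen B (by simp) hl]
      ring
    | false => rw [List.filter_cons_of_neg (by simp [hl]), ih, numLive_cons_dead hl]

theorem Regular.alphabetSize_eq {j : ℕ} {T : BlockSeq ℕ} (h : Regular j T) :
    alphabetSize T.word = j * T.numLive := h.liveFirst.alphabetSize_eq h.length_live

end Count

/-! ### Multiplicities and block counts of the Class I sequences -/

section ClassI

variable {π : List Diag} {i : ℕ}

theorem numLive_classI_succ (h : 2 < π.length) (hi : 1 < i) (j : ℕ) :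
    (classI π i (j + 1)).numLive =
      (classITop π i j).numLive * (classIMid π i j).numLive * (classI π i j).numLive := by
  rw [classI_succ h hi, canonical_eq, numLive_rename, numLive_shuffle, numLive_comp]

theorem numDead_classI_succ (h : 2 < π.length) (hi : 1 < i) (j : ℕ) :
    (classI π i (j + 1)).numDead = (classITop π i j).numDead +
      (classITop π i j).numLive * (classIMid π i j).numDead +
      (classITop π i j).numLive * (classIMid π i j).numLive * (classI π i j).numDead := by
  rw [classI_succ h hi, canonical_eq, numDead_rename, numDead_shuffle, numDead_comp, numLive_comp]

theorem numLive_classI_zero (π : List Diag) (i : ℕ) : (classI π i 0).numLive = 2 := by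
  rw [classI_zero]; rfl

theorem numDead_classI_zero (π : List Diag) (i : ℕ) : (classI π i 0).numDead = 0 := by
  rw [classI_zero]; rfl

theorem numLive_classI_base {j : ℕ} (h : π.length ≤ 2 ∨ i ≤ 1) (hj : j ≠ 0) :
    (classI π i j).numLive = 1 := by
  rw [classI_base h hj]; rfl

theorem numDead_classI_base {j : ℕ} (h : π.length ≤ 2 ∨ i ≤ 1) (hj : j ≠ 0) :
    (classI π i j).numDead = 1 := by
  rw [classI_base h hj]; rfl

theorem alphabetSize_classIMid (j : ℕ) : alphabetSize (classIMid π i j).word =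
    (classI π i j).numLive * (classIMid π i j).numLive :=
  (regular_classI _ _ _).alphabetSize_eq

/-- Every symbol of `T_π(i, j)` occurs `1 + (i + |π| - 3 choose |π| - 2)` times. -/
theorem length_word_classI : ∀ π i j, 1 ≤ i → (classI π i j).word.length =
    ((i - 1 + (π.length - 2)).choose (π.length - 2) + 1) * (j * (classI π i j).numLive) := by
  apply classI_induction
  · intro π i _
    rw [classI_zero]; simp
  · intro π i j h hj hi
    rw [numLive_classI_base h hj, classI_base h hj, classIBase_word]
    have : (i - 1 + (π.length - 2)).choose (π.length - 2) = 1 := by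
      rcases h with h | h
      · rw [Nat.sub_eq_zero_of_le h]; simp
      · rw [Nat.sub_eq_zero_of_le h]; simp
    rw [this]
    cases lastDiag π <;> simp <;> ring
  · intro π i j h hi h1 h2 h3 _
    have h1 := h1 (by omega)
    have h2 : (classIMid π i j).word.length = _ := h2 (by omega)
    have h3 : (classITop π i j).word.length = _ := h3 (by omega)
    have hasm := assembly_classI π i j
    have hM := alphabetSize_classIMid (π := π) (i := i) j
    have hcomp := length_word_comp (mid := classIMid π i j) hasm.top.length_live
    have hsh := length_word_shuffle (d := lastDiag π) hasm.length_live_comp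
    rw [numLive_classI_succ h hi, classI_succ h hi, canonical_eq, word_rename, List.length_map, hsh,
      numLive_comp, h1]
    have hmid : (classI π.dropLast i (classI π i j).numLive).numLive = (classIMid π i j).numLive :=
      rfl
    have htop : (classI π (i - 1) (alphabetSize (classIMid π i j).word)).numLive =
      (classITop π i j).numLive := rfl
    rw [hmid] at h2
    rw [htop] at h3
    rw [h2, h3, hM] at hcomp
    obtain ⟨r, hr⟩ : ∃ r, π.length = r + 3 := ⟨π.length - 3, by omega⟩
    obtain ⟨m, rfl⟩ : ∃ m, i = m + 2 := ⟨i - 2, by omega⟩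
    have e1 : π.dropLast.length - 2 = r := by rw [List.length_dropLast, hr]; omega
    rw [e1, hr] at hcomp
    rw [hr]
    have e2 : r + 3 - 2 = r + 1 := by omega
    have e3 : m + 2 - 1 - 1 = m := by omega
    have e4 : m + 2 - 1 = m + 1 := by omega
    rw [e2, e3, e4] at hcomp
    rw [e2, e4]
    -- A symbol of the composition occurs as often as in T_mid plus T_top, less its replaced live
    -- occurrence. This is Pascal's rule for the multiplicity minus one.
    have e5 : (m + 1 + (r + 1)).choose (r + 1) =
        (m + 1 + r).choose r + (m + (r + 1)).choose (r + 1) := by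
      rw [show m + 1 + (r + 1) = (m + 1 + r) + 1 by ring, Nat.choose_succ_succ,
        show m + (r + 1) = m + 1 + r by ring]
    rw [e5]
    generalize (m + 1 + r).choose r = A at *
    generalize (m + (r + 1)).choose (r + 1) = B at *
    generalize (classI π (m + 2) j).numLive = l at *
    generalize (classIMid π (m + 2) j).numLive = Lm at *
    generalize (classITop π (m + 2) j).numLive = Lt at *
    have : (BlockSeq.comp (classITop π (m + 2) j) (classIMid π (m + 2) j)).word.length =
        (A + B + 1) * (Lt * (l * Lm)) := by
      linarith
    rw [this]
    ring

theorem two_le_numLive_classI (h : 2 < π.length) (hi : 1 < i) (j : ℕ) :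
    2 ≤ (classI π i j).numLive := by
  induction j with
  | zero => rw [numLive_classI_zero]
  | succ j ih =>
    rw [numLive_classI_succ h hi]
    have h1 := (assembly_classI π i j).top.numLive_pos
    have h2 := (assembly_classI π i j).mid.numLive_pos
    exact ih.trans (Nat.le_mul_of_pos_left _ (Nat.mul_pos h1 h2))

/-- For |π| = 3 each copy of T_mid adds one dead block. The slack of 4 makes the induction close by
absorbing the extra dead blocks and the `+ 2` in the bound for T_top. -/
theorem numDead_classI_three : ∀ π i j, π.length = 3 → 1 < i →
    (classI π i j).numDead + 4 ≤ (j + 2) * (classI π i j).numLive := by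
  apply classI_induction
  · intro π i _ _
    rw [numDead_classI_zero, numLive_classI_zero]
  · intro π i j h hj hp hi
    omega
  · intro π i j h hi h1 _ h3 hp _
    have h1 := h1 hp hi
    have hl := two_le_numLive_classI h hi j
    have hLm : (classIMid π i j).numLive = 1 :=
      numLive_classI_base (by simp [hp]) (by omega)
    have hDm : (classIMid π i j).numDead = 1 :=
      numDead_classI_base (by simp [hp]) (by omega)
    have hM := alphabetSize_classIMid (π := π) (i := i) j
    rw [numLive_classI_succ h hi, numDead_classI_succ h hi, hLm, hDm]
    rw [hLm, mul_one] at hM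
    by_cases hi2 : i = 2
    · have hLt : (classITop π i j).numLive = 1 := numLive_classI_base (by omega) (by omega)
      have hDt : (classITop π i j).numDead = 1 := numDead_classI_base (by omega) (by omega)
      rw [hLt, hDt]
      nlinarith
    · have h3 : (classITop π i j).numDead + 4 ≤
          (alphabetSize (classIMid π i j).word + 2) * (classITop π i j).numLive :=
        h3 hp (by omega)
      rw [hM] at h3
      have h4 := Nat.mul_le_mul_left (classITop π i j).numLive h1
      nlinarith

/-- The number of dead blocks is smaller than the length by a factor of order `i`. -/
theorem numDead_classI_le : ∀ π i j, 3 ≤ π.length → 1 ≤ i →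
    (classI π i j).numDead ≤ 3 * i ^ (π.length - 3) * (j * (classI π i j).numLive) := by
  apply classI_induction
  · intro π i _ _
    rw [numDead_classI_zero]; simp
  · intro π i j h hj hp hi
    rw [numDead_classI_base h hj, numLive_classI_base h hj]
    have : 0 < 3 * i ^ (π.length - 3) * (j * 1) := by positivity
    exact this
  · intro π i j h hi h1 h2 h3 hp hi1
    by_cases hp3 : π.length = 3
    · have h4 := numDead_classI_three π i (j + 1) hp3 hi
      rw [hp3]
      simp only [Nat.sub_self, pow_zero, mul_one]
      nlinarith [h4]
    have h1 := h1 hp hi1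
    have h2 : (classIMid π i j).numDead ≤ _ := h2 (by simp; omega) hi1
    have h3 : (classITop π i j).numDead ≤ _ := h3 hp (by omega)
    have hmid : (classI π.dropLast i (classI π i j).numLive).numLive = (classIMid π i j).numLive :=
      rfl
    have htop : (classI π (i - 1) (alphabetSize (classIMid π i j).word)).numLive =
      (classITop π i j).numLive := rfl
    rw [hmid] at h2
    rw [htop, alphabetSize_classIMid] at h3
    rw [numLive_classI_succ h hi, numDead_classI_succ h hi]
    obtain ⟨r, hr⟩ : ∃ r, π.length = r + 4 := ⟨π.length - 4, by omega⟩
    obtain ⟨m, rfl⟩ : ∃ m, i = m + 1 := ⟨i - 1, by omega⟩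
    rw [List.length_dropLast, hr, show r + 4 - 1 - 3 = r by omega] at h2
    rw [hr, show r + 4 - 3 = r + 1 by omega] at h1 h3
    rw [hr, show r + 4 - 3 = r + 1 by omega]
    rw [Nat.add_sub_cancel] at h3
    -- The dead blocks of T_top, with i one smaller, and of the copies of T_mid, with π one letter
    -- shorter, share the budget for i = m+1.
    have hpow : m ^ (r + 1) + (m + 1) ^ r ≤ (m + 1) ^ (r + 1) := by
      have := Nat.pow_le_pow_left (Nat.le_succ m) r
      rw [pow_succ, pow_succ]
      nlinarith
    generalize (classI π (m + 1) j).numLive = l at *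
    generalize (classIMid π (m + 1) j).numLive = Lm at *
    generalize (classITop π (m + 1) j).numLive = Lt at *
    calc _ ≤ 3 * m ^ (r + 1) * (l * Lm * Lt) + Lt * (3 * (m + 1) ^ r * (l * Lm)) +
          Lt * Lm * (3 * (m + 1) ^ (r + 1) * (j * l)) := by gcongr
      _ = 3 * (m ^ (r + 1) + (m + 1) ^ r) * (l * Lm * Lt) +
          3 * (m + 1) ^ (r + 1) * (j * (Lt * Lm * l)) := by ring
      _ ≤ 3 * (m + 1) ^ (r + 1) * (l * Lm * Lt) +
          3 * (m + 1) ^ (r + 1) * (j * (Lt * Lm * l)) := by gcongr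
      _ = _ := by ring

end ClassI

/-! ### Ackermann's function -/

theorem ackermann_step (e j : ℕ) : ackermann (e + 2) (j + 2) =
    ackermann (e + 2) (j + 1) * ackermann (e + 1) (ackermann (e + 2) (j + 1)) := by
  rw [ackermann]

theorem two_pow_le_ackermann (e j : ℕ) : 2 ^ (j + 1) ≤ ackermann (e + 1) (j + 1) := by
  induction e generalizing j with
  | zero => rw [ackermann]
  | succ e ihe =>
    induction j with
    | zero => rw [ackermann]; norm_num
    | succ j ihj =>
      rw [ackermann_step, pow_succ]
      refine Nat.mul_le_mul ihj ?_
      have h1 : 0 < ackermann (e + 2) (j + 1) := lt_of_lt_of_le (by positivity) ihj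
      obtain ⟨w, hw⟩ : ∃ w, ackermann (e + 2) (j + 1) = w + 1 := ⟨_, (Nat.succ_pred_eq_of_pos h1).symm⟩
      rw [hw]
      refine le_trans ?_ (ihe w)
      rw [pow_succ]
      have := Nat.one_le_two_pow (n := w)
      omega

theorem lt_ackermann (e j : ℕ) : j + 1 < ackermann (e + 1) (j + 1) :=
  lt_of_lt_of_le Nat.lt_two_pow_self (two_pow_le_ackermann e j)

theorem ackermann_mono {e a b : ℕ} (ha : 1 ≤ a) (hab : a ≤ b) :
    ackermann (e + 1) a ≤ ackermann (e + 1) b := by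
  induction b, hab using Nat.le_induction with
  | base => exact le_rfl
  | succ b hb ih =>
    refine ih.trans ?_
    obtain ⟨c, rfl⟩ : ∃ c, b = c + 1 := ⟨b - 1, by omega⟩
    cases e with
    | zero => rw [ackermann, ackermann]; exact Nat.pow_le_pow_right (by norm_num) (by omega)
    | succ e =>
      rw [ackermann_step]
      refine Nat.le_mul_of_pos_right _ ?_
      have h1 := lt_ackermann (e + 1) c
      obtain ⟨w, hw⟩ : ∃ w, ackermann (e + 2) (c + 1) = w + 1 :=
        ⟨_, (Nat.succ_pred_eq_of_pos (Nat.zero_lt_of_lt h1)).symm⟩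
      rw [hw]
      exact lt_of_le_of_lt (Nat.zero_le _) (lt_ackermann e w)

/-- The right side is w · a_{e+1,w} with w = a_{e+2,2} ≥ 8. One more row thus lowers the argument to
3, the value used in α(n). -/
theorem ackermann_six_le (e : ℕ) : ackermann (e + 1) 6 ≤ ackermann (e + 2) 3 := by
  have h8 : 8 ≤ ackermann (e + 2) 2 := by
    rw [show (2 : ℕ) = 0 + 2 from rfl, ackermann_step]
    have : ackermann (e + 2) (0 + 1) = 2 := by rw [ackermann]
    rw [this]
    have := two_pow_le_ackermann e 1
    norm_num at this
    omega
  rw [show (3 : ℕ) = 1 + 2 from rfl, ackermann_step]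
  refine (ackermann_mono (by norm_num) (show 6 ≤ ackermann (e + 2) 2 by omega)).trans ?_
  exact Nat.le_mul_of_pos_left _ (by show 0 < ackermann (e + 2) 2; omega)

/-- One step of the recursion for the number of live blocks. -/
theorem ackermann_absorb {e x l Lm Lt : ℕ} (hx : 2 ≤ x) (hl : l ≤ ackermann (e + 2) (x + 1))
    (hm : Lm ≤ ackermann (e + 1) (3 * l + 3))
    (ht : Lt ≤ ackermann (e + 1) (3 * (l * Lm) + 3)) :
    Lt * Lm * l ≤ ackermann (e + 2) (x + 4) := by
  have hw8 : 8 ≤ ackermann (e + 2) (x + 1) := by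
    refine le_trans ?_ (two_pow_le_ackermann (e + 1) x)
    exact (Nat.pow_le_pow_right (by norm_num) (show 3 ≤ x + 1 by omega) : 2 ^ 3 ≤ 2 ^ (x + 1))
  have h1 := ackermann_step e x
  have h2 := ackermann_step e (x + 1)
  have h3 := ackermann_step e (x + 2)
  rw [h3]
  simp only [show x + 2 + 1 = x + 3 from rfl, show x + 1 + 1 = x + 2 from rfl] at h1 h2 h3 ⊢
  generalize ackermann (e + 2) (x + 1) = w at *
  generalize hw1 : ackermann (e + 2) (x + 2) = w₁ at *
  generalize hw2 : ackermann (e + 2) (x + 3) = w₂ at *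
  have hF : ∀ y, 1 ≤ y → y < ackermann (e + 1) y := by
    intro y hy
    obtain ⟨z, rfl⟩ : ∃ z, y = z + 1 := ⟨y - 1, by omega⟩
    exact lt_ackermann e z
  have hFw := hF w (by omega)
  -- As l ≤ w and w ≥ 8, the argument 3l+3 for T_mid is at most 4w, hence at most w₁.
  have hw1' : 4 * w ≤ w₁ := by rw [h1]; nlinarith
  have hm' : Lm ≤ ackermann (e + 1) w₁ :=
    hm.trans (ackermann_mono (by omega) (by omega))
  have hFw1 := hF w₁ (by omega)
  generalize ackermann (e + 1) w₁ = F₁ at *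
  have hM : l * Lm ≤ w * F₁ := Nat.mul_le_mul hl hm'
  -- The second Ackermann step covers the argument for T_top, and the third multiplies by its number
  -- of live blocks.
  have hw2' : 3 * (l * Lm) + 3 ≤ w₂ := by
    rw [h2]
    nlinarith
  have ht' : Lt ≤ ackermann (e + 1) w₂ := ht.trans (ackermann_mono (by omega) hw2')
  calc Lt * Lm * l = (l * Lm) * Lt := by ring
    _ ≤ w₂ * ackermann (e + 1) w₂ := Nat.mul_le_mul (by omega) ht'

/-- T_mid and T_top both lie one Ackermann row lower, since |π| or i drops by one. A step in j costs
three steps along the row, hence the argument 3j+3. -/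
theorem numLive_classI_le : ∀ π i j, 1 ≤ i →
    (classI π i j).numLive ≤ ackermann (i + π.length) (3 * j + 3) := by
  have hpos : ∀ e j, 1 ≤ e → 2 ≤ ackermann e (j + 1) := by
    intro e j he
    obtain ⟨e, rfl⟩ : ∃ e', e = e' + 1 := ⟨e - 1, by omega⟩
    have := lt_ackermann e j
    omega
  apply classI_induction
  · intro π i hi
    rw [numLive_classI_zero]
    exact hpos _ _ (by omega)
  · intro π i j h hj hi
    rw [numLive_classI_base h hj]
    exact le_trans (by norm_num) (hpos _ (3 * j + 2) (by omega))
  · intro π i j h hi h1 h2 h3 _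
    have h1 := h1 (by omega)
    have h2 : (classIMid π i j).numLive ≤ _ := h2 (by omega)
    have h3 : (classITop π i j).numLive ≤ _ := h3 (by omega)
    rw [alphabetSize_classIMid] at h3
    rw [numLive_classI_succ h hi]
    obtain ⟨e, he⟩ : ∃ e, i + π.length = e + 2 := ⟨i + π.length - 2, by omega⟩
    rw [List.length_dropLast, show i + (π.length - 1) = e + 1 by omega] at h2
    rw [show i - 1 + π.length = e + 1 by omega] at h3
    rw [he] at h1 ⊢
    exact ackermann_absorb (x := 3 * j + 2) (by omega) h1 h2 h3

/-! ### Lower bounds for the extremal function -/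

section Extremal

variable {α : Type}

/-- Only the last r−1 letters of u can be at distance less than r from a letter of v. -/
theorem Sparse.append {r : ℕ} {u v : List α} (hu : Sparse r u) (hv : Sparse r v)
    (h : ∀ a ∈ v, a ∉ u.drop (u.length - (r - 1))) : Sparse r (u ++ v) := by
  intro i j hi hj hij he
  rw [List.length_append] at hi hj
  by_cases hju : j < u.length
  · rw [List.getElem_append_left (by omega), List.getElem_append_left hju] at he
    exact hu i j _ hju hij he
  · rw [List.getElem_append_right (as := u) (i := j) (by omega)] at he
    by_cases hiu : i < u.length
    · rw [List.getElem_append_left hiu] at he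
      by_contra hr
      refine h _ (List.getElem_mem (l := v) (n := j - u.length) (by omega)) ?_
      rw [← he, List.mem_drop_iff_getElem]
      exact ⟨i - (u.length - (r - 1)), by omega, by congr 1; omega⟩
    · rw [List.getElem_append_right (by omega)] at he
      have := hv (i - u.length) (j - u.length) (by omega) (by omega) (by omega) he
      omega

theorem Sparse.of_nodup (r : ℕ) {w : List α} (h : w.Nodup) : Sparse r w := fun i j hi hj hij he =>
  absurd ((List.Nodup.getElem_inj_iff h).1 he) (by omega)

theorem Sparse.map {β : Type} {r : ℕ} {w : List α} (h : Sparse r w) {f : α → β}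
    (hf : Function.Injective f) : Sparse r (w.map f) := by
  intro i j hi hj hij he
  rw [List.getElem_map, List.getElem_map] at he
  exact h i j (by simpa using hi) (by simpa using hj) hij (hf he)

theorem Sparse.nodup_of_infix {r : ℕ} {w B : List α} (h : Sparse r w) (hB : B <:+: w)
    (hr : B.length ≤ r) : B.Nodup := by
  obtain ⟨u, v, rfl⟩ := hB
  rw [List.nodup_iff_pairwise_ne, List.pairwise_iff_getElem]
  intro i j hi hj hij he
  have := h (u.length + i) (u.length + j) (by simp; omega) (by simp; omega) (by omega) (by
    simpa [List.getElem_append, hi, hj] using he)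
  omega

/-- A concatenation of blocks without repetitions becomes sparse after few deletions per block. -/
theorem exists_sparse_sublist [DecidableEq α] (r : ℕ) (L : List (List α))
    (hL : ∀ B ∈ L, B.Nodup) : ∃ s : List α, s.Sublist L.flatten ∧ Sparse r s ∧
      L.flatten.length ≤ s.length + (r - 1) * L.length := by
  induction L using List.reverseRecOn with
  | nil => exact ⟨[], by simp, Sparse.of_nodup r (by simp), by simp⟩
  | append_singleton L B ih =>
    obtain ⟨s, hs, hr, hl⟩ := ih fun C hC => hL C (by simp [hC])
    set e := s.drop (s.length - (r - 1))
    have hB : B.Nodup := hL B (by simp)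
    refine ⟨s ++ B.filter (· ∉ e), ?_, ?_, ?_⟩
    · rw [List.flatten_append, List.flatten_singleton]
      exact hs.append List.filter_sublist
    · refine hr.append (Sparse.of_nodup r (hB.filter _)) fun a ha => ?_
      simpa using (List.mem_filter.1 ha).2
    · have h1 : (B.filter (· ∈ e)).length ≤ e.length :=
        (List.subperm_of_subset (hB.filter _) fun a ha => by
          simpa using (List.mem_filter.1 ha).2).length_le
      have h2 := List.length_eq_length_filter_add (l := B) (· ∈ e)
      have h3 : B.filter (fun x => !decide (x ∈ e)) = B.filter (· ∉ e) := by
        congr 1; funext x; simp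
      rw [h3] at h2
      have h4 : e.length ≤ r - 1 := by simp only [e, List.length_drop]; omega
      simp only [List.flatten_append, List.flatten_singleton, List.length_append,
        List.length_singleton, Nat.mul_add, mul_one]
      omega

theorem alphabetSize_append_of_disjoint {u v : List ℕ} (h : ∀ a ∈ v, a ∉ u) :
    alphabetSize (u ++ v) = alphabetSize u + alphabetSize v := by
  rw [alphabetSize, List.toFinset_append, Finset.card_union_of_disjoint]
  · rfl
  · rw [Finset.disjoint_left]
    intro a ha hb
    exact h a (by simpa using hb) (by simpa using ha)

/-- A pattern that begins and ends with the same symbol does not straddle two words without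
common symbols. -/
theorem Contained.of_append {σ : List ℕ} {c : ℕ} {τ : List ℕ} (hσ : σ = c :: (τ ++ [c]))
    {u v : List α} (h : ∀ a ∈ v, a ∉ u) (hc : Contained σ (u ++ v)) :
    Contained σ u ∨ Contained σ v := by
  obtain ⟨f, hf, hs⟩ := hc
  obtain ⟨s₁, s₂, he, h1, h2⟩ := List.sublist_append_iff.1 hs
  rcases s₁ with _ | ⟨a, s₁⟩
  · exact Or.inr ⟨f, hf, by rw [he]; exact h2⟩
  rcases List.eq_nil_or_concat s₂ with rfl | ⟨s₂, b, rfl⟩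
  · exact Or.inl ⟨f, hf, by rw [he, List.append_nil]; exact h1⟩
  exfalso
  have ha : a = f c := by
    rw [hσ] at he
    simp only [List.map_cons, List.cons_append, List.cons.injEq] at he
    exact he.1.symm
  have hb : b = f c := by
    have h' : List.map f (c :: τ) ++ [f c] = (a :: s₁ ++ s₂) ++ [b] := by simpa [hσ] using he
    simpa using (List.append_inj_right' h' rfl).symm
  refine h b (h2.subset (by simp)) (h1.subset ?_)
  rw [hb, ← ha]; simp

theorem not_contained_of_nodup {σ : List ℕ} {c : ℕ} {τ : List ℕ} (hσ : σ = c :: (τ ++ [c]))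
    {w : List α} (hw : w.Nodup) : ¬ Contained σ w := by
  rintro ⟨f, -, hs⟩
  have := hw.sublist hs
  rw [hσ] at this
  simp at this

/-- A word over letters common to all members of a list of words is obtained by picking one letter
from each. -/
theorem sublist_flatten_of_forall_mem {w : List α} {L : List (List α)}
    (hl : w.length ≤ L.length) (h : ∀ a ∈ w, ∀ B ∈ L, a ∈ B) : w.Sublist L.flatten := by
  induction w generalizing L with
  | nil => simp
  | cons a w ih =>
    rcases L with _ | ⟨B, L⟩
    · simp at hl
    · rw [List.flatten_cons, ← List.singleton_append]
      refine List.Sublist.append (List.singleton_sublist.2 (h a (by simp) B (by simp))) ?_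
      exact ih (by simpa using hl) fun b hb C hC => h b (by simp [hb]) C (by simp [hC])

theorem exists_chunks (r m : ℕ) (S : List α) (h : m * r ≤ S.length) : ∃ L : List (List α),
    L.length = m ∧ L.flatten.Sublist S ∧ ∀ B ∈ L, B <:+: S ∧ B.length = r := by
  induction m generalizing S with
  | zero => exact ⟨[], by simp⟩
  | succ m ih =>
    rw [Nat.succ_mul] at h
    obtain ⟨L, h1, h2, h3⟩ := ih (S.drop r) (by rw [List.length_drop]; omega)
    refine ⟨S.take r :: L, by simp [h1], ?_, ?_⟩
    · rw [List.flatten_cons]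
      conv_rhs => rw [← List.take_append_drop r S]
      exact (List.Sublist.refl _).append h2
    · intro B hB
      rcases List.mem_cons.1 hB with rfl | hB
      · exact ⟨(List.take_prefix r S).isInfix, by rw [List.length_take]; omega⟩
      · exact ⟨(h3 B hB).1.trans (List.drop_suffix r S).isInfix, (h3 B hB).2⟩

/-- A long sparse word over a small alphabet contains every pattern. -/
theorem contained_of_sparse {σ S : List ℕ} (hS : Sparse (alphabetSize σ) S)
    (hl : ((alphabetSize S).choose (alphabetSize σ) * σ.length + 1) * alphabetSize σ ≤ S.length) :
    Contained σ S := by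
  set r := alphabetSize σ with hr
  obtain ⟨L, h1, h2, h3⟩ := exists_chunks r _ S hl
  have hcard : ∀ B ∈ L, B.toFinset.card = r := fun B hB => by
    rw [List.toFinset_card_of_nodup (hS.nodup_of_infix (h3 B hB).1 (h3 B hB).2.le), (h3 B hB).2]
  have hsub : (L.map List.toFinset).toFinset ⊆ S.toFinset.powersetCard r := by
    intro C hC
    obtain ⟨B, hB, rfl⟩ := List.mem_map.1 (List.mem_toFinset.1 hC)
    rw [Finset.mem_powersetCard]
    refine ⟨fun a ha => ?_, hcard B hB⟩
    rw [List.mem_toFinset] at ha ⊢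
    exact (h3 B hB).1.subset ha
  -- Each chunk of length r is an r-element set of symbols. By the pigeonhole principle one set
  -- occurs more than |σ| times, and each of its occurrences can supply one letter of σ.
  obtain ⟨C, hC⟩ : ∃ C, σ.length < (L.map List.toFinset).count C := by
    by_contra! hcon
    have h4 := List.sum_toFinset_count_eq_length (L.map List.toFinset)
    have h5 : ∑ C ∈ (L.map List.toFinset).toFinset, (L.map List.toFinset).count C ≤
        (L.map List.toFinset).toFinset.card * σ.length :=
      Finset.sum_le_card_nsmul _ _ _ fun C _ => hcon C
    have h6 := Finset.card_le_card hsub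
    rw [Finset.card_powersetCard] at h6
    have h7 := Nat.mul_le_mul_right σ.length h6
    rw [List.length_map, h1] at h4
    change _ ≤ (alphabetSize S).choose r * σ.length at h7
    omega
  obtain ⟨L', hL', hrep⟩ := List.sublist_map_iff.1 (List.replicate_sublist_iff.2 hC.le)
  have hmem : ∀ B ∈ L', B.toFinset = C := fun B hB =>
    List.eq_of_mem_replicate (hrep ▸ List.mem_map_of_mem hB)
  have hlen : L'.length = σ.length := by
    have := congrArg List.length hrep
    simpa using this.symm
  have hCr : σ ≠ [] → σ.toFinset.card = C.card := by
    intro hne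
    rcases L' with _ | ⟨B, L'⟩
    · exact absurd (List.length_eq_zero_iff.1 hlen.symm) hne
    · rw [← hmem B (by simp), hcard B (hL'.subset (by simp))]; rfl
  by_cases hne : σ = []
  · subst hne
    exact ⟨id, by simp, by simp⟩
  let e := Finset.equivOfCardEq (hCr hne)
  have hemem : ∀ a (ha : a ∈ σ.toFinset), (e ⟨a, ha⟩ : ℕ) ∈ C := fun a ha => (e ⟨a, ha⟩).2
  refine ⟨fun a => if h : a ∈ σ.toFinset then (e ⟨a, h⟩ : ℕ) else 0, ?_, ?_⟩
  · intro a ha b hb hab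
    have ha' : a ∈ σ.toFinset := List.mem_toFinset.2 ha
    have hb' : b ∈ σ.toFinset := List.mem_toFinset.2 hb
    simp only [dif_pos ha', dif_pos hb'] at hab
    exact congrArg Subtype.val (e.injective (Subtype.ext hab))
  · refine (sublist_flatten_of_forall_mem (by simp [hlen]) ?_).trans (hL'.flatten.trans h2)
    intro b hb B hB
    obtain ⟨a, ha, rfl⟩ := List.mem_map.1 hb
    have ha' : a ∈ σ.toFinset := List.mem_toFinset.2 ha
    rw [dif_pos ha', ← List.mem_toFinset, hmem B hB]
    exact hemem a ha'

/-- Boundedness matters: a supremum of an unbounded set in ℕ would be 0. -/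
theorem le_Ex {σ S : List ℕ} (h : ¬ Contained σ S) (hs : Sparse (alphabetSize σ) S) :
    S.length ≤ Ex σ (alphabetSize S) := by
  refine le_csSup ⟨((alphabetSize S).choose (alphabetSize σ) * σ.length + 1) * alphabetSize σ, ?_⟩
    ⟨S, rfl, h, rfl, hs⟩
  rintro _ ⟨S', rfl, h', hn, hs'⟩
  by_contra! hcon
  exact h' (contained_of_sparse hs' (by rw [hn]; exact hcon.le))

/-- Padding with symbols that occur once. -/
theorem le_Ex_of_alphabetSize_le {σ : List ℕ} {c : ℕ} {τ : List ℕ} (hσ : σ = c :: (τ ++ [c]))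
    {S : List ℕ} {n : ℕ} (h : ¬ Contained σ S) (hs : Sparse (alphabetSize σ) S)
    (hn : alphabetSize S ≤ n) : S.length + (n - alphabetSize S) ≤ Ex σ n := by
  set v := List.range' (S.toFinset.sup id + 1) (n - alphabetSize S) with hv
  have hd : ∀ a ∈ v, a ∉ S := by
    intro a ha haS
    have h1 : a ≤ S.toFinset.sup id := Finset.le_sup (f := id) (List.mem_toFinset.2 haS)
    have h2 := (List.mem_range'_1.1 ha).1
    omega
  have hvn : v.Nodup := List.nodup_range'
  have hvl : v.length = n - alphabetSize S := List.length_range'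
  have hsz : alphabetSize (S ++ v) = n := by
    rw [alphabetSize_append_of_disjoint hd, alphabetSize.eq_1 v, List.toFinset_card_of_nodup hvn, hvl]
    omega
  have := le_Ex (σ := σ) (S := S ++ v)
    (fun hc => (hc.of_append hσ hd).elim h (not_contained_of_nodup hσ hvn))
    (hs.append (Sparse.of_nodup _ hvn) fun a ha hb => hd a ha ((List.drop_sublist _ _).subset hb))
  rwa [hsz, List.length_append, hvl] at this

theorem self_le_Ex {σ : List ℕ} {c : ℕ} {τ : List ℕ} (hσ : σ = c :: (τ ++ [c])) (n : ℕ) :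
    n ≤ Ex σ n := by
  have := le_Ex_of_alphabetSize_le hσ (S := []) (n := n) (not_contained_of_nodup hσ (by simp))
    (Sparse.of_nodup _ (by simp)) (by simp [alphabetSize])
  simpa [alphabetSize] using this

/-- Disjoint copies of one sequence. -/
theorem mul_length_le_Ex {σ : List ℕ} {c : ℕ} {τ : List ℕ} (hσ : σ = c :: (τ ++ [c]))
    {S : List ℕ} {t n : ℕ} (h : ¬ Contained σ S) (hs : Sparse (alphabetSize σ) S)
    (hn : t * alphabetSize S ≤ n) : t * S.length ≤ Ex σ n := by
  -- Copy number s uses the letters `Nat.pair s b`. The bound on the first component keeps the next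
  -- copy disjoint from the earlier ones.
  obtain ⟨W, hW, hWs, hWn, hWl, -⟩ : ∃ W : List ℕ, ¬ Contained σ W ∧
      Sparse (alphabetSize σ) W ∧ alphabetSize W ≤ t * alphabetSize S ∧ W.length = t * S.length ∧
      ∀ a ∈ W, a.unpair.1 < t := by
    clear hn
    induction t with
    | zero =>
      exact ⟨[], not_contained_of_nodup hσ (by simp), Sparse.of_nodup _ (by simp),
        by simp [alphabetSize]⟩
    | succ t ih =>
      obtain ⟨W, h1, h2, h3, h4, h5⟩ := ih
      have hinj : Function.Injective (Nat.pair t) := fun a b hab => (Nat.pair_eq_pair.1 hab).2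
      have hd : ∀ a ∈ S.map (Nat.pair t), a ∉ W := by
        intro a ha haW
        obtain ⟨b, -, rfl⟩ := List.mem_map.1 ha
        have := h5 _ haW
        simp at this
      refine ⟨W ++ S.map (Nat.pair t), ?_, ?_, ?_, ?_, ?_⟩
      · exact fun hc => (hc.of_append hσ hd).elim h1 fun hc => h (hc.of_map hinj.injOn)
      · exact h2.append (hs.map hinj) fun a ha hb => hd a ha ((List.drop_sublist _ _).subset hb)
      · rw [alphabetSize_append_of_disjoint hd, Nat.succ_mul]
        refine Nat.add_le_add h3 ?_
        rw [alphabetSize, show (S.map (Nat.pair t)).toFinset = S.toFinset.image (Nat.pair t) by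
          ext; simp]
        exact Finset.card_image_le
      · rw [List.length_append, List.length_map, h4, Nat.succ_mul]
      · intro a ha
        rcases List.mem_append.1 ha with ha | ha
        · exact (h5 a ha).trans (Nat.lt_succ_self t)
        · obtain ⟨b, -, rfl⟩ := List.mem_map.1 ha
          simp
  have := le_Ex_of_alphabetSize_le hσ hW hWs (hWn.trans hn)
  omega

end Extremal

/-! ### The lower bound in terms of the inverse Ackermann function -/

theorem mShape_eq_cons {k : ℕ} (hk : 1 ≤ k) : ∃ τ, mShape k = 1 :: (τ ++ [1]) := by
  obtain ⟨k, rfl⟩ : ∃ m, k = m + 1 := ⟨k - 1, by omega⟩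
  refine ⟨List.range' 2 (k + 1) ++ (List.range' 1 (k + 1)).reverse ++ List.range' 2 (k + 1) ++
    (List.range' 2 k).reverse, ?_⟩
  rw [mShape, show List.range' 1 (k + 1 + 1) = 1 :: List.range' 2 (k + 1) from List.range'_succ,
    show (List.range' 1 (k + 1)).reverse = (List.range' 2 k).reverse ++ [1] by
      rw [show List.range' 1 (k + 1) = 1 :: List.range' 2 k from List.range'_succ,
        List.reverse_cons]]
  simp

theorem pow_le_factorial_mul_choose {i : ℕ} (hi : 1 ≤ i) (k : ℕ) :
    i ^ (k + 1) ≤ (k + 1).factorial * (i - 1 + (k + 1)).choose (k + 1) := by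
  rw [← Nat.ascFactorial_eq_factorial_mul_choose, Nat.sub_add_cancel hi]
  exact Nat.pow_succ_le_ascFactorial i (k + 1)

/-- The sequences `T_π(i, 1)`, made sparse and repeated, bound the extremal function from below. -/
theorem mul_pow_le_Ex {σ : List ℕ} {c : ℕ} {τ : List ℕ} (hσ : σ = c :: (τ ++ [c]))
    {π : List Diag} {k i n : ℕ} (hπ : π.length = k + 3) (hi1 : 1 ≤ i)
    (hav : ¬ Contained σ (classI π i 1).word)
    (hi : 8 * (k + 1).factorial * alphabetSize σ ≤ i) (hn : (classI π i 1).numLive ≤ n) :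
    n * i ^ (k + 1) ≤ 4 * (k + 1).factorial * Ex σ n := by
  have hreg := regular_classI π i 1
  have hsize := hreg.alphabetSize_eq
  have hlen := length_word_classI π i 1 hi1
  have hdead := numDead_classI_le π i 1 (by omega) hi1
  have hblocks := length_eq_numLive_add_numDead (classI π i 1)
  have hpos := hreg.numLive_pos
  have hch := pow_le_factorial_mul_choose hi1 k
  rw [hπ, show k + 3 - 2 = k + 1 by omega] at hlen
  rw [hπ, Nat.add_sub_cancel] at hdead
  rw [one_mul] at hsize hlen hdead
  obtain ⟨S, hS, hsp, hSl⟩ := exists_sparse_sublist (alphabetSize σ)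
    ((classI π i 1).map Block.word) (by simpa using hreg.liveFirst.nodup)
  rw [← List.flatMap_def] at hS hSl
  change S.Sublist (classI π i 1).word at hS
  change (classI π i 1).word.length ≤ _ at hSl
  rw [List.length_map, hblocks] at hSl
  have hSav : ¬ Contained σ S := fun ⟨f, hf, hs⟩ => hav ⟨f, hf, hs.trans hS⟩
  have hSN : alphabetSize S ≤ (classI π i 1).numLive := by
    rw [← hsize]
    exact Finset.card_le_card fun a ha => List.mem_toFinset.2 (hS.subset (List.mem_toFinset.1 ha))
  generalize (classI π i 1).numLive = N at *
  generalize (classI π i 1).numDead = D at *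
  generalize (i - 1 + (k + 1)).choose (k + 1) = C at *
  generalize (k + 1).factorial = F at *
  rw [hlen] at hSl
  have hEx := mul_length_le_Ex hσ hSav hsp (t := n / N)
    ((Nat.mul_le_mul_left _ hSN).trans (Nat.div_mul_le_self n N))
  -- One live and at most 3 i^k dead blocks per symbol.
  have hD : N + D ≤ 4 * i ^ k * N := by
    have := Nat.mul_le_mul_right N (Nat.one_le_pow k i hi1)
    linarith
  -- The constant 8 in `hi` is 2 · 4: the deletions cost at most half of the main term.
  have h1 : 2 * (F * ((alphabetSize σ - 1) * (N + D))) ≤ i ^ (k + 1) * N := by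
    calc 2 * (F * ((alphabetSize σ - 1) * (N + D)))
        ≤ 2 * (F * (alphabetSize σ * (4 * i ^ k * N))) := by gcongr; omega
      _ = (8 * F * alphabetSize σ) * (i ^ k * N) := by ring
      _ ≤ i * (i ^ k * N) := by gcongr
      _ = _ := by ring
  have h2 : N * i ^ (k + 1) ≤ 2 * F * S.length := by
    have h3 := Nat.mul_le_mul_right N hch
    have h4 := Nat.mul_le_mul_left F hSl
    have h5 : F * ((C + 1) * N) = F * C * N + F * N := by ring
    have h6 : F * (S.length + (alphabetSize σ - 1) * (N + D)) =
      F * S.length + F * ((alphabetSize σ - 1) * (N + D)) := by ring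
    have h7 : 2 * F * S.length = 2 * (F * S.length) := by ring
    rw [mul_comm N]
    omega
  -- As N ≤ n, rounding down to a multiple of N loses at most half.
  have h3 : n ≤ 2 * (n / N * N) := by
    have h4 := Nat.lt_div_mul_add (a := n) hpos
    have h5 : 1 * N ≤ n / N * N := Nat.mul_le_mul_right N (Nat.div_pos hn hpos)
    omega
  calc n * i ^ (k + 1) ≤ 2 * (n / N * N) * i ^ (k + 1) := by gcongr
    _ = 2 * (n / N) * (N * i ^ (k + 1)) := by ring
    _ ≤ 2 * (n / N) * (2 * F * S.length) := by gcongr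
    _ = 4 * F * (n / N * S.length) := by ring
    _ ≤ _ := by gcongr

theorem ackermann_lt_of_lt_alpha {n i : ℕ} (hn : 1 ≤ n) (hi : 1 ≤ i) (h : i < alpha n) :
    ackermann i 3 < n := by
  have h1 := Nat.notMem_of_lt_sInf (s := {i : ℕ | 1 ≤ i ∧ n ≤ ackermann i (max (n ⌈/⌉ n) 3)}) h
  have h2 : max (n ⌈/⌉ n) 3 = 3 := by
    have : n ⌈/⌉ n = 1 := by
      rw [Nat.ceilDiv_eq_add_pred_div]
      exact Nat.div_eq_of_lt_le (by omega) (by omega)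
    rw [this]; rfl
  rw [h2] at h1
  by_contra hcon
  exact h1 ⟨hi, by omega⟩

/-- For large α(n) the construction is applied with i = α(n) − (k+5); for bounded α(n) the trivial
bound Ex(σ, n) ≥ n suffices. -/
theorem exists_mul_alpha_pow_le_Ex {σ : List ℕ} {c : ℕ} {τ : List ℕ} (hσ : σ = c :: (τ ++ [c]))
    {π : List Diag} {k : ℕ} (hπ : π.length = k + 3)
    (hav : ∀ i, ¬ Contained σ (classI π i 1).word) :
    ∃ C : ℕ, ∀ n, 1 ≤ n → n * alpha n ^ (k + 1) ≤ C * Ex σ n := by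
  set i₀ := 8 * (k + 1).factorial * alphabetSize σ
  -- Once α(n) ≥ A, the choice of i satisfies both α(n) ≤ 2i and i ≥ i₀.
  set A := 2 * (k + 5) + i₀ with hA
  refine ⟨A ^ (k + 1) + 2 ^ (k + 1) * (4 * (k + 1).factorial), fun n hn => ?_⟩
  rw [add_mul]
  by_cases hsmall : alpha n < A
  · refine le_trans ?_ (Nat.le_add_right _ _)
    rw [mul_comm]
    exact Nat.mul_le_mul (Nat.pow_le_pow_left hsmall.le _) (self_le_Ex hσ n)
  · refine le_trans ?_ (Nat.le_add_left _ _)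
    obtain ⟨i, hi⟩ : ∃ i, alpha n = i + (k + 5) := ⟨alpha n - (k + 5), by omega⟩
    -- The row is i + |π| = i+k+3. One more row turns the argument 6 into 3, and i+k+4 is still
    -- below α(n).
    have hN : (classI π i 1).numLive ≤ n := by
      have h1 := numLive_classI_le π i 1 (by omega)
      rw [hπ] at h1
      exact (h1.trans (ackermann_six_le (i + k + 2))).trans
        (ackermann_lt_of_lt_alpha (i := i + k + 4) hn (by omega) (by omega)).le
    have h2 := mul_pow_le_Ex hσ hπ (by omega) (hav i) (by omega) hN
    calc n * alpha n ^ (k + 1) ≤ n * (2 * i) ^ (k + 1) := by gcongr; omega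
      _ = 2 ^ (k + 1) * (n * i ^ (k + 1)) := by rw [mul_pow]; ring
      _ ≤ 2 ^ (k + 1) * (4 * (k + 1).factorial * Ex σ n) := by gcongr
      _ = _ := by ring

end GenDS

theorem mainTheorem5 :
    (∀ k : ℕ, 1 ≤ k → ∀ x y : GenDS.Diag, ∀ i j : ℕ, 1 ≤ i →
      ¬ GenDS.Contained (GenDS.mShape (2 ^ k))
        (GenDS.classI ([GenDS.Diag.up, x, y] ++ List.replicate k GenDS.Diag.up) i j).word) ∧
    (∀ k : ℕ, 1 ≤ k →
      (fun n : ℕ => (n : ℝ) * (GenDS.alpha n : ℝ) ^ (k + 1)) =O[Filter.atTop]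
        (fun n : ℕ => (GenDS.Ex (GenDS.mShape (2 ^ k)) n : ℝ))) := by
  have havoid : ∀ k : ℕ, 1 ≤ k → ∀ x y : GenDS.Diag, ∀ i j : ℕ,
      ¬ GenDS.Contained (GenDS.mShape (2 ^ k))
        (GenDS.classI ([GenDS.Diag.up, x, y] ++ List.replicate k GenDS.Diag.up) i j).word := by
    intro k hk x y i j
    obtain ⟨m, rfl⟩ : ∃ m, k = m + 1 := ⟨k - 1, by omega⟩
    exact GenDS.classI_avoids m x y i j
  refine ⟨fun k hk x y i j _ => havoid k hk x y i j, fun k hk => ?_⟩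
  obtain ⟨τ, hτ⟩ := GenDS.mShape_eq_cons (Nat.one_le_two_pow (n := k))
  -- The two free letters of π are immaterial here, and only |π| = k+3 enters the count; both are
  -- taken to be ↗.
  obtain ⟨C, hC⟩ := GenDS.exists_mul_alpha_pow_le_Ex hτ (k := k)
    (by simp) fun i => havoid k hk .up .up i 1
  refine Asymptotics.IsBigO.of_bound (C : ℝ) ?_
  filter_upwards [Filter.eventually_ge_atTop 1] with n hn
  rw [Real.norm_of_nonneg (by positivity), Real.norm_of_nonneg (by positivity)]
  exact_mod_cast hC n hn
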